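/- Let $k$ be a field of characteristic $p>0$, let $n,m\ge 0$, put $A=k[[x_1,\dots,x_n]]$ and $B=k[[y_1,\dots,y_m]]$ with maximal ideals $\mathfrak m_A,\mathfrak m_B$, and let $\varphi:A\to B$ be a homomorphism of $k$-algebras (it is automatically local). *Admissible transformations.* A homomorphism of $k$-algebras $\overline\varphi:A\to B$ is an admissible transformation of $\varphi$ if it is related to $\varphi$ in one of the following ways: 1. (automorphisms) $\overline\varphi=\sigma\circ\varphi\circ\tau$ for some $k$-automorphisms $\tau$ of $A$ and $\sigma$ of $B$; 2. (blowing-up) $\overline\varphi=\psi\circ\varphi$, where for some $l\in\{1,\dots,m-1\}$ the $k$-endomorphism $\psi$ of $B$ is given by $\psi(y_i)=y_i$ for $i\le l$ and $\psi(y_i)=y_l\,y_i$ for $i>l$; 3. (ramification) $\varphi=\overline\varphi\circ\psi_d$, where for some integer $d\ge 1$ the $k$-endomorphism $\psi_d$ of $A$ is given by $\psi_d(x_1)=x_1^d$ and $\psi_d(x_i)=x_i$ for $i\ne 1$; 4. (contraction) $\varphi=\overline\varphi\circ\psi$, where for some $l\in\{1,\dots,n-1\}$ the $k$-endomorphism $\psi$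 of $A$ is given by $\psi(x_i)=x_i$ for $i\le l$ and $\psi(x_i)=x_i\,x_l$ for $i>l$. *Geometric rank.* Let $\nu$ be the valuation on the fraction field of $A/\ker\varphi$ induced by $f\mapsto \operatorname{ord}(\varphi(f))$, where $\operatorname{ord}$ is the $\mathfrak m_B$-adic order on $B$, and let $k_\nu$ be the residue field of its valuation ring. If $\varphi(\mathfrak m_A)\neq 0$, put $\operatorname{grk}\varphi:=\operatorname{tr.deg}_k k_\nu+1$; if $\varphi(\mathfrak m_A)=0$, put $\operatorname{grk}\varphi:=0$. For $f\in B$, let $\operatorname{in}(f)$ denote its initial form (the nonzero homogeneous component of $f$ of lowest degree, and $0$ if $f=0$), and let $B^p=\{v^p : v\in B\}$. **Theorem.** One has $\operatorname{grk}\varphi\le\min(n,m)$, and there is a finite sequence of homomorphisms of $k$-algebras $\varphi=\varphi_0,\varphi_1,\dots,\varphi_N:A\to B$, each $\varphi_{j+1}$ being an admissible transformation of $\varphi_j$, such that $$\varphi_N(x_i)=y_i^{p^{\alpha_i}}u_i\quad\text{for } i\le \operatorname{grk}\varphi,\qquad \varphi_N(x_i)=0\quad\text{for } i>\operatorname{grk}\varphi,$$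 for some integers $\alpha_i\ge 0$ and some units $u_i$ of $B$. Moreover, for each $i\le\operatorname{grk}\varphi$: if $\alpha_i=0$ then $u_i=1$; if $\alpha_i>0$ then $\operatorname{in}(u_i)=1$ and $u_i\notin B^p$. -/

import Mathlib

namespace QuasiMonomial

/-- The ring of formal power series in `n` variables over `k`. The variables are
`MvPowerSeries.X i` for `i : Fin n`, numbered from `0` to `n - 1`. -/
abbrev PS (k : Type*) [Field k] (n : ℕ) : Type _ := MvPowerSeries (Fin n) k

/-- The initial form of `f`: its nonzero homogeneous component of lowest degree
(and `0` if `f = 0`), i.e. the image of `f` in the associated graded ring of the power series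
ring with respect to its maximal ideal, that graded ring being the polynomial ring. -/
noncomputable def initialForm {k : Type*} [Field k] {n : ℕ} (f : PS k n) : PS k n :=
  MvPowerSeries.homogeneousComponent f.order.toNat f

/-- Admissible transformations: `IsAdmissible φ φ'` says that `φ'` is obtained from `φ` by one
modification. A `k`-algebra homomorphism between formal power series rings in finitely many
variables is automatically local and continuous, so that `ψ` is determined in each case by the
given values on the variables. -/
inductive IsAdmissible {k : Type*} [Field k] {n m : ℕ} :
    (PS k n →ₐ[k] PS k m) → (PS k n →ₐ[k] PS k m) → Prop
  /-- Modification by automorphisms of the source and of the target. -/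
  | automorphisms (φ : PS k n →ₐ[k] PS k m) (τ : PS k n ≃ₐ[k] PS k n) (σ : PS k m ≃ₐ[k] PS k m) :
      IsAdmissible φ ((σ.toAlgHom.comp φ).comp τ.toAlgHom)
  /-- Modification by blowing-up, with respect to a variable of the target
  that is not the last one. -/
  | blowingUp (φ : PS k n →ₐ[k] PS k m) (ψ : PS k m →ₐ[k] PS k m) (l : Fin m)
      (hl : (l : ℕ) + 1 < m)
      (h_le : ∀ i : Fin m, i ≤ l → ψ (MvPowerSeries.X i) = MvPowerSeries.X i)
      (h_gt : ∀ i : Fin m, l < i →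
        ψ (MvPowerSeries.X i) = MvPowerSeries.X l * MvPowerSeries.X i) :
      IsAdmissible φ (ψ.comp φ)
  /-- Modification by ramification: the first variable is sent to its `d`-th power. -/
  | ramification (φ' : PS k n →ₐ[k] PS k m) (ψ : PS k n →ₐ[k] PS k n) (d : ℕ) (hd : 0 < d)
      (h_first : ∀ i : Fin n, (i : ℕ) = 0 → ψ (MvPowerSeries.X i) = MvPowerSeries.X i ^ d)
      (h_other : ∀ i : Fin n, (i : ℕ) ≠ 0 → ψ (MvPowerSeries.X i) = MvPowerSeries.X i) :
      IsAdmissible (φ'.comp ψ) φ'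
  /-- Modification by contraction, with respect to a variable of the source
  that is not the last one. -/
  | contraction (φ' : PS k n →ₐ[k] PS k m) (ψ : PS k n →ₐ[k] PS k n) (l : Fin n)
      (hl : (l : ℕ) + 1 < n)
      (h_le : ∀ i : Fin n, i ≤ l → ψ (MvPowerSeries.X i) = MvPowerSeries.X i)
      (h_gt : ∀ i : Fin n, l < i →
        ψ (MvPowerSeries.X i) = MvPowerSeries.X i * MvPowerSeries.X l) :
      IsAdmissible (φ'.comp ψ) φ'

/-- The `𝔪`-adic valuation of the power series ring, written multiplicatively:
the value of `f ≠ 0` is `exp (-ord f)`. -/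
noncomputable def orderValuation (k : Type*) [Field k] (m : ℕ) :
    Valuation (PS k m) (WithZero (Multiplicative ℤ)) where
  toFun f := open Classical in
    if f = 0 then 0 else WithZero.exp (-((MvPowerSeries.order f).toNat : ℤ))
  map_zero' := by simp
  map_one' := by
    have h : (1 : PS k m).order = 0 := MvPowerSeries.weightedOrder_one _
    simp [h]
  map_mul' f g := by
    by_cases hf : f = 0
    · simp [hf]
    by_cases hg : g = 0
    · simp [hg]
    have hf' : f.order ≠ ⊤ := by simpa using hf
    have hg' : g.order ≠ ⊤ := by simpa using hg
    simp only [hf, hg, mul_eq_zero, or_self, if_false]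
    rw [MvPowerSeries.order_mul, ENat.toNat_add hf' hg', ← WithZero.exp_add]
    congr 1
    push_cast
    ring
  map_add_le_max' f g := by
    by_cases hf : f = 0
    · subst hf
      rw [zero_add]
      exact le_sup_right
    by_cases hg : g = 0
    · subst hg
      rw [add_zero]
      exact le_sup_left
    by_cases hfg : f + g = 0
    · simp [hfg]
    have hf' : f.order ≠ ⊤ := by simpa using hf
    have hg' : g.order ≠ ⊤ := by simpa using hg
    have hfg' : (f + g).order ≠ ⊤ := by simpa using hfg
    simp only [hf, hg, hfg, if_false]
    have h := MvPowerSeries.min_order_le_add (f := f) (g := g)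
    rw [le_max_iff, WithZero.exp_le_exp, WithZero.exp_le_exp]
    rcases min_le_iff.mp h with h | h
    · left
      have := ENat.toNat_le_toNat h hfg'
      omega
    · right
      have := ENat.toNat_le_toNat h hfg'
      omega

theorem orderValuation_le_one {k : Type*} [Field k] {m : ℕ} (f : PS k m) :
    orderValuation k m f ≤ 1 := by
  classical
  change (if f = 0 then 0 else WithZero.exp (-((MvPowerSeries.order f).toNat : ℤ))) ≤ _
  split_ifs
  · exact zero_le_one
  · rw [← WithZero.exp_zero, WithZero.exp_le_exp]
    omega

theorem orderValuation_ne_zero {k : Type*} [Field k] {m : ℕ} {f : PS k m} (hf : f ≠ 0) :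
    orderValuation k m f ≠ 0 := by
  classical
  change (if f = 0 then 0 else WithZero.exp (-((MvPowerSeries.order f).toNat : ℤ))) ≠ _
  rw [if_neg hf]
  exact WithZero.exp_ne_zero

section GeometricRank

variable {k : Type*} [Field k] {n m : ℕ} (φ : PS k n →ₐ[k] PS k m)

/-- The coimage `A ⧸ ker φ` (it is `A` itself if `φ` is injective). -/
abbrev Coimage : Type _ := PS k n ⧸ RingHom.ker φ

instance instIsDomainCoimage : IsDomain (Coimage φ) :=
  haveI : IsDomain (PS k m) := NoZeroDivisors.to_isDomain _
  haveI := RingHom.ker_isPrime φ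
  Ideal.Quotient.isDomain _

/-- The valuation induced on `A ⧸ ker φ` by `f ↦ ord (φ f)`. -/
noncomputable def coimageValuation :
    Valuation (Coimage φ) (WithZero (Multiplicative ℤ)) :=
  (orderValuation k m).comap (Ideal.kerLiftAlg φ).toRingHom

theorem nonZeroDivisors_le_primeCompl :
    nonZeroDivisors (Coimage φ) ≤ (coimageValuation φ).supp.primeCompl := by
  intro x hx hx0
  have h0 : coimageValuation φ x = 0 := hx0
  refine orderValuation_ne_zero (k := k) (m := m) (f := Ideal.kerLiftAlg φ x) ?_ h0
  intro h
  exact nonZeroDivisors.ne_zero hx (Ideal.kerLiftAlg_injective φ (h.trans (map_zero _).symm))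

/-- The valuation `ν` induced by `f ↦ ord (φ f)` on the fraction field of `A ⧸ ker φ`. -/
noncomputable def inducedValuation :
    Valuation (FractionRing (Coimage φ)) (WithZero (Multiplicative ℤ)) :=
  (coimageValuation φ).extendToLocalization (nonZeroDivisors_le_primeCompl φ) _

theorem inducedValuation_algebraMap_le_one (c : k) :
    inducedValuation φ (algebraMap k (FractionRing (Coimage φ)) c) ≤ 1 := by
  rw [IsScalarTower.algebraMap_apply k (Coimage φ) (FractionRing (Coimage φ)) c]
  refine (Valuation.extendToLocalization_apply_map_apply _ _ _ _).trans_le ?_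
  exact orderValuation_le_one _

/-- The residue field `A_ν ⧸ 𝔪_ν` of the valuation ring of `ν`. -/
abbrev ValuationResidueField : Type _ :=
  IsLocalRing.ResidueField (inducedValuation φ).valuationSubring

/-- The residue field of `ν` is an extension of `k`. -/
noncomputable instance instAlgebraResidueField : Algebra k (ValuationResidueField φ) :=
  ((IsLocalRing.residue (inducedValuation φ).valuationSubring).comp
    ((algebraMap k (FractionRing (Coimage φ))).codRestrict
      (inducedValuation φ).valuationSubring
      (inducedValuation_algebraMap_le_one φ))).toAlgebra

open Classical in
/-- The geometric rank of `φ`: it is `1` plus the transcendence degree over `k` of the residue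
field of the valuation `ν`, and `0` if `φ` vanishes on the maximal ideal
(in which case `ν` is trivial). The transcendence degree is finite by Abhyankar's inequality. -/
noncomputable def geometricRank : ℕ :=
  if ∀ f : PS k n, f ∈ IsLocalRing.maximalIdeal (PS k n) → φ f = 0 then 0
  else Cardinal.toNat (Algebra.trdeg k (ValuationResidueField φ)) + 1

end GeometricRank

end QuasiMonomial

/-! The geometric rank is read off from the Hilbert–Samuel function `H_φ(N) = dim_k A / {f : ord
φ(f) ≥ N}` (`hilbertFunction`). `Growth φ r` says that `H_φ` grows like `N ^ r`, up to constant
factors and linear rescaling of `N`.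

Reduction to the normal form (`exists_diag`, `exists_normalForm`). Suppose the first `s` variables
`x_i` are already sent to `y_i ^ p ^ α_i` times units (`Diag`). The induction is lexicographic on
`(m - s, ∑ α_i)`. Let `x_t` be a further variable with nonzero image. Subtracting a series in the
first `s` variables (`exists_division`) removes from `φ(x_t)` all monomials in the `y_i ^ p ^ α_i`.
Blowing-ups (`Diag.exists_min`) give `φ(x_t) = y^β f`, where `f` contains a monomial free of `y_1,
..., y_s`. If `f` is a unit, some `p ^ α_i` does not divide `β_i`, and `Diag.exists_sum_lt` turns
`φ(x_t)` into a unit times `y_i ^ p ^ v` with `v < α_i`, which takes the place of `φ(x_i)`. If `f`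
is not a unit, `exists_purify` makes it a power of a new variable times a unit. Then either `s`
increases, or that variable is traded for a power of some `y_i` and `∑ α_i` drops as before.
Ramification takes roots of order prime to `p` of units, by Hensel; hence `p`-power exponents
remain. Choosing `∑ α_i` minimal prevents the remaining units from being `p`-th powers.

Rank. Every step used carries the growth of its result back to its source (`Step`); for contractions
this needs that the pivot variable is not killed. The normal form with `r` variables has growth `r`
(`growth_of_diag`), hence so has `φ`, and `Growth.geometricRank_eq` shows that `r` is the geometric
rank. For one inequality, `t` algebraically independent residues together with an element of
positive order span enough to force `t + 1 ≤ r`. For the other, growth `r` yields `r` algebraically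
independent leading forms in the image; after equalizing their degrees, the quotients by one of them
have `r - 1` independent residues. -/

namespace QuasiMonomial

open MvPowerSeries

/-! ### Automatic continuity of homomorphisms and coefficients of images -/

section Basics

variable {k : Type*} [Field k] {n m : ℕ}

theorem isUnit_iff_constantCoeff_ne_zero {f : PS k n} : IsUnit f ↔ constantCoeff f ≠ 0 := by
  rw [MvPowerSeries.isUnit_iff_constantCoeff, isUnit_iff_ne_zero]

/-- A homomorphism of `k`-algebras between power series rings preserves constant terms. -/
theorem constantCoeff_algHom (φ : PS k n →ₐ[k] PS k m) (f : PS k n) :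
    constantCoeff (φ f) = constantCoeff f := by
  by_contra h
  -- If the constant terms differed, subtracting that of `φ f` from `f` would give a unit whose
  -- image is not a unit.
  have hu : IsUnit (f - C (constantCoeff (φ f))) := by
    rw [isUnit_iff_constantCoeff_ne_zero, map_sub, constantCoeff_C, sub_ne_zero]
    exact Ne.symm h
  have h2 := hu.map φ
  rw [isUnit_iff_constantCoeff_ne_zero, map_sub] at h2
  apply h2
  have : (C (constantCoeff (φ f)) : PS k n) = algebraMap k (PS k n) (constantCoeff (φ f)) := rfl
  rw [this, AlgHom.commutes]
  have : algebraMap k (PS k m) (constantCoeff (φ f)) = C (constantCoeff (φ f)) := rfl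
  rw [this, map_sub, constantCoeff_C, sub_self]

/-- A power series with prescribed coefficients. -/
def ofCoeff (c : (Fin n →₀ ℕ) → k) : PS k n := c

@[simp]
theorem coeff_ofCoeff (c : (Fin n →₀ ℕ) → k) (e : Fin n →₀ ℕ) : coeff e (ofCoeff c) = c e := rfl

theorem exists_eq_sum_monomial_mul {N : ℕ} {f : PS k n} (hf : (N : ℕ∞) ≤ f.order) :
    ∃ g : (Fin n →₀ ℕ) → PS k n,
      f = ∑ e ∈ (Finsupp.finite_of_degree_eq (σ := Fin n) N).toFinset,
        monomial e (1 : k) * g e := by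
  classical
  have hc : ∀ d : Fin n →₀ ℕ, ∃ e, N ≤ d.degree → e ≤ d ∧ e.degree = N := by
    intro d
    by_cases h : N ≤ d.degree
    · obtain ⟨e, h1, h2⟩ := Finsupp.exists_le_degree_eq d N h
      exact ⟨e, fun _ => ⟨h1, h2⟩⟩
    · exact ⟨0, fun h' => absurd h' h⟩
  choose c hc using hc
  -- Each monomial of `f` is assigned to the single divisor of degree `N` selected by `c`, so it is
  -- counted exactly once.
  refine ⟨fun e => ofCoeff fun d => if c (d + e) = e then coeff (d + e) f else 0, ?_⟩
  ext d
  rw [map_sum]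
  simp only [coeff_monomial_mul, one_mul, coeff_ofCoeff]
  by_cases hd : N ≤ d.degree
  · obtain ⟨h1, h2⟩ := hc d hd
    rw [Finset.sum_eq_single (c d)]
    · rw [if_pos h1, tsub_add_cancel_of_le h1, if_pos rfl]
    · intro e _ he
      by_cases hle : e ≤ d
      · rw [if_pos hle, tsub_add_cancel_of_le hle, if_neg (Ne.symm he)]
      · rw [if_neg hle]
    · intro h
      simp [h2] at h
  · rw [Finset.sum_eq_zero, coeff_of_lt_order]
    · push Not at hd
      exact lt_of_lt_of_le (by exact_mod_cast hd) hf
    · intro e he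
      rw [if_neg]
      intro hle
      simp at he
      exact hd (he ▸ Finsupp.degree_mono hle)

theorem le_order_sum {ι : Type*} (s : Finset ι) (g : ι → PS k n) (N : ℕ∞)
    (h : ∀ i ∈ s, N ≤ (g i).order) : N ≤ (∑ i ∈ s, g i).order := by
  classical
  induction s using Finset.induction_on with
  | empty => simp
  | insert a s ha ih =>
    rw [Finset.sum_insert ha]
    exact le_trans (le_min (h a (by simp)) (ih fun i hi => h i (by simp [hi])))
      min_order_le_add

theorem algHom_monomial (φ : PS k n →ₐ[k] PS k m) (e : Fin n →₀ ℕ) :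
    φ (monomial e 1) = ∏ i, φ (X i) ^ e i := by
  rw [monomial_one_eq, Finsupp.prod_fintype _ _ (by simp), map_prod]
  simp

theorem degree_le_order_algHom_monomial (φ : PS k n →ₐ[k] PS k m) (e : Fin n →₀ ℕ) :
    (e.degree : ℕ∞) ≤ (φ (monomial e 1)).order := by
  rw [algHom_monomial, Finsupp.degree_eq_sum]
  refine le_trans ?_ (le_order_prod _ _)
  push_cast
  refine Finset.sum_le_sum fun i _ => le_order_pow_of_constantCoeff_eq_zero _ ?_
  rw [constantCoeff_algHom, constantCoeff_X]

/-- This is the automatic continuity: an element of order at least `N` is a finite combination of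
monomials of degree `N`, and each variable goes to a series without constant term. -/
theorem order_le_order_algHom (φ : PS k n →ₐ[k] PS k m) (f : PS k n) :
    f.order ≤ (φ f).order := by
  have key : ∀ N : ℕ, (N : ℕ∞) ≤ f.order → (N : ℕ∞) ≤ (φ f).order := by
    intro N hN
    obtain ⟨g, hg⟩ := exists_eq_sum_monomial_mul hN
    rw [hg, map_sum]
    refine le_order_sum _ _ _ fun e he => ?_
    simp only [Set.Finite.mem_toFinset, Set.mem_ofPred_eq] at he
    rw [map_mul]
    refine le_trans ?_ le_order_mul
    rw [← he]
    exact le_trans (degree_le_order_algHom_monomial φ e) le_self_add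
  exact ENat.forall_natCast_le_iff_le.mp key

theorem exists_truncation (f : PS k n) (N : ℕ) :
    (N : ℕ∞) ≤ (f - ∑ e ∈ (Finsupp.finite_of_degree_lt (σ := Fin n) N).toFinset,
        monomial e (coeff e f)).order := by
  classical
  apply nat_le_order
  intro d hd
  rw [map_sub, map_sum, Finset.sum_eq_single d]
  · simp
  · intro e _ he
    rw [coeff_monomial, if_neg (Ne.symm he)]
  · intro h
    simp at h
    omega

theorem algHom_monomial_smul (φ : PS k n →ₐ[k] PS k m) (e : Fin n →₀ ℕ) (c : k) :
    φ (monomial e c) = c • φ (monomial e 1) := by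
  rw [← map_smul, ← map_smul, smul_eq_mul, mul_one]

/-- Coefficients of the image of a power series under a homomorphism. -/
theorem coeff_algHom (φ : PS k n →ₐ[k] PS k m) (f : PS k n) (d : Fin m →₀ ℕ)
    (S : Finset (Fin n →₀ ℕ))
    (hS : ∀ e, e ∉ S → coeff e f * coeff d (φ (monomial e 1)) = 0) :
    coeff d (φ f) = ∑ e ∈ S, coeff e f * coeff d (φ (monomial e 1)) := by
  classical
  -- Monomials of degree above that of `d` do not contribute, so the sum over `T` is correct; it
  -- agrees with the sum over `S` because both extend by zero to `S ∪ T`.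
  set N := d.degree + 1
  set T := (Finsupp.finite_of_degree_lt (σ := Fin n) N).toFinset with hT
  have h1 : coeff d (φ f) = ∑ e ∈ T, coeff e f * coeff d (φ (monomial e 1)) := by
    have h := le_trans (exists_truncation f N) (order_le_order_algHom φ _)
    have h0 := coeff_of_lt_order (d := d) (lt_of_lt_of_le (by simp [N]; norm_cast; omega) h)
    rw [map_sub, map_sub, sub_eq_zero] at h0
    rw [h0, map_sum, map_sum]
    refine Finset.sum_congr rfl fun e _ => ?_
    rw [algHom_monomial_smul, map_smul, smul_eq_mul]
  have h2 : ∀ e, e ∉ T → coeff e f * coeff d (φ (monomial e 1)) = 0 := by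
    intro e he
    rw [coeff_of_lt_order (f := φ (monomial e 1)), mul_zero]
    refine lt_of_lt_of_le ?_ (degree_le_order_algHom_monomial φ e)
    simp [hT, N] at he
    norm_cast
  rw [h1, Finset.sum_subset (Finset.subset_union_left (s₂ := S)) (fun e _ he => h2 e he),
    Finset.sum_subset (Finset.subset_union_right (s₁ := T)) (fun e _ he => hS e he)]

theorem algHom_ext_X {φ ψ : PS k n →ₐ[k] PS k m} (h : ∀ i, φ (X i) = ψ (X i)) : φ = ψ := by
  refine AlgHom.ext fun f => ?_
  ext d
  set S := (Finsupp.finite_of_degree_lt (σ := Fin n) (d.degree + 1)).toFinset with hS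
  have h2 : ∀ (χ : PS k n →ₐ[k] PS k m) e, e ∉ S → coeff e f * coeff d (χ (monomial e 1)) = 0 := by
    intro χ e he
    rw [coeff_of_lt_order (f := χ (monomial e 1)), mul_zero]
    refine lt_of_lt_of_le ?_ (degree_le_order_algHom_monomial χ e)
    simp [hS] at he
    norm_cast
  rw [coeff_algHom φ f d S (h2 φ), coeff_algHom ψ f d S (h2 ψ)]
  simp only [algHom_monomial, h]

theorem exists_algHom_X (f : Fin n → PS k m) (hf : ∀ i, constantCoeff (f i) = 0) :
    ∃ φ : PS k n →ₐ[k] PS k m, ∀ i, φ (X i) = f i :=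
  ⟨substAlgHom (hasSubst_of_constantCoeff_zero hf), fun i => substAlgHom_X _ i⟩

theorem constantCoeff_algHom_X (φ : PS k n →ₐ[k] PS k m) (i : Fin n) :
    constantCoeff (φ (X i)) = 0 := by
  rw [constantCoeff_algHom, constantCoeff_X]

/-- An endomorphism that sends every variable to a monomial permutes the monomials. -/
theorem coeff_monomial_algHom (ψ : PS k n →ₐ[k] PS k m) (T : (Fin n →₀ ℕ) → (Fin m →₀ ℕ))
    (hψ : ∀ e, ψ (monomial e 1) = monomial (T e) 1) (hT : Function.Injective T)
    (f : PS k n) (e : Fin n →₀ ℕ) : coeff (T e) (ψ f) = coeff e f := by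
  classical
  rw [coeff_algHom ψ f (T e) {e}]
  · simp [hψ]
  · intro e' he'
    rw [hψ, coeff_monomial, if_neg, mul_zero]
    intro h
    exact he' (by simp [hT h])

theorem exists_of_coeff_monomial_algHom_ne_zero (ψ : PS k n →ₐ[k] PS k m)
    (T : (Fin n →₀ ℕ) → (Fin m →₀ ℕ))
    (hψ : ∀ e, ψ (monomial e 1) = monomial (T e) 1)
    (f : PS k n) (d : Fin m →₀ ℕ) (hd : coeff d (ψ f) ≠ 0) :
    ∃ e, T e = d ∧ coeff e f ≠ 0 := by
  classical
  by_contra! h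
  apply hd
  rw [coeff_algHom ψ f d ∅]
  · simp
  · intro e _
    by_cases hTe : T e = d
    · rw [h e hTe, zero_mul]
    · rw [hψ, coeff_monomial, if_neg (Ne.symm hTe), mul_zero]

end Basics

open Module

/-! ### A dimension comparison -/

section LinearAlgebra

/-- `V` is a quotient of the range of `l`. All comparisons of Hilbert functions below are instances.
-/
theorem finrank_le_of_ker_le {k W V U : Type*} [Field k] [AddCommGroup W] [Module k W]
    [AddCommGroup V] [Module k V] [AddCommGroup U] [Module k U] [Module.Finite k U]
    (q : W →ₗ[k] V) (hq : Function.Surjective q) (l : W →ₗ[k] U)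
    (h : ∀ w, l w = 0 → q w = 0) :
    Module.Finite k V ∧ finrank k V ≤ finrank k U := by
  have h' : LinearMap.ker l ≤ LinearMap.ker q := fun w hw => h w hw
  let g : LinearMap.range l →ₗ[k] V :=
    ((LinearMap.ker l).liftQ q h').comp l.quotKerEquivRange.symm.toLinearMap
  have hg : Function.Surjective g := by
    intro v
    obtain ⟨w, rfl⟩ := hq v
    refine ⟨l.quotKerEquivRange (Submodule.Quotient.mk w), ?_⟩
    simp [g]
  have hf : Module.Finite k V := Module.Finite.of_surjective g hg
  refine ⟨hf, ?_⟩
  have h1 := LinearMap.finrank_range_le g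
  rw [LinearMap.range_eq_top.mpr hg, finrank_top] at h1
  exact h1.trans (Submodule.finrank_le _)

end LinearAlgebra

/-! ### The Hilbert–Samuel function and its behaviour under admissible transformations -/

section Growth

variable {k : Type*} [Field k] {n m : ℕ}

/-- The elements whose image has order at least `N`. -/
def orderKernel (φ : PS k n →ₐ[k] PS k m) (N : ℕ) : Submodule k (PS k n) where
  carrier := {f | (N : ℕ∞) ≤ (φ f).order}
  add_mem' {f g} hf hg := by
    rw [Set.mem_ofPred_eq] at hf hg ⊢
    rw [map_add]
    exact (le_min hf hg).trans min_order_le_add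
  zero_mem' := by simp
  smul_mem' c f hf := by
    rw [Set.mem_ofPred_eq] at hf ⊢
    rw [map_smul]
    exact hf.trans le_order_smul

theorem mem_orderKernel {φ : PS k n →ₐ[k] PS k m} {N : ℕ} {f : PS k n} :
    f ∈ orderKernel φ N ↔ (N : ℕ∞) ≤ (φ f).order := Iff.rfl

/-- The Hilbert–Samuel function of the order filtration induced by a homomorphism. -/
noncomputable def hilbertFunction (φ : PS k n →ₐ[k] PS k m) (N : ℕ) : ℕ :=
  finrank k (PS k n ⧸ orderKernel φ N)

theorem finrank_quotient_le_card (K : Submodule k (PS k n)) (S : Finset (Fin n →₀ ℕ))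
    (h : ∀ f : PS k n, (∀ e ∈ S, coeff e f = 0) → f ∈ K) :
    Module.Finite k (PS k n ⧸ K) ∧ finrank k (PS k n ⧸ K) ≤ S.card := by
  have := finrank_le_of_ker_le K.mkQ K.mkQ_surjective
    (LinearMap.pi fun e : S => coeff (R := k) (e : Fin n →₀ ℕ)) (fun f hf => by
      rw [Submodule.mkQ_apply, Submodule.Quotient.mk_eq_zero]
      exact h f fun e he => congrFun hf ⟨e, he⟩)
  refine ⟨this.1, this.2.trans (by simp)⟩

instance finite_quotient_orderKernel (φ : PS k n →ₐ[k] PS k m) (N : ℕ) :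
    Module.Finite k (PS k n ⧸ orderKernel φ N) := by
  refine (finrank_quotient_le_card _ (Finsupp.finite_of_degree_lt (σ := Fin n) N).toFinset
    fun f hf => ?_).1
  refine le_trans (nat_le_order fun d hd => hf d ?_) (order_le_order_algHom φ f)
  simpa using hd

/-- The auxiliary space `W` makes it possible to compare through representatives only, for instance
truncations: `q` has to be surjective merely modulo elements of order `N`. -/
theorem hilbertFunction_le {n' m' : ℕ} {W : Type*} [AddCommGroup W] [Module k W]
    {φ : PS k n →ₐ[k] PS k m} {φ' : PS k n' →ₐ[k] PS k m'} {N N' : ℕ}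
    (q : W →ₗ[k] PS k n) (hq : ∀ f, ∃ w, (N : ℕ∞) ≤ (φ (f - q w)).order)
    (l : W →ₗ[k] PS k n')
    (h : ∀ w, (N' : ℕ∞) ≤ (φ' (l w)).order → (N : ℕ∞) ≤ (φ (q w)).order) :
    hilbertFunction φ N ≤ hilbertFunction φ' N' := by
  refine (finrank_le_of_ker_le ((orderKernel φ N).mkQ.comp q) ?_
    ((orderKernel φ' N').mkQ.comp l) ?_).2
  · intro v
    obtain ⟨f, rfl⟩ := (orderKernel φ N).mkQ_surjective v
    obtain ⟨w, hw⟩ := hq f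
    refine ⟨w, ?_⟩
    rw [LinearMap.comp_apply, Submodule.mkQ_apply, Submodule.mkQ_apply, eq_comm,
      Submodule.Quotient.eq]
    exact hw
  · intro w hw
    rw [LinearMap.comp_apply, Submodule.mkQ_apply, Submodule.Quotient.mk_eq_zero] at hw ⊢
    exact h w hw

theorem hilbertFunction_le_of_linearMap {n' m' : ℕ}
    {φ : PS k n →ₐ[k] PS k m} {φ' : PS k n' →ₐ[k] PS k m'} {N N' : ℕ}
    (l : PS k n →ₗ[k] PS k n')
    (h : ∀ w, (N' : ℕ∞) ≤ (φ' (l w)).order → (N : ℕ∞) ≤ (φ w).order) :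
    hilbertFunction φ N ≤ hilbertFunction φ' N' :=
  hilbertFunction_le LinearMap.id (fun f => ⟨f, by simp⟩) l h

theorem hilbertFunction_mono (φ : PS k n →ₐ[k] PS k m) {N N' : ℕ} (h : N ≤ N') :
    hilbertFunction φ N ≤ hilbertFunction φ N' :=
  hilbertFunction_le_of_linearMap LinearMap.id fun w hw =>
    le_trans (by exact_mod_cast h) hw

/-- The Hilbert–Samuel function grows like a polynomial of degree `r`. -/
def Growth (φ : PS k n →ₐ[k] PS k m) (r : ℕ) : Prop :=
  (∃ c : ℕ, ∀ M : ℕ, 0 < M → M ^ r ≤ c * hilbertFunction φ (c * M)) ∧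
    ∃ c : ℕ, ∀ N : ℕ, hilbertFunction φ N ≤ c * (N + 1) ^ r

/-- The exponent of polynomial growth is insensitive to bounded factors and to linear rescaling of
the argument. -/
theorem Growth.of_le {φ φ' : PS k n →ₐ[k] PS k m} {r : ℕ} (h : Growth φ' r) (a b c : ℕ)
    (h1 : ∀ N, hilbertFunction φ N ≤ hilbertFunction φ' (a * N))
    (h2 : ∀ N, hilbertFunction φ' N ≤ b * hilbertFunction φ (c * N)) : Growth φ r := by
  obtain ⟨⟨c₁, hc₁⟩, c₂, hc₂⟩ := h
  refine ⟨⟨c₁ * b + c * c₁, fun M hM => (hc₁ M hM).trans ?_⟩, c₂ * (a + 1) ^ r, fun N => ?_⟩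
  · calc c₁ * hilbertFunction φ' (c₁ * M)
        ≤ c₁ * (b * hilbertFunction φ (c * (c₁ * M))) := Nat.mul_le_mul_left _ (h2 _)
      _ = (c₁ * b) * hilbertFunction φ (c * (c₁ * M)) := by ring
      _ ≤ (c₁ * b + c * c₁) * hilbertFunction φ ((c₁ * b + c * c₁) * M) := by
        refine Nat.mul_le_mul (Nat.le_add_right _ _) (hilbertFunction_mono φ ?_)
        nlinarith [Nat.zero_le (c₁ * b * M)]
  · calc hilbertFunction φ N ≤ c₂ * (a * N + 1) ^ r := (h1 N).trans (hc₂ _)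
      _ ≤ c₂ * ((a + 1) * (N + 1)) ^ r := by gcongr; nlinarith
      _ = c₂ * (a + 1) ^ r * (N + 1) ^ r := by rw [mul_pow, mul_assoc]

theorem order_pow_eq {f : PS k n} {d : ℕ} (hf : f.order = d) (M : ℕ) :
    (f ^ M).order = ((d * M : ℕ) : ℕ∞) := by
  induction M with
  | zero =>
    have h0 : (1 : PS k n).order = 0 := weightedOrder_one _
    simp [h0]
  | succ M ih =>
    rw [pow_succ, order_mul, ih, hf, mul_add, mul_one]
    norm_cast

theorem order_algEquiv (σ : PS k m ≃ₐ[k] PS k m) (f : PS k m) : (σ f).order = f.order := by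
  refine le_antisymm ?_ (order_le_order_algHom σ.toAlgHom f)
  have := order_le_order_algHom σ.symm.toAlgHom (σ f)
  simpa using this

theorem Growth.of_algEquiv {φ : PS k n →ₐ[k] PS k m} {τ : PS k n ≃ₐ[k] PS k n}
    {σ : PS k m ≃ₐ[k] PS k m} {r : ℕ}
    (h : Growth ((σ.toAlgHom.comp φ).comp τ.toAlgHom) r) : Growth φ r := by
  refine h.of_le 1 1 1 (fun N => ?_) (fun N => ?_)
  · refine hilbertFunction_le_of_linearMap τ.symm.toLinearMap fun w hw => ?_
    simpa [order_algEquiv] using hw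
  · rw [one_mul, one_mul]
    refine hilbertFunction_le_of_linearMap τ.toLinearMap fun w hw => ?_
    simpa [order_algEquiv] using hw

/-- The map on exponents of the monomial substitution `X i ↦ X i * X l ^ N i`. -/
noncomputable def shiftExp (l : Fin n) (N : Fin n → ℕ) (e : Fin n →₀ ℕ) : Fin n →₀ ℕ :=
  e + Finsupp.single l (∑ i, N i * e i)

theorem shiftExp_apply_same (l : Fin n) (N : Fin n → ℕ) (e : Fin n →₀ ℕ) :
    shiftExp l N e l = e l + ∑ i, N i * e i := by
  simp [shiftExp]

theorem shiftExp_apply_of_ne {l i : Fin n} (h : i ≠ l) (N : Fin n → ℕ) (e : Fin n →₀ ℕ) :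
    shiftExp l N e i = e i := by
  simp [shiftExp, h]

theorem degree_shiftExp (l : Fin n) (N : Fin n → ℕ) (e : Fin n →₀ ℕ) :
    (shiftExp l N e).degree = e.degree + ∑ i, N i * e i := by
  rw [shiftExp, map_add, Finsupp.degree_single]

theorem shiftExp_injective (l : Fin n) (N : Fin n → ℕ) :
    Function.Injective (shiftExp l N) := by
  intro e e' h
  have h1 : ∀ i, i ≠ l → e i = e' i := fun i hi => by
    have := DFunLike.congr_fun h i
    rwa [shiftExp_apply_of_ne hi, shiftExp_apply_of_ne hi] at this
  have h2 := DFunLike.congr_fun h l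
  rw [shiftExp_apply_same, shiftExp_apply_same, ← Finset.add_sum_erase _ _ (Finset.mem_univ l),
    ← Finset.add_sum_erase _ _ (Finset.mem_univ l),
    Finset.sum_congr rfl (fun i hi => by rw [h1 i (Finset.ne_of_mem_erase hi)])] at h2
  ext i
  by_cases hi : i = l
  · subst hi
    nlinarith [Nat.zero_le (N i)]
  · exact h1 i hi

theorem algHom_monomial_eq_shiftExp {ψ : PS k n →ₐ[k] PS k n} {l : Fin n} {N : Fin n → ℕ}
    (hψ : ∀ i, ψ (X i) = X i * X l ^ N i) (e : Fin n →₀ ℕ) :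
    ψ (monomial e 1) = monomial (shiftExp l N e) 1 := by
  have h1 : ∏ i, (X i : PS k n) ^ e i = monomial e 1 := by
    rw [monomial_one_eq, Finsupp.prod_fintype _ _ (by simp)]
  rw [algHom_monomial]
  simp only [hψ, mul_pow, ← pow_mul, Finset.prod_mul_distrib, Finset.prod_pow_eq_pow_sum]
  rw [h1, X_pow_eq, monomial_mul_monomial, mul_one, shiftExp]

theorem order_shift_le {ψ : PS k n →ₐ[k] PS k n} {l : Fin n} {N : Fin n → ℕ} (hN : ∀ i, N i ≤ 1)
    (hψ : ∀ i, ψ (X i) = X i * X l ^ N i) (f : PS k n) : (ψ f).order ≤ 2 * f.order := by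
  by_cases hf : f = 0
  · simp [hf]
  obtain ⟨e, he, hd⟩ := exists_coeff_ne_zero_and_order (ne_zero_iff_order_finite.mp hf)
  rw [← coeff_monomial_algHom ψ _ (algHom_monomial_eq_shiftExp hψ) (shiftExp_injective l N)] at he
  refine (order_le he).trans ?_
  rw [← hd, degree_shiftExp]
  norm_cast
  rw [two_mul, add_le_add_iff_left, Finsupp.degree_eq_sum]
  exact Finset.sum_le_sum fun i _ => by nlinarith [hN i]

/-- A blowing-up at most doubles the order and never lowers it. -/
theorem Growth.of_blowUp {φ : PS k n →ₐ[k] PS k m} {ψ : PS k m →ₐ[k] PS k m} {l : Fin m}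
    {N : Fin m → ℕ} (hN : ∀ i, N i ≤ 1) (hψ : ∀ i, ψ (X i) = X i * X l ^ N i) {r : ℕ}
    (h : Growth (ψ.comp φ) r) : Growth φ r := by
  refine h.of_le 2 1 1 (fun N => ?_) (fun N => ?_)
  · refine hilbertFunction_le_of_linearMap LinearMap.id fun w hw => ?_
    have h2 := hw.trans (order_shift_le hN hψ _)
    simp only [LinearMap.id_apply, Nat.cast_mul, Nat.cast_ofNat] at h2
    exact (ENat.mul_le_mul_left_iff (by simp) (by simp)).mp h2
  · rw [one_mul, one_mul]
    refine hilbertFunction_le_of_linearMap LinearMap.id fun w hw => ?_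
    exact hw.trans (order_le_order_algHom ψ _)

theorem hilbertFunction_comp_le (φ' : PS k n →ₐ[k] PS k m) (ψ : PS k n →ₐ[k] PS k n) (N : ℕ) :
    hilbertFunction (φ'.comp ψ) N ≤ hilbertFunction φ' N :=
  hilbertFunction_le_of_linearMap ψ.toLinearMap fun _ hw => hw

/-- A polynomial of degree below `M` lies in the image of `ψ` once it is multiplied by `X l ^ M`.
Under `φ'` this factor raises the order by exactly `d * M`, with `d` the finite order of `φ' (X l)`;
this is where `hl` enters. -/
theorem Growth.of_contraction {φ' : PS k n →ₐ[k] PS k m} {ψ : PS k n →ₐ[k] PS k n} {l : Fin n}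
    {N : Fin n → ℕ} (hN : ∀ i, N i ≤ 1) (hNl : N l = 0) (hψ : ∀ i, ψ (X i) = X i * X l ^ N i)
    (hl : φ' (X l) ≠ 0) {r : ℕ} (h : Growth φ' r) : Growth (φ'.comp ψ) r := by
  classical
  obtain ⟨d, hd⟩ : ∃ d : ℕ, (d : ℕ∞) = (φ' (X l)).order :=
    ⟨_, ne_zero_iff_order_finite.mp hl⟩
  refine h.of_le 1 1 (d + 1) (fun M => ?_) (fun M => ?_)
  · rw [one_mul]
    exact hilbertFunction_comp_le _ _ _
  · rw [one_mul]
    set S := (Finsupp.finite_of_degree_lt (σ := Fin n) M).toFinset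
    let q : (S → k) →ₗ[k] PS k n :=
      Fintype.linearCombination k fun e : S => monomial (e : Fin n →₀ ℕ) (1 : k)
    let t : (S → k) →ₗ[k] PS k n :=
      Fintype.linearCombination k fun e : S =>
        monomial ((e : Fin n →₀ ℕ) +
          Finsupp.single l (M - ∑ i, N i * (e : Fin n →₀ ℕ) i)) (1 : k)
    have hqt : ∀ w, ψ (t w) = X l ^ M * q w := by
      intro w
      simp only [q, t, Fintype.linearCombination_apply, map_sum, map_smul, Finset.mul_sum,
        mul_smul_comm]
      refine Finset.sum_congr rfl fun e _ => ?_
      congr 1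
      rw [algHom_monomial_eq_shiftExp hψ, X_pow_eq, monomial_mul_monomial, mul_one]
      congr 1
      have he : ∑ i, N i * (e : Fin n →₀ ℕ) i ≤ M := by
        have h1 : (e : Fin n →₀ ℕ).degree < M := by
          have he : (e : Fin n →₀ ℕ) ∈ {f : Fin n →₀ ℕ | f.degree < M} :=
            (Set.Finite.mem_toFinset _).mp e.2
          exact he
        rw [Finsupp.degree_eq_sum] at h1
        refine le_trans (Finset.sum_le_sum fun i _ => ?_) h1.le
        nlinarith [hN i]
      have h3 : ∑ i, N i * ((e : Fin n →₀ ℕ) +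
          Finsupp.single l (M - ∑ i, N i * (e : Fin n →₀ ℕ) i)) i
          = ∑ i, N i * (e : Fin n →₀ ℕ) i := by
        refine Finset.sum_congr rfl fun i _ => ?_
        by_cases hi : i = l
        · subst hi
          simp [hNl]
        · simp [hi]
      rw [shiftExp, h3, add_assoc, ← Finsupp.single_add, Nat.sub_add_cancel he, add_comm]
    refine hilbertFunction_le q (fun f => ⟨fun e => coeff (e : Fin n →₀ ℕ) f, ?_⟩) t
      fun w hw => ?_
    · refine le_trans ?_ (order_le_order_algHom φ' _)
      have h5 : q (fun e => coeff (e : Fin n →₀ ℕ) f) = ∑ e ∈ S, monomial e (coeff e f) := by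
        rw [← Finset.sum_coe_sort S, Fintype.linearCombination_apply]
        refine Finset.sum_congr rfl fun e _ => ?_
        rw [← map_smul, smul_eq_mul, mul_one]
      rw [h5]
      exact exists_truncation f M
    · rw [AlgHom.comp_apply, hqt, map_mul, map_pow, order_mul] at hw
      have h4 : (φ' (X l) ^ M).order = ((d * M : ℕ) : ℕ∞) := order_pow_eq hd.symm M
      rw [h4, add_mul, one_mul, Nat.cast_add] at hw
      exact (ENat.add_le_add_iff_left (ENat.natCast_ne_top _)).mp hw

/-- The source is generated over the image of `ψ` by `1, X l, ..., X l ^ (d - 1)`, so passing to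
this image divides the Hilbert function by at most `d`. -/
theorem Growth.of_ramification {φ' : PS k n →ₐ[k] PS k m} {ψ : PS k n →ₐ[k] PS k n}
    {l : Fin n} {d : ℕ} (hd : 0 < d) (hl : ψ (X l) = X l ^ d)
    (hψ : ∀ i, i ≠ l → ψ (X i) = X i) {r : ℕ} (h : Growth φ' r) : Growth (φ'.comp ψ) r := by
  classical
  refine h.of_le 1 d 1 (fun M => ?_) (fun M => ?_)
  · rw [one_mul]
    exact hilbertFunction_comp_le _ _ _
  rw [one_mul]
  -- Writing `X l ^ d` as `X l * X l ^ (d - 1)` makes the ramification a shift of exponents.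
  set N : Fin n → ℕ := fun i => if i = l then d - 1 else 0 with hN
  have hψN : ∀ i, ψ (X i) = X i * X l ^ N i := by
    intro i
    by_cases hi : i = l
    · subst hi
      rw [hl, hN]
      simp only [if_true]
      rw [← pow_succ', Nat.sub_add_cancel hd]
    · simp [hψ i hi, hN, hi]
  have hsum : ∀ e : Fin n →₀ ℕ, e l + ∑ i, N i * e i = d * e l := by
    intro e
    rw [Finset.sum_eq_single l]
    · simp only [hN, if_true]
      rw [← Nat.succ_pred_eq_of_pos hd]
      simp only [Nat.succ_eq_add_one, Nat.add_sub_cancel]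
      ring
    · intro i _ hi
      simp [hN, hi]
    · simp
  let q : (Fin d → PS k n) →ₗ[k] PS k n :=
    ∑ j : Fin d, (LinearMap.mulLeft k (X l ^ (j : ℕ) : PS k n)).comp
      (ψ.toLinearMap.comp (LinearMap.proj j))
  have hq : ∀ w, q w = ∑ j : Fin d, X l ^ (j : ℕ) * ψ (w j) := by
    intro w
    simp [q]
  let t : (Fin d → PS k n) →ₗ[k] (Fin d → PS k n ⧸ orderKernel (φ'.comp ψ) M) :=
    LinearMap.pi fun j => (orderKernel (φ'.comp ψ) M).mkQ.comp (LinearMap.proj j)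
  have key := (finrank_le_of_ker_le ((orderKernel φ' M).mkQ.comp q) ?_ t ?_).2
  · rw [finrank_pi_fintype] at key
    simpa [hilbertFunction] using key
  · rw [LinearMap.coe_comp]
    refine (orderKernel φ' M).mkQ_surjective.comp fun f => ?_
    refine ⟨fun j => ofCoeff fun e => coeff (shiftExp l N e + Finsupp.single l (j : ℕ)) f, ?_⟩
    rw [hq]
    ext δ
    rw [map_sum]
    obtain ⟨e, he⟩ : ∃ e : Fin n →₀ ℕ,
        shiftExp l N e + Finsupp.single l (δ l % d) = δ := by
      refine ⟨δ.update l (δ l / d), ?_⟩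
      ext i
      by_cases hi : i = l
      · subst hi
        rw [Finsupp.add_apply, shiftExp_apply_same, hsum]
        simp [Nat.div_add_mod]
      · rw [Finsupp.add_apply, shiftExp_apply_of_ne hi]
        simp [hi]
    rw [Finset.sum_eq_single ⟨δ l % d, Nat.mod_lt _ hd⟩]
    · dsimp only
      rw [X_pow_eq, coeff_monomial_mul, one_mul, if_pos]
      · conv_lhs => rw [← he]
        simp only [Finsupp.add_apply, Finsupp.single_eq_same]
        have h5 : (shiftExp l N e l + δ l % d) = δ l := by
          have := DFunLike.congr_fun he l
          simpa using this
        rw [h5, add_tsub_cancel_right,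
          coeff_monomial_algHom ψ _ (algHom_monomial_eq_shiftExp hψN) (shiftExp_injective l N),
          coeff_ofCoeff, he]
      · rw [Finsupp.single_le_iff]
        exact Nat.mod_le _ _
    · intro j _ hj
      rw [X_pow_eq, coeff_monomial_mul, one_mul]
      by_cases hle : Finsupp.single l (j : ℕ) ≤ δ
      · rw [if_pos hle]
        by_contra hne
        obtain ⟨e', he', -⟩ := exists_of_coeff_monomial_algHom_ne_zero ψ _
          (algHom_monomial_eq_shiftExp hψN) _ _ hne
        have h6 := DFunLike.congr_fun he' l
        rw [shiftExp_apply_same, hsum, Finsupp.tsub_apply, Finsupp.single_eq_same] at h6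
        rw [Finsupp.single_le_iff] at hle
        apply hj
        ext
        change (j : ℕ) = δ l % d
        have h7 : δ l = d * e' l + j := by omega
        rw [h7, Nat.mul_add_mod, Nat.mod_eq_of_lt j.2]
      · rw [if_neg hle]
    · simp
  · intro w hw
    rw [LinearMap.comp_apply, Submodule.mkQ_apply, Submodule.Quotient.mk_eq_zero,
      mem_orderKernel, hq, map_sum]
    refine le_order_sum _ _ _ fun j _ => ?_
    have hj : w j ∈ orderKernel (φ'.comp ψ) M := by
      rw [← Submodule.Quotient.mk_eq_zero]
      exact congrFun hw j
    rw [map_mul]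
    refine le_trans hj (le_trans ?_ le_order_mul)
    exact le_add_self

/-- An admissible transformation under which the growth of the Hilbert–Samuel function does
not change. -/
def Step (φ φ' : PS k n →ₐ[k] PS k m) : Prop :=
  IsAdmissible φ φ' ∧ ∀ r, Growth φ' r → Growth φ r

theorem Step.automorphisms (φ : PS k n →ₐ[k] PS k m) (τ : PS k n ≃ₐ[k] PS k n)
    (σ : PS k m ≃ₐ[k] PS k m) : Step φ ((σ.toAlgHom.comp φ).comp τ.toAlgHom) :=
  ⟨IsAdmissible.automorphisms φ τ σ, fun _ h => h.of_algEquiv⟩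

theorem Step.blowingUp (φ : PS k n →ₐ[k] PS k m) (ψ : PS k m →ₐ[k] PS k m) (l : Fin m)
    (hl : (l : ℕ) + 1 < m) (hψ : ∀ i, ψ (X i) = X i * X l ^ (if l < i then 1 else 0)) :
    Step φ (ψ.comp φ) := by
  refine ⟨IsAdmissible.blowingUp φ ψ l hl (fun i hi => ?_) (fun i hi => ?_),
    fun r h => h.of_blowUp (fun i => ?_) hψ⟩
  · simp [hψ, not_lt.mpr hi]
  · simp [hψ, hi, mul_comm]
  · split_ifs <;> simp

/-- The condition `h0` is essential for the growth: if `φ'` kills `X l`, then the composite with `ψ`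
also kills all later variables, whatever `φ'` does to them. -/
theorem Step.contraction (φ' : PS k n →ₐ[k] PS k m) (ψ : PS k n →ₐ[k] PS k n) (l : Fin n)
    (hl : (l : ℕ) + 1 < n) (hψ : ∀ i, ψ (X i) = X i * X l ^ (if l < i then 1 else 0))
    (h0 : φ' (X l) ≠ 0) : Step (φ'.comp ψ) φ' := by
  refine ⟨IsAdmissible.contraction φ' ψ l hl (fun i hi => ?_) (fun i hi => ?_),
    fun r h => h.of_contraction (fun i => ?_) ?_ hψ h0⟩
  · simp [hψ, not_lt.mpr hi]
  · simp [hψ, hi]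
  · split_ifs <;> simp
  · simp

theorem Step.ramification (φ' : PS k n →ₐ[k] PS k m) (ψ : PS k n →ₐ[k] PS k n) (l : Fin n)
    (hl : (l : ℕ) = 0) {d : ℕ} (hd : 0 < d) (hψ : ψ (X l) = X l ^ d)
    (h : ∀ i, i ≠ l → ψ (X i) = X i) : Step (φ'.comp ψ) φ' := by
  refine ⟨IsAdmissible.ramification φ' ψ d hd (fun i hi => ?_) (fun i hi => ?_),
    fun r hr => hr.of_ramification hd hψ h⟩
  · obtain rfl : i = l := Fin.ext (hi.trans hl.symm)
    exact hψ
  · exact h i fun hil => hi (by rw [hil, hl])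

/-- Chains of admissible transformations that do not change the growth. -/
abbrev Reach (φ φ' : PS k n →ₐ[k] PS k m) : Prop := Relation.ReflTransGen Step φ φ'

theorem Reach.isAdmissible {φ φ' : PS k n →ₐ[k] PS k m} (h : Reach φ φ') :
    Relation.ReflTransGen IsAdmissible φ φ' := by
  induction h with
  | refl => exact Relation.ReflTransGen.refl
  | tail _ h ih => exact ih.tail h.1

theorem Reach.growth {φ φ' : PS k n →ₐ[k] PS k m} (h : Reach φ φ') {r : ℕ}
    (hr : Growth φ' r) : Growth φ r := by
  induction h with
  | refl => exact hr
  | tail _ h ih => exact ih (h.2 r hr)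

end Growth

/-! ### Flexible forms of the admissible transformations -/

section Moves

variable {k : Type*} [Field k] {n m : ℕ}

theorem Reach.target (φ : PS k n →ₐ[k] PS k m) (σ : PS k m ≃ₐ[k] PS k m) :
    Reach φ (σ.toAlgHom.comp φ) := by
  have h := Step.automorphisms φ AlgEquiv.refl σ
  have h2 : ((σ.toAlgHom.comp φ).comp (AlgEquiv.refl : PS k n ≃ₐ[k] PS k n).toAlgHom)
      = σ.toAlgHom.comp φ := AlgHom.ext fun _ => rfl
  rw [h2] at h
  exact Relation.ReflTransGen.single h

theorem Reach.source (φ : PS k n →ₐ[k] PS k m) (τ : PS k n ≃ₐ[k] PS k n) :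
    Reach φ (φ.comp τ.toAlgHom) := by
  have h := Step.automorphisms φ τ AlgEquiv.refl
  have h2 : (((AlgEquiv.refl : PS k m ≃ₐ[k] PS k m).toAlgHom.comp φ).comp τ.toAlgHom)
      = φ.comp τ.toAlgHom := AlgHom.ext fun _ => rfl
  rw [h2] at h
  exact Relation.ReflTransGen.single h

/-- The automorphism that permutes the variables. -/
noncomputable def permEquiv (π : Equiv.Perm (Fin n)) : PS k n ≃ₐ[k] PS k n :=
  renameEquiv k π

@[simp]
theorem permEquiv_X (π : Equiv.Perm (Fin n)) (i : Fin n) :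
    permEquiv π (X i : PS k n) = X (π i) := by
  change rename π (X i : PS k n) = X (π i)
  exact rename_X _ i

@[simp]
theorem permEquiv_symm_X (π : Equiv.Perm (Fin n)) (i : Fin n) :
    (permEquiv π).symm (X i : PS k n) = X (π.symm i) := by
  rw [AlgEquiv.symm_apply_eq, permEquiv_X, Equiv.apply_symm_apply]

theorem exists_perm_eq {a b c d : Fin n} (hab : a ≠ b) (hcd : c ≠ d) :
    ∃ π : Equiv.Perm (Fin n), π a = c ∧ π b = d := by
  refine ⟨Equiv.swap (Equiv.swap a c b) d * Equiv.swap a c, ?_, ?_⟩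
  · rw [Equiv.Perm.mul_apply, Equiv.swap_apply_left]
    refine Equiv.swap_apply_of_ne_of_ne ?_ hcd
    intro h
    have : Equiv.swap a c a = Equiv.swap a c b := by rw [Equiv.swap_apply_left, ← h]
    exact hab ((Equiv.swap a c).injective this)
  · rw [Equiv.Perm.mul_apply, Equiv.swap_apply_left]

/-- Moving `l` to the last but one place and `i` to the last one reduces a blowing-up or contraction
with pivot `l` to one that changes only the variable `i`. -/
theorem exists_perm_last {i l : Fin n} (h : i ≠ l) :
    ∃ (π : Equiv.Perm (Fin n)) (l₀ : Fin n), (l₀ : ℕ) + 1 < n ∧ π l = l₀ ∧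
      ∀ j, l₀ < π j ↔ j = i := by
  have hn : 2 ≤ n := by
    by_contra hn
    exact h (Fin.ext (by omega))
  obtain ⟨π, h1, h2⟩ := exists_perm_eq (n := n) (a := l) (b := i) (c := ⟨n - 2, by omega⟩)
    (d := ⟨n - 1, by omega⟩) h.symm (by rw [Ne, Fin.mk.injEq]; omega)
  refine ⟨π, ⟨n - 2, by omega⟩, by simp only; omega, h1, fun j => ?_⟩
  rw [← π.injective.eq_iff, h2, Fin.lt_def, Fin.ext_iff]
  have := (π j).2
  simp only
  omega

/-- Blowing-up that changes a single variable. -/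
theorem Reach.blowUp_single (φ : PS k n →ₐ[k] PS k m) {ψ : PS k m →ₐ[k] PS k m} {i l : Fin m}
    (h : i ≠ l) (hi : ψ (X i) = X i * X l) (hψ : ∀ j, j ≠ i → ψ (X j) = X j) :
    Reach φ (ψ.comp φ) := by
  obtain ⟨π, l₀, hl₀, hπl, hπ⟩ := exists_perm_last h
  obtain ⟨ψ₀, hψ₀⟩ := exists_algHom_X (k := k)
    (fun j : Fin m => (X j * X l₀ ^ (if l₀ < j then 1 else 0) : PS k m))
    (fun j => by rw [map_mul, constantCoeff_X, zero_mul])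
  have h1 := Reach.target φ (permEquiv π)
  have h2 := h1.tail (Step.blowingUp _ ψ₀ l₀ hl₀ hψ₀)
  have h3 := h2.trans (Reach.target _ (permEquiv π).symm)
  convert h3 using 1
  rw [← AlgHom.comp_assoc, ← AlgHom.comp_assoc]
  congr 1
  refine algHom_ext_X fun j => ?_
  have h4 : π.symm l₀ = l := by rw [← hπl, Equiv.symm_apply_apply]
  change ψ (X j) = (permEquiv π).symm (ψ₀ (permEquiv π (X j)))
  rw [permEquiv_X, hψ₀]
  by_cases hj : j = i
  · subst hj
    rw [if_pos ((hπ j).mpr rfl), hi]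
    simp [h4]
  · rw [if_neg (fun h' => hj ((hπ j).mp h')), hψ j hj]
    simp

theorem prod_pow_eq_prod_update_mul {R ι : Type*} [CommMonoid R] [Fintype ι] [DecidableEq ι]
    (x : ι → R) (N : ι → ℕ) (l : ι) (b : ℕ) (hb : N l = b + 1) :
    ∏ j, x j ^ N j = (∏ j, x j ^ Function.update N l b j) * x l := by
  rw [← Finset.mul_prod_erase _ _ (Finset.mem_univ l),
    ← Finset.mul_prod_erase _ (fun j => x j ^ Function.update N l b j) (Finset.mem_univ l),
    Function.update_self, hb, pow_succ,
    Finset.prod_congr rfl (g := fun j => x j ^ N j) (s₁ := Finset.univ.erase l)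
      (f := fun j => x j ^ Function.update N l b j)
      (fun j hj => by rw [Function.update_of_ne (Finset.ne_of_mem_erase hj)]),
    mul_right_comm]

theorem algHom_id_of_X {ψ : PS k n →ₐ[k] PS k n} (h : ∀ i, ψ (X i) = X i) :
    ψ = AlgHom.id k _ := algHom_ext_X h

/-- Such a substitution is a composite of single blowing-ups, one for each unit of `∑ N j`. -/
theorem Reach.pivot (φ : PS k n →ₐ[k] PS k m) {ψ : PS k m →ₐ[k] PS k m} {l : Fin m}
    {N : Fin m → ℕ} (hN : N l = 0) (hψ : ∀ j, ψ (X j) = X j * X l ^ N j) :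
    Reach φ (ψ.comp φ) := by
  classical
  induction hs : ∑ j, N j generalizing N ψ with
  | zero =>
    rw [algHom_id_of_X (ψ := ψ), AlgHom.id_comp]
    intro i
    rw [Finset.sum_eq_zero_iff] at hs
    rw [hψ, hs i (Finset.mem_univ i), pow_zero, mul_one]
  | succ s ih =>
    obtain ⟨i, -, hi⟩ : ∃ i ∈ Finset.univ, N i ≠ 0 := by
      apply Finset.exists_ne_zero_of_sum_ne_zero
      omega
    have hil : i ≠ l := by
      rintro rfl
      exact hi hN
    obtain ⟨ψ', hψ'⟩ := exists_algHom_X (k := k)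
      (fun j : Fin m => (X j * X l ^ (Function.update N i (N i - 1) j) : PS k m)) (by simp)
    obtain ⟨χ, hχ⟩ := exists_algHom_X (k := k)
      (fun j : Fin m => (if j = i then X j * X l else X j : PS k m))
      (by intro j; split_ifs <;> simp)
    have h1 := ih (N := Function.update N i (N i - 1)) (by simp [hil.symm, hN]) hψ' (by
      rw [Finset.sum_update_of_mem (Finset.mem_univ i)]
      rw [← Finset.add_sum_erase _ _ (Finset.mem_univ i)] at hs
      rw [Finset.sdiff_singleton_eq_erase]
      omega)
    have h2 := h1.trans (Reach.blowUp_single _ (ψ := χ) hil (by simp [hχ])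
      (fun j hj => by simp [hχ, hj]))
    convert h2 using 1
    rw [← AlgHom.comp_assoc]
    congr 1
    refine algHom_ext_X fun j => ?_
    rw [AlgHom.comp_apply, hψ, hψ', map_mul, map_pow, hχ, hχ, if_neg hil.symm]
    by_cases hj : j = i
    · subst hj
      obtain ⟨a, ha⟩ := Nat.exists_eq_succ_of_ne_zero hi
      simp only [if_true, Function.update_self, ha, Nat.succ_eq_add_one, Nat.add_sub_cancel]
      ring
    · simp [hj]

/-- Dual to `Reach.pivot`: one variable is changed, by single blowing-ups with varying pivots. -/
theorem Reach.coPivot (φ : PS k n →ₐ[k] PS k m) {ψ : PS k m →ₐ[k] PS k m} {i : Fin m}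
    {N : Fin m → ℕ} (hN : N i = 0) (hi : ψ (X i) = X i * ∏ j, X j ^ N j)
    (hψ : ∀ j, j ≠ i → ψ (X j) = X j) : Reach φ (ψ.comp φ) := by
  classical
  induction hs : ∑ j, N j generalizing N ψ with
  | zero =>
    rw [algHom_id_of_X (ψ := ψ), AlgHom.id_comp]
    intro j
    rw [Finset.sum_eq_zero_iff] at hs
    by_cases hj : j = i
    · subst hj
      rw [hi, Finset.prod_eq_one, mul_one]
      intro j' hj'
      rw [hs j' hj', pow_zero]
    · exact hψ j hj
  | succ s ih =>
    obtain ⟨l, -, hl⟩ : ∃ l ∈ Finset.univ, N l ≠ 0 := by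
      apply Finset.exists_ne_zero_of_sum_ne_zero
      omega
    have hil : i ≠ l := by
      rintro rfl
      exact hl hN
    obtain ⟨ψ', hψ'⟩ := exists_algHom_X (k := k)
      (fun j : Fin m => (if j = i then X j * ∏ j', X j' ^ (Function.update N l (N l - 1) j')
        else X j : PS k m)) (by intro j; split_ifs <;> simp)
    obtain ⟨χ, hχ⟩ := exists_algHom_X (k := k)
      (fun j : Fin m => (if j = i then X j * X l else X j : PS k m))
      (by intro j; split_ifs <;> simp)
    have h1 := ih (N := Function.update N l (N l - 1)) (ψ := ψ') (by simp [hil, hN])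
      (by simp [hψ']) (fun j hj => by simp [hψ', hj]) (by
      rw [Finset.sum_update_of_mem (Finset.mem_univ l)]
      rw [← Finset.add_sum_erase _ _ (Finset.mem_univ l)] at hs
      rw [Finset.sdiff_singleton_eq_erase]
      omega)
    have h2 := h1.trans (Reach.blowUp_single _ (ψ := χ) hil (by simp [hχ])
      (fun j hj => by simp [hχ, hj]))
    convert h2 using 1
    rw [← AlgHom.comp_assoc]
    congr 1
    refine algHom_ext_X fun j => ?_
    rw [AlgHom.comp_apply, hψ']
    by_cases hj : j = i
    · subst hj
      have h3 : ∀ j', χ (X j' ^ (Function.update N l (N l - 1) j'))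
          = (X j' ^ (Function.update N l (N l - 1) j') : PS k m) := by
        intro j'
        by_cases hj' : j' = j
        · subst hj'
          rw [Function.update_of_ne hil, hN]
          simp
        · simp [hχ, hj']
      rw [if_pos rfl, hi, map_mul, map_prod, Finset.prod_congr rfl fun j' _ => h3 j', hχ,
        if_pos rfl, prod_pow_eq_prod_update_mul _ N l (N l - 1) (by omega)]
      ring
    · rw [if_neg hj, hψ j hj, hχ, if_neg hj]

/-- Contraction that changes a single variable. -/
theorem Reach.exists_contraction_single (φ : PS k n →ₐ[k] PS k m) {i l : Fin n} (h : i ≠ l)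
    (hl : φ (X l) ≠ 0) {g : PS k m} (hg : constantCoeff g = 0) (hi : φ (X i) = g * φ (X l)) :
    ∃ φ', Reach φ φ' ∧ φ' (X i) = g ∧ ∀ j, j ≠ i → φ' (X j) = φ (X j) := by
  classical
  obtain ⟨φ', hφ'⟩ := exists_algHom_X (k := k) (Function.update (fun j => φ (X j)) i g) (by
    intro j
    by_cases hj : j = i
    · subst hj
      simpa using hg
    · simpa [hj] using constantCoeff_algHom_X φ j)
  have hφi : φ' (X i) = g := by simp [hφ']
  have hφj : ∀ j, j ≠ i → φ' (X j) = φ (X j) := fun j hj => by simp [hφ', hj]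
  refine ⟨φ', ?_, hφi, hφj⟩
  obtain ⟨π, l₀, hl₀, hπl, hπ⟩ := exists_perm_last h
  have h4 : π.symm l₀ = l := by rw [← hπl, Equiv.symm_apply_apply]
  obtain ⟨ψ₀, hψ₀⟩ := exists_algHom_X (k := k)
    (fun j : Fin n => (X j * X l₀ ^ (if l₀ < j then 1 else 0) : PS k n))
    (fun j => by rw [map_mul, constantCoeff_X, zero_mul])
  have h1 := Reach.source φ (permEquiv π).symm
  have h2 := Step.contraction (φ'.comp (permEquiv π).symm.toAlgHom) ψ₀ l₀ hl₀ hψ₀ (by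
    change φ' ((permEquiv π).symm (X l₀)) ≠ 0
    rw [permEquiv_symm_X, h4, hφj l h.symm]
    exact hl)
  have h3 : φ.comp (permEquiv π).symm.toAlgHom =
      (φ'.comp (permEquiv π).symm.toAlgHom).comp ψ₀ := by
    refine algHom_ext_X fun j => ?_
    change φ ((permEquiv π).symm (X j)) = φ' ((permEquiv π).symm (ψ₀ (X j)))
    rw [hψ₀, permEquiv_symm_X, map_mul, map_pow, permEquiv_symm_X, permEquiv_symm_X, h4,
      map_mul, map_pow]
    by_cases hj : π.symm j = i
    · have h5 : l₀ < j := by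
        have := (hπ (π.symm j)).mpr hj
        simpa using this
      rw [if_pos h5, hj, hφi, hi, hφj l h.symm, pow_one]
    · have h5 : ¬ l₀ < j := fun h5 => hj ((hπ (π.symm j)).mp (by simpa using h5))
      rw [if_neg h5, hφj _ hj, pow_zero, mul_one]
  rw [h3] at h1
  have h6 := (h1.tail h2).trans (Reach.source _ (permEquiv π))
  convert h6 using 1
  refine algHom_ext_X fun j => ?_
  change φ' (X j) = φ' ((permEquiv π).symm (permEquiv π (X j)))
  rw [AlgEquiv.symm_apply_apply]

/-- Contractions divide images of variables: here all of them by powers of one fixed image, in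
`Reach.exists_contraction_of` a single one by a monomial in the others. -/
theorem Reach.exists_contraction_by (φ : PS k n →ₐ[k] PS k m) {l : Fin n} (hl : φ (X l) ≠ 0)
    {g : Fin n → PS k m} (hg : ∀ i, constantCoeff (g i) = 0) {a : Fin n → ℕ} (ha : a l = 0)
    (h : ∀ i, φ (X i) = g i * φ (X l) ^ a i) :
    ∃ φ', Reach φ φ' ∧ ∀ i, φ' (X i) = g i := by
  classical
  induction hs : ∑ j, a j generalizing a φ with
  | zero =>
    refine ⟨φ, Relation.ReflTransGen.refl, fun i => ?_⟩
    rw [Finset.sum_eq_zero_iff] at hs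
    rw [h, hs i (Finset.mem_univ i), pow_zero, mul_one]
  | succ s ih =>
    obtain ⟨i, -, hi⟩ : ∃ i ∈ Finset.univ, a i ≠ 0 := by
      apply Finset.exists_ne_zero_of_sum_ne_zero
      omega
    have hil : i ≠ l := by
      rintro rfl
      exact hi ha
    obtain ⟨b, hb⟩ := Nat.exists_eq_succ_of_ne_zero hi
    obtain ⟨φ₁, h1, h2, h3⟩ := Reach.exists_contraction_single φ hil hl
      (g := g i * φ (X l) ^ b) (by rw [map_mul, hg, zero_mul])
      (by rw [h, hb, Nat.succ_eq_add_one, pow_succ, mul_assoc])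
    obtain ⟨φ₂, h4, h5⟩ := ih φ₁ (a := Function.update a i b) (by rwa [h3 l hil.symm])
      (by simp [hil.symm, ha]) (fun j => by
        rw [h3 l hil.symm]
        by_cases hj : j = i
        · subst hj
          simp [h2]
        · rw [h3 j hj, h j, Function.update_of_ne hj]) (by
        rw [Finset.sum_update_of_mem (Finset.mem_univ i)]
        rw [← Finset.add_sum_erase _ _ (Finset.mem_univ i)] at hs
        rw [Finset.sdiff_singleton_eq_erase]
        omega)
    exact ⟨φ₂, h1.trans h4, h5⟩

theorem Reach.exists_contraction_of (φ : PS k n →ₐ[k] PS k m) {i : Fin n}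
    {g : PS k m} (hg : constantCoeff g = 0) {a : Fin n → ℕ} (ha : a i = 0)
    (h0 : ∀ l, a l ≠ 0 → φ (X l) ≠ 0) (h : φ (X i) = g * ∏ l, φ (X l) ^ a l) :
    ∃ φ', Reach φ φ' ∧ φ' (X i) = g ∧ ∀ j, j ≠ i → φ' (X j) = φ (X j) := by
  classical
  induction hs : ∑ j, a j generalizing a φ with
  | zero =>
    refine ⟨φ, Relation.ReflTransGen.refl, ?_, fun j _ => rfl⟩
    rw [Finset.sum_eq_zero_iff] at hs
    rw [h, Finset.prod_eq_one, mul_one]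
    intro j hj
    rw [hs j hj, pow_zero]
  | succ s ih =>
    obtain ⟨l, -, hl⟩ : ∃ l ∈ Finset.univ, a l ≠ 0 := by
      apply Finset.exists_ne_zero_of_sum_ne_zero
      omega
    have hil : i ≠ l := by
      rintro rfl
      exact hl ha
    obtain ⟨b, hb⟩ := Nat.exists_eq_succ_of_ne_zero hl
    set a' := Function.update a l b with ha'
    have h6 : ∏ j, φ (X j) ^ a j = (∏ j, φ (X j) ^ a' j) * φ (X l) :=
      prod_pow_eq_prod_update_mul _ a l b hb
    obtain ⟨φ₁, h1, h2, h3⟩ := Reach.exists_contraction_single φ hil (h0 l hl)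
      (g := g * ∏ j, φ (X j) ^ a' j) (by rw [map_mul, hg, zero_mul])
      (by rw [h, h6, mul_assoc])
    have hai : a' i = 0 := by simp [ha', hil, ha]
    obtain ⟨φ₂, h4, h5, h7⟩ := ih φ₁ (a := a') hai (fun j hj => by
        have hji : j ≠ i := by
          rintro rfl
          exact hj hai
        rw [h3 j hji]
        refine h0 j fun hj0 => hj ?_
        have hjl : j ≠ l := by
          rintro rfl
          exact hl hj0
        rw [ha', Function.update_of_ne hjl, hj0]) (by
        rw [h2]
        congr 1
        refine Finset.prod_congr rfl fun j _ => ?_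
        by_cases hj : j = i
        · subst hj
          rw [hai, pow_zero, pow_zero]
        · rw [h3 j hj]) (by
        rw [ha', Finset.sum_update_of_mem (Finset.mem_univ l)]
        rw [← Finset.add_sum_erase _ _ (Finset.mem_univ l)] at hs
        rw [Finset.sdiff_singleton_eq_erase]
        omega)
    exact ⟨φ₂, h1.trans h4, h5, fun j hj => (h7 j hj).trans (h3 j hj)⟩

theorem Reach.exists_ramification (φ : PS k n →ₐ[k] PS k m) {i : Fin n} {d : ℕ} (hd : 0 < d)
    {g : PS k m} (hg : constantCoeff g = 0) (hi : φ (X i) = g ^ d) :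
    ∃ φ', Reach φ φ' ∧ φ' (X i) = g ∧ ∀ j, j ≠ i → φ' (X j) = φ (X j) := by
  classical
  obtain ⟨φ', hφ'⟩ := exists_algHom_X (k := k) (Function.update (fun j => φ (X j)) i g) (by
    intro j
    by_cases hj : j = i
    · subst hj
      simpa using hg
    · simpa [hj] using constantCoeff_algHom_X φ j)
  have hφi : φ' (X i) = g := by simp [hφ']
  have hφj : ∀ j, j ≠ i → φ' (X j) = φ (X j) := fun j hj => by simp [hφ', hj]
  refine ⟨φ', ?_, hφi, hφj⟩
  have hn : 0 < n := i.pos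
  set z : Fin n := ⟨0, hn⟩
  set π : Equiv.Perm (Fin n) := Equiv.swap i z with hπ
  have hπz : π.symm z = i := by rw [hπ, Equiv.symm_swap, Equiv.swap_apply_right]
  obtain ⟨ψ₀, hψ₀⟩ := exists_algHom_X (k := k)
    (fun j : Fin n => (if j = z then X z ^ d else X j : PS k n))
    (by intro j; split_ifs <;> simp [hd.ne'])
  have h1 := Reach.source φ (permEquiv π).symm
  have h2 := Step.ramification (φ'.comp (permEquiv π).symm.toAlgHom) ψ₀ z rfl hd
    (by simp [hψ₀]) (fun j hj => by simp [hψ₀, hj])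
  have h3 : φ.comp (permEquiv π).symm.toAlgHom =
      (φ'.comp (permEquiv π).symm.toAlgHom).comp ψ₀ := by
    refine algHom_ext_X fun j => ?_
    change φ ((permEquiv π).symm (X j)) = φ' ((permEquiv π).symm (ψ₀ (X j)))
    rw [hψ₀, permEquiv_symm_X]
    by_cases hj : j = z
    · subst hj
      rw [if_pos rfl, map_pow, permEquiv_symm_X, hπz, map_pow, hφi, hi]
    · rw [if_neg hj, permEquiv_symm_X, hφj]
      intro h
      rw [← hπz] at h
      exact hj (π.symm.injective h)
  rw [h3] at h1
  have h6 := (h1.tail h2).trans (Reach.source _ (permEquiv π))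
  convert h6 using 1
  refine algHom_ext_X fun j => ?_
  change φ' (X j) = φ' ((permEquiv π).symm (permEquiv π (X j)))
  rw [AlgEquiv.symm_apply_apply]

/-- Hypothesis `h` expresses that the `q i` involve only the variables in `S`, which are not moved;
so subtracting `q i` gives the inverse. -/
theorem exists_shear (q : Fin n → PS k n) (hq : ∀ i, constantCoeff (q i) = 0) (S : Set (Fin n))
    (hS : ∀ i ∈ S, q i = 0)
    (h : ∀ χ : PS k n →ₐ[k] PS k n, (∀ i ∈ S, χ (X i) = X i) → ∀ i, χ (q i) = q i) :
    ∃ τ : PS k n ≃ₐ[k] PS k n, ∀ i, τ (X i) = X i + q i := by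
  obtain ⟨τ, hτ⟩ := exists_algHom_X (k := k) (fun i => X i + q i) (by simp [hq])
  obtain ⟨τ', hτ'⟩ := exists_algHom_X (k := k) (fun i => X i - q i) (by simp [hq])
  have h1 := h τ fun i hi => by rw [hτ, hS i hi, add_zero]
  have h2 := h τ' fun i hi => by rw [hτ', hS i hi, sub_zero]
  refine ⟨AlgEquiv.ofAlgHom τ τ' (algHom_ext_X fun i => ?_) (algHom_ext_X fun i => ?_), hτ⟩
  · simp [hτ, hτ', h1]
  · simp [hτ, hτ', h2]

theorem exists_scaling (c : Fin n → k) (hc : ∀ i, c i ≠ 0) :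
    ∃ τ : PS k n ≃ₐ[k] PS k n, ∀ i, τ (X i) = c i • X i := by
  obtain ⟨τ, hτ⟩ := exists_algHom_X (k := k) (fun i => c i • (X i : PS k n))
    (fun i => by rw [← coeff_zero_eq_constantCoeff_apply]; simp)
  obtain ⟨τ', hτ'⟩ := exists_algHom_X (k := k) (fun i => (c i)⁻¹ • (X i : PS k n))
    (fun i => by rw [← coeff_zero_eq_constantCoeff_apply]; simp)
  refine ⟨AlgEquiv.ofAlgHom τ τ' (algHom_ext_X fun i => ?_) (algHom_ext_X fun i => ?_), hτ⟩
  · simp [hτ, hτ', smul_smul, hc]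
  · simp [hτ, hτ', smul_smul, hc]

end Moves

/-! ### Division with respect to monomials times units -/

section Division

variable {k : Type*} [Field k] {s m : ℕ}

/-- The exponent of the monomial `∏ i, X (e i) ^ (d i * a i)`. -/
noncomputable def expo (e : Fin s → Fin m) (d : Fin s → ℕ) (a : Fin s →₀ ℕ) : Fin m →₀ ℕ :=
  ∑ i, Finsupp.single (e i) (d i * a i)

theorem expo_apply {e : Fin s → Fin m} (he : Function.Injective e) (d : Fin s → ℕ)
    (a : Fin s →₀ ℕ) (i : Fin s) : expo e d a (e i) = d i * a i := by
  rw [expo, Finsupp.finsetSum_apply, Finset.sum_eq_single i]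
  · simp
  · intro j _ hj
    rw [Finsupp.single_apply, if_neg (fun h => hj (he h))]
  · simp

theorem expo_apply_of_notMem {e : Fin s → Fin m} (d : Fin s → ℕ)
    (a : Fin s →₀ ℕ) {x : Fin m} (hx : ∀ i, e i ≠ x) : expo e d a x = 0 := by
  rw [expo, Finsupp.finsetSum_apply, Finset.sum_eq_zero]
  intro j _
  rw [Finsupp.single_apply, if_neg (hx j)]

theorem le_of_expo_le {e : Fin s → Fin m} (he : Function.Injective e) {d : Fin s → ℕ}
    (hd : ∀ i, 0 < d i) {a b : Fin s →₀ ℕ} (h : expo e d a ≤ expo e d b) : a ≤ b := by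
  intro i
  have := h (e i)
  rw [expo_apply he, expo_apply he] at this
  exact Nat.le_of_mul_le_mul_left this (hd i)

theorem monomial_sum_single {ι : Type*} (S : Finset ι) (e : ι → Fin m) (c : ι → ℕ) :
    (monomial (∑ i ∈ S, Finsupp.single (e i) (c i)) (1 : k) : PS k m)
      = ∏ i ∈ S, X (e i) ^ c i := by
  classical
  induction S using Finset.induction_on with
  | empty => simp
  | insert a S ha ih =>
    rw [Finset.sum_insert ha, Finset.prod_insert ha, ← ih, X_pow_eq, monomial_mul_monomial,
      mul_one]

section

variable {θ : PS k s →ₐ[k] PS k m} {e : Fin s → Fin m} {d : Fin s → ℕ} {u : Fin s → PS k m}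

theorem algHom_monomial_eq_expo (hθ : ∀ i, θ (X i) = X (e i) ^ d i * u i) (a : Fin s →₀ ℕ) :
    θ (monomial a 1) = monomial (expo e d a) 1 * ∏ i, u i ^ a i := by
  rw [algHom_monomial, expo, monomial_sum_single, ← Finset.prod_mul_distrib]
  refine Finset.prod_congr rfl fun i _ => ?_
  rw [hθ, mul_pow, ← pow_mul]

theorem coeff_expo_algHom_monomial (he : Function.Injective e) (hd : ∀ i, 0 < d i)
    (hθ : ∀ i, θ (X i) = X (e i) ^ d i * u i) {a b : Fin s →₀ ℕ} (hab : ¬ a ≤ b) :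
    coeff (expo e d b) (θ (monomial a 1)) = 0 := by
  classical
  rw [algHom_monomial_eq_expo hθ, coeff_monomial_mul, if_neg]
  exact fun h => hab (le_of_expo_le he hd h)

theorem coeff_expo_algHom_monomial_self (hu : ∀ i, IsUnit (u i))
    (hθ : ∀ i, θ (X i) = X (e i) ^ d i * u i) (a : Fin s →₀ ℕ) :
    coeff (expo e d a) (θ (monomial a 1)) ≠ 0 := by
  classical
  rw [algHom_monomial_eq_expo hθ, coeff_monomial_mul, if_pos le_rfl, tsub_self, one_mul,
    coeff_zero_eq_constantCoeff_apply, map_prod, Finset.prod_ne_zero_iff]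
  intro i _
  rw [map_pow]
  exact pow_ne_zero _ (isUnit_iff_constantCoeff_ne_zero.mp (hu i))

/-- `θ` sends the monomial with exponent `b` to the one with exponent `expo e d b` times a unit, so
at the exponents `expo e d a` it is triangular for the componentwise order, with nonzero diagonal
entries by `coeff_expo_algHom_monomial_self`. -/
theorem coeff_expo_algHom (he : Function.Injective e) (hd : ∀ i, 0 < d i)
    (hθ : ∀ i, θ (X i) = X (e i) ^ d i * u i) (P : PS k s) (a : Fin s →₀ ℕ) :
    coeff (expo e d a) (θ P) = coeff a P * coeff (expo e d a) (θ (monomial a 1)) +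
      ∑ b ∈ Finset.Iio a, coeff b P * coeff (expo e d a) (θ (monomial b 1)) := by
  classical
  rw [coeff_algHom θ P _ (Finset.Iic a), ← Finset.Iio_insert, Finset.sum_insert (by simp)]
  intro b hb
  rw [coeff_expo_algHom_monomial he hd hθ (by simpa using hb), mul_zero]

/-- Division by a subring generated by monomials times units. -/
theorem exists_division (he : Function.Injective e) (hd : ∀ i, 0 < d i)
    (hu : ∀ i, IsUnit (u i)) (hθ : ∀ i, θ (X i) = X (e i) ^ d i * u i) (g : PS k m) :
    ∃ P : PS k s, ∀ a, coeff (expo e d a) (g - θ P) = 0 := by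
  classical
  have hwf : WellFounded (fun a b : Fin s →₀ ℕ => a < b) := wellFounded_lt
  -- The triangular system for the coefficients of `P` is solved by well-founded recursion on the
  -- exponent.
  let F : (a : Fin s →₀ ℕ) → ((b : Fin s →₀ ℕ) → b < a → k) → k := fun a c =>
    (coeff (expo e d a) g - ∑ b ∈ (Finset.Iio a).attach,
      c b (Finset.mem_Iio.mp b.2) * coeff (expo e d a) (θ (monomial (b : Fin s →₀ ℕ) 1))) /
      coeff (expo e d a) (θ (monomial a 1))
  refine ⟨ofCoeff (hwf.fix F), fun a => ?_⟩
  have h1 : hwf.fix F a = (coeff (expo e d a) g - ∑ b ∈ Finset.Iio a,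
      hwf.fix F b * coeff (expo e d a) (θ (monomial b 1))) /
      coeff (expo e d a) (θ (monomial a 1)) := by
    rw [hwf.fix_eq, ← Finset.sum_attach (Finset.Iio a)]
  rw [map_sub, coeff_expo_algHom he hd hθ, coeff_ofCoeff, h1,
    div_mul_cancel₀ _ (coeff_expo_algHom_monomial_self hu hθ a)]
  simp

theorem algHom_injective_of_expo (he : Function.Injective e) (hd : ∀ i, 0 < d i)
    (hu : ∀ i, IsUnit (u i)) (hθ : ∀ i, θ (X i) = X (e i) ^ d i * u i) :
    Function.Injective θ := by
  classical
  rw [injective_iff_map_eq_zero]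
  intro P hP
  by_contra hne
  have hex : {a : Fin s →₀ ℕ | coeff a P ≠ 0}.Nonempty := by
    by_contra h
    rw [Set.not_nonempty_iff_eq_empty, Set.eq_empty_iff_forall_notMem] at h
    exact hne (by ext a; simpa using h a)
  obtain ⟨a, ha, hmin⟩ := (wellFounded_lt (α := Fin s →₀ ℕ)).has_min _ hex
  have h1 := coeff_expo_algHom he hd hθ P a
  rw [hP, Finset.sum_eq_zero, add_zero, map_zero] at h1
  · exact mul_ne_zero ha (coeff_expo_algHom_monomial_self hu hθ a) h1.symm
  · intro b hb
    have : coeff b P = 0 := by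
      by_contra hb'
      exact hmin b hb' (Finset.mem_Iio.mp hb)
    rw [this, zero_mul]

end

theorem exists_algEquiv_of_units {u : Fin m → PS k m} (hu : ∀ i, IsUnit (u i)) :
    ∃ σ : PS k m ≃ₐ[k] PS k m, ∀ i, σ (X i) = X i * u i := by
  obtain ⟨θ, hθ⟩ := exists_algHom_X (k := k) (fun i => X i * u i) (by simp)
  have hθ' : ∀ i, θ (X i) = X (id i) ^ 1 * u i := fun i => by rw [hθ, pow_one, id]
  refine ⟨AlgEquiv.ofBijective θ ⟨?_, fun g => ?_⟩, hθ⟩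
  · exact algHom_injective_of_expo Function.injective_id (fun _ => one_pos) hu hθ'
  -- All variables occur, with exponent one, so every exponent is reached and the remainder of the
  -- division is zero.
  · obtain ⟨P, hP⟩ := exists_division Function.injective_id (fun _ => one_pos) hu hθ' g
    refine ⟨P, ?_⟩
    rw [eq_comm, ← sub_eq_zero]
    ext a
    have h1 : expo id (fun _ => 1) a = a := by
      ext i
      have := expo_apply (e := id) Function.injective_id (fun _ => 1) a i
      simpa using this
    simpa [h1] using hP a

end Division

/-! ### Roots of units by Hensel's lemma -/

section Roots

variable {k : Type*} [Field k] {m : ℕ}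

theorem constantCoeff_eq_zero_of_mem_span {f : PS k m}
    (hf : f ∈ Ideal.span (Set.range (X : Fin m → PS k m))) : constantCoeff f = 0 := by
  have h : Ideal.span (Set.range (X : Fin m → PS k m)) ≤
      RingHom.ker (constantCoeff : PS k m →+* k) := by
    rw [Ideal.span_le]
    rintro _ ⟨i, rfl⟩
    simp [RingHom.mem_ker]
  exact h hf

theorem mem_span_of_constantCoeff_eq_zero {f : PS k m} (hf : constantCoeff f = 0) :
    f ∈ Ideal.span (Set.range (X : Fin m → PS k m)) := by
  obtain ⟨g, hg⟩ := exists_eq_sum_monomial_mul (N := 1) (f := f)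
    (one_le_order_iff_constCoeff_eq_zero.mpr hf)
  rw [hg]
  refine Ideal.sum_mem _ fun e he => Ideal.mul_mem_right _ _ ?_
  rw [Set.Finite.mem_toFinset, Set.mem_ofPred_eq] at he
  obtain ⟨i, rfl⟩ : ∃ i, e = Finsupp.single i 1 := by
    have h0 : e ≠ 0 := by
      rintro rfl
      simp at he
    obtain ⟨i, hi⟩ := Finsupp.ne_iff.mp h0
    refine ⟨i, ?_⟩
    have h1 : Finsupp.single i 1 ≤ e := by
      rw [Finsupp.single_le_iff]
      exact Nat.one_le_iff_ne_zero.mpr hi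
    obtain ⟨e', rfl⟩ := exists_add_of_le h1
    rw [map_add, Finsupp.degree_single] at he
    have h2 : e' = 0 := by
      rw [← Finsupp.degree_eq_zero_iff]
      omega
    rw [h2, add_zero]
  rw [← X_def]
  exact Ideal.subset_span ⟨i, rfl⟩

/-- Power series with constant term `1` have roots of every order prime to the
characteristic. -/
theorem exists_pow_eq {w : PS k m} (hw : constantCoeff w = 1) {c : ℕ} (hc : (c : k) ≠ 0) :
    ∃ z : PS k m, z ^ c = w ∧ constantCoeff z = 1 := by
  have hc0 : c ≠ 0 := by
    rintro rfl
    simp at hc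
  obtain ⟨z, hz, hz1⟩ := HenselianRing.is_henselian
    (I := Ideal.span (Set.range (X : Fin m → PS k m)))
    (Polynomial.X ^ c - Polynomial.C w : Polynomial (PS k m))
    (Polynomial.monic_X_pow_sub_C w hc0) 1
    (mem_span_of_constantCoeff_eq_zero (by simp [hw])) (by
      apply IsUnit.map
      simp only [Polynomial.derivative_sub, Polynomial.derivative_X_pow,
        Polynomial.derivative_C, sub_zero, Polynomial.eval_mul, Polynomial.eval_pow,
        Polynomial.eval_X, one_pow, mul_one, map_natCast, Polynomial.eval_natCast]
      rw [isUnit_iff_constantCoeff_ne_zero]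
      simpa using hc)
  refine ⟨z, ?_, ?_⟩
  · simpa [Polynomial.IsRoot, sub_eq_zero] using hz
  · have := constantCoeff_eq_zero_of_mem_span hz1
    rw [map_sub, map_one, sub_eq_zero] at this
    exact this

end Roots

/-! ### Scaling, prime-to-`p` ramification and removal of monomial factors -/

section CleanUp

variable {k : Type*} [Field k] {n m : ℕ}

/-- Scaling one variable of the source. -/
theorem Reach.exists_scale (φ : PS k n →ₐ[k] PS k m) (t : Fin n) {c : k} (hc : c ≠ 0) :
    ∃ φ', Reach φ φ' ∧ φ' (X t) = c • φ (X t) ∧ ∀ j, j ≠ t → φ' (X j) = φ (X j) := by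
  classical
  obtain ⟨τ, hτ⟩ := exists_scaling (fun j : Fin n => if j = t then c else 1)
    (by intro j; split_ifs <;> simp [hc])
  refine ⟨_, Reach.source φ τ, ?_, fun j hj => ?_⟩
  · change φ (τ (X t)) = _
    rw [hτ, if_pos rfl, map_smul]
  · change φ (τ (X j)) = _
    rw [hτ, if_neg hj, one_smul]

theorem Reach.exists_swap (φ : PS k n →ₐ[k] PS k m) (i j : Fin n) :
    ∃ φ', Reach φ φ' ∧ ∀ l, φ' (X l) = φ (X (Equiv.swap i j l)) := by
  refine ⟨_, Reach.source φ (permEquiv (Equiv.swap i j)), fun l => ?_⟩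
  change φ (permEquiv (Equiv.swap i j) (X l)) = _
  rw [permEquiv_X]

/-- After scaling, `w` has constant term one and therefore a `c`-th root, so the whole image is a
`c`-th power and ramification extracts its root. -/
theorem Reach.exists_ramification_unit (φ : PS k n →ₐ[k] PS k m) {t : Fin n} {x w : PS k m}
    {a c : ℕ} (hx : constantCoeff x = 0) (ha : 0 < a) (hc : (c : k) ≠ 0) (hw : IsUnit w)
    (ht : φ (X t) = x ^ (a * c) * w) :
    ∃ φ' w', Reach φ φ' ∧ IsUnit w' ∧ φ' (X t) = x ^ a * w' ∧
      ∀ j, j ≠ t → φ' (X j) = φ (X j) := by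
  have hc0 : 0 < c := by
    rcases Nat.eq_zero_or_pos c with rfl | h
    · simp at hc
    · exact h
  have hw0 := isUnit_iff_constantCoeff_ne_zero.mp hw
  obtain ⟨φ₁, h1, h2, h3⟩ := Reach.exists_scale φ t (inv_ne_zero hw0)
  obtain ⟨z, hz, hz1⟩ := exists_pow_eq (w := (constantCoeff w)⁻¹ • w)
    (by
      rw [← coeff_zero_eq_constantCoeff_apply, map_smul, coeff_zero_eq_constantCoeff_apply,
        smul_eq_mul, inv_mul_cancel₀ hw0]) hc
  obtain ⟨φ₂, h4, h5, h6⟩ := Reach.exists_ramification φ₁ (i := t) (g := x ^ a * z) hc0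
    (by rw [map_mul, map_pow, hx, zero_pow ha.ne', zero_mul])
    (by rw [h2, ht, mul_pow, hz, ← pow_mul, mul_smul_comm])
  refine ⟨φ₂, z, h1.trans h4, ?_, h5, fun j hj => (h6 j hj).trans (h3 j hj)⟩
  rw [isUnit_iff_constantCoeff_ne_zero, hz1]
  exact one_ne_zero

/-- Dividing by powers of `φ (X l)` removes powers of `x ^ d` at the cost of units; `d ∣ c i` is
what makes the removal complete. -/
theorem Reach.exists_cleanUp (φ : PS k n →ₐ[k] PS k m) {l : Fin n} {x u : PS k m} {d : ℕ}
    (hl : φ (X l) = x ^ d * u) (hu : IsUnit u) (hx : φ (X l) ≠ 0) (f : Fin n → PS k m)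
    (hf : ∀ i, constantCoeff (f i) = 0) (c : Fin n → ℕ) (hcl : c l = 0) (hc : ∀ i, d ∣ c i)
    (h : ∀ i, φ (X i) = f i * x ^ c i) :
    ∃ φ', Reach φ φ' ∧ ∀ i, (c i = 0 → φ' (X i) = φ (X i)) ∧
      ∃ w, IsUnit w ∧ φ' (X i) = f i * w := by
  classical
  obtain ⟨v, hv⟩ := hu.exists_right_inv
  choose a ha using hc
  let b : Fin n → ℕ := fun i => if c i = 0 then 0 else a i
  have hb : ∀ i, c i = d * b i := by
    intro i
    by_cases hi : c i = 0
    · simp [b, hi]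
    · simp only [b, hi, if_false]
      exact ha i
  obtain ⟨φ', h1, h2⟩ := Reach.exists_contraction_by φ hx (g := fun i => f i * v ^ b i)
    (fun i => by rw [map_mul, hf, zero_mul]) (a := b) (by simp [b, hcl]) (fun i => by
      rw [h i, hl, hb i, mul_pow, pow_mul, mul_assoc (f i), mul_left_comm (v ^ b i),
        ← mul_pow v, mul_comm v, hv, one_pow, mul_one])
  refine ⟨φ', h1, fun i => ⟨fun hi => ?_, v ^ b i, ?_, h2 i⟩⟩
  · rw [h2, h i]
    simp [b, hi]
  · exact (IsUnit.of_mul_eq_one u (by rw [mul_comm]; exact hv)).pow _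

end CleanUp

/-! ### Partially diagonal homomorphisms -/

section Diagonal

variable {k : Type*} [Field k] {n m s : ℕ}

/-- The first `s` variables are sent to powers of variables, up to units. -/
def Diag (p : ℕ) (φ : PS k n →ₐ[k] PS k m) (hn : s ≤ n) (hm : s ≤ m) (α : Fin s → ℕ) : Prop :=
  ∀ i, ∃ u, IsUnit u ∧ φ (X (Fin.castLE hn i)) = X (Fin.castLE hm i) ^ p ^ α i * u

theorem Diag.congr {p : ℕ} {φ φ' : PS k n →ₐ[k] PS k m} {hn : s ≤ n} {hm : s ≤ m} {α : Fin s → ℕ}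
    (h : Diag p φ hn hm α) (h' : ∀ i : Fin s, φ' (X (Fin.castLE hn i)) = φ (X (Fin.castLE hn i))) :
    Diag p φ' hn hm α := fun i => by
  rw [h']
  exact h i

theorem X_pow_mul_unit_ne_zero {i : Fin m} {d : ℕ} {u : PS k m} (hu : IsUnit u) :
    (X i : PS k m) ^ d * u ≠ 0 :=
  mul_ne_zero (pow_ne_zero _ (by
    rw [X_def]
    intro h
    have := congrArg (coeff (Finsupp.single i 1)) h
    simp at this)) hu.ne_zero

/-- No monomial of `Q` is a monomial in the `X i ^ d i`, `i < s`. -/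
def Avoids (d : Fin s → ℕ) (hm : s ≤ m) (Q : PS k m) : Prop :=
  ∀ δ, coeff δ Q ≠ 0 → (∃ i : Fin s, ¬ d i ∣ δ (Fin.castLE hm i)) ∨
    ∃ j : Fin m, s ≤ (j : ℕ) ∧ δ j ≠ 0

theorem castLE_ne_of_le {hm : s ≤ m} {j : Fin m} (hj : s ≤ (j : ℕ)) (i : Fin s) :
    Fin.castLE hm i ≠ j := by
  intro h
  have := congrArg Fin.val h
  simp at this
  omega

theorem exists_castLE_eq {hm : s ≤ m} {j : Fin m} (hj : (j : ℕ) < s) :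
    ∃ i : Fin s, Fin.castLE hm i = j := ⟨⟨j, hj⟩, rfl⟩

theorem avoids_of_coeff_expo {d : Fin s → ℕ} {hm : s ≤ m} {Q : PS k m}
    (h : ∀ a, coeff (expo (Fin.castLE hm) d a) Q = 0) : Avoids d hm Q := by
  intro δ hδ
  by_contra! hc
  obtain ⟨h1, h2⟩ := hc
  choose a ha using h1
  apply hδ
  convert h (Finsupp.equivFunOnFinite.symm a)
  refine Finsupp.ext fun j => ?_
  by_cases hj : (j : ℕ) < s
  · obtain ⟨i, rfl⟩ := exists_castLE_eq (hm := hm) hj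
    rw [expo_apply (Fin.castLE_injective hm), ha]
    rfl
  · push Not at hj
    rw [h2 j hj, expo_apply_of_notMem _ _ (castLE_ne_of_le hj)]

/-- Subtracting power series in the first `s` variables. -/
theorem Diag.exists_avoids {p : ℕ} (hp : 0 < p) {φ : PS k n →ₐ[k] PS k m} {hn : s ≤ n}
    {hm : s ≤ m} {α : Fin s → ℕ} (h : Diag p φ hn hm α) :
    ∃ φ', Reach φ φ' ∧ Diag p φ' hn hm α ∧
      ∀ i : Fin n, s ≤ (i : ℕ) → Avoids (fun i => p ^ α i) hm (φ' (X i)) := by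
  classical
  have hd : ∀ i, 0 < p ^ α i := fun i => pow_pos hp _
  obtain ⟨ι, hι⟩ := exists_algHom_X (k := k) (fun i : Fin s => (X (Fin.castLE hn i) : PS k n))
    (by simp)
  choose u hu hφ using h
  have hθ : ∀ i, (φ.comp ι) (X i) = X (Fin.castLE hm i) ^ p ^ α i * u i := fun i => by
    rw [AlgHom.comp_apply, hι, hφ]
  choose P hP using exists_division (θ := φ.comp ι) (Fin.castLE_injective hm) hd hu hθ
  have hP0 : ∀ i : Fin n, constantCoeff (P (φ (X i))) = 0 := by
    intro i
    have h1 := hP (φ (X i)) 0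
    have h2 : expo (Fin.castLE hm) (fun i => p ^ α i) (0 : Fin s →₀ ℕ) = 0 := by
      simp [expo]
    rw [h2, coeff_zero_eq_constantCoeff_apply, map_sub, constantCoeff_algHom_X,
      constantCoeff_algHom, zero_sub, neg_eq_zero] at h1
    exact h1
  -- The variables from the `s`-th on are moved by series in the first `s` variables, which stay
  -- fixed; so the diagonal part is untouched.
  obtain ⟨τ, hτ⟩ := exists_shear (k := k)
    (fun i : Fin n => if (i : ℕ) < s then 0 else - ι (P (φ (X i))))
    (fun i => by
      split_ifs
      · simp
      · rw [map_neg, constantCoeff_algHom, hP0, neg_zero])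
    {i | (i : ℕ) < s} (fun i hi => by simpa using fun h => absurd hi (not_lt.mpr h))
    (fun χ hχ i => by
      have h1 : χ.comp ι = ι := algHom_ext_X fun j => by
        rw [AlgHom.comp_apply, hι]
        exact hχ _ (by simp)
      split_ifs
      · simp
      · rw [map_neg, ← AlgHom.comp_apply, h1])
  refine ⟨_, Reach.source φ τ, fun i => ⟨u i, hu i, ?_⟩, fun i hi => avoids_of_coeff_expo ?_⟩
  · change φ (τ (X _)) = _
    rw [hτ, if_pos (by simp), add_zero, hφ]
  · change ∀ a, coeff _ (φ (τ (X i))) = 0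
    intro a
    rw [hτ, if_neg (not_lt.mpr hi), map_add, map_neg, ← sub_eq_add_neg]
    exact hP (φ (X i)) a

/-- Removing by contractions the powers of `x` from the images of the first `s` variables. -/
theorem Diag.exists_of_cleanUp {p : ℕ} (hp : 0 < p) {φ : PS k n →ₐ[k] PS k m} {hn : s ≤ n}
    {hm : s ≤ m} {α : Fin s → ℕ} {l : Fin n} {x u : PS k m} {d : ℕ} (hl : φ (X l) = x ^ d * u)
    (hu : IsUnit u) (hl0 : φ (X l) ≠ 0) (c : Fin s → ℕ) (hc : ∀ i, d ∣ c i)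
    (hcl : ∀ i, Fin.castLE hn i = l → c i = 0)
    (h : ∀ i, ∃ v, IsUnit v ∧
      φ (X (Fin.castLE hn i)) = X (Fin.castLE hm i) ^ p ^ α i * v * x ^ c i) :
    ∃ φ', Reach φ φ' ∧ Diag p φ' hn hm α ∧ ∀ i : Fin n, s ≤ (i : ℕ) → φ' (X i) = φ (X i) := by
  classical
  choose v hv hφ using h
  let c' : Fin n → ℕ := fun i => if hi : (i : ℕ) < s then c ⟨i, hi⟩ else 0
  let f : Fin n → PS k m := fun i => if hi : (i : ℕ) < s then
    X (Fin.castLE hm ⟨i, hi⟩) ^ p ^ α ⟨i, hi⟩ * v ⟨i, hi⟩ else φ (X i)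
  have hcs : ∀ i : Fin s, c' (Fin.castLE hn i) = c i := fun i => dif_pos i.2
  have hfs : ∀ i : Fin s, f (Fin.castLE hn i) = X (Fin.castLE hm i) ^ p ^ α i * v i :=
    fun i => dif_pos i.2
  have hcge : ∀ i : Fin n, s ≤ (i : ℕ) → c' i = 0 := fun i hi => dif_neg (not_lt.mpr hi)
  have hfge : ∀ i : Fin n, s ≤ (i : ℕ) → f i = φ (X i) := fun i hi => dif_neg (not_lt.mpr hi)
  obtain ⟨φ', h2, h3⟩ := Reach.exists_cleanUp φ hl hu hl0 f
    (fun i => by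
      rcases lt_or_ge (i : ℕ) s with hi | hi
      · obtain ⟨j, rfl⟩ := exists_castLE_eq (hm := hn) hi
        rw [hfs, map_mul, map_pow, constantCoeff_X, zero_pow (pow_pos hp _).ne', zero_mul]
      · rw [hfge i hi, constantCoeff_algHom_X])
    c' (by
      rcases lt_or_ge (l : ℕ) s with hi | hi
      · obtain ⟨j, hj⟩ := exists_castLE_eq (hm := hn) hi
        rw [← hj, hcs, hcl j hj]
      · exact hcge l hi) (fun i => by
      rcases lt_or_ge (i : ℕ) s with hi | hi
      · obtain ⟨j, rfl⟩ := exists_castLE_eq (hm := hn) hi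
        rw [hcs]
        exact hc j
      · rw [hcge i hi]
        exact dvd_zero _) (fun i => by
      rcases lt_or_ge (i : ℕ) s with hi | hi
      · obtain ⟨j, rfl⟩ := exists_castLE_eq (hm := hn) hi
        rw [hφ, hcs, hfs]
      · rw [hcge i hi, hfge i hi, pow_zero, mul_one])
  refine ⟨φ', h2, fun i => ?_, fun i hi => (h3 i).1 (hcge i hi)⟩
  obtain ⟨w, hw, h4⟩ := (h3 (Fin.castLE hn i)).2
  exact ⟨v i * w, (hv i).mul hw, by rw [h4, hfs, mul_assoc]⟩

/-- Blowing-up along a diagonal variable, followed by contractions. -/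
theorem Diag.exists_pivot {p : ℕ} (hp : 0 < p) {φ : PS k n →ₐ[k] PS k m} {hn : s ≤ n}
    {hm : s ≤ m} {α : Fin s → ℕ} (h : Diag p φ hn hm α) {l : Fin s} {N : Fin m → ℕ}
    (hN : ∀ i, p ^ α l ∣ N i) (hNl : N (Fin.castLE hm l) = 0) {ψ : PS k m →ₐ[k] PS k m}
    (hψ : ∀ j, ψ (X j) = X j * X (Fin.castLE hm l) ^ N j) :
    ∃ φ', Reach φ φ' ∧ Diag p φ' hn hm α ∧
      ∀ i : Fin n, s ≤ (i : ℕ) → φ' (X i) = ψ (φ (X i)) := by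
  choose u hu hφ using h
  have hval : ∀ i : Fin s, (ψ.comp φ) (X (Fin.castLE hn i)) =
      X (Fin.castLE hm i) ^ p ^ α i * ψ (u i) *
        X (Fin.castLE hm l) ^ (N (Fin.castLE hm i) * p ^ α i) := by
    intro i
    rw [AlgHom.comp_apply, hφ, map_mul, map_pow, hψ, mul_pow, ← pow_mul]
    ring
  have hl : (ψ.comp φ) (X (Fin.castLE hn l)) = X (Fin.castLE hm l) ^ p ^ α l * ψ (u l) := by
    rw [hval, hNl, zero_mul, pow_zero, mul_one]
  obtain ⟨φ', h2, h3, h4⟩ := Diag.exists_of_cleanUp hp (hn := hn) (hm := hm) (α := α) hl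
    ((hu l).map ψ) (by rw [hl]; exact X_pow_mul_unit_ne_zero ((hu l).map ψ))
    (fun i => N (Fin.castLE hm i) * p ^ α i) (fun i => Dvd.dvd.mul_right (hN _) _)
    (fun i hi => by rw [Fin.castLE_injective hn hi, hNl, zero_mul])
    (fun i => ⟨ψ (u i), (hu i).map ψ, hval i⟩)
  exact ⟨φ', (Reach.pivot φ hNl hψ).trans h2, h3, h4⟩

/-- Only the exponent of the pivot changes, and it changes by a multiple of `d l`. -/
theorem Avoids.pivot {d : Fin s → ℕ} {hm : s ≤ m} {Q : PS k m} (h : Avoids d hm Q) {l : Fin s}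
    {N : Fin m → ℕ} (hN : ∀ i, d l ∣ N i) {ψ : PS k m →ₐ[k] PS k m}
    (hψ : ∀ j, ψ (X j) = X j * X (Fin.castLE hm l) ^ N j) : Avoids d hm (ψ Q) := by
  intro δ hδ
  obtain ⟨e, rfl, he⟩ := exists_of_coeff_monomial_algHom_ne_zero ψ _
    (algHom_monomial_eq_shiftExp hψ) _ _ hδ
  rcases h e he with ⟨i, hi⟩ | ⟨j, hj, hej⟩
  · left
    refine ⟨i, ?_⟩
    by_cases hil : i = l
    · subst hil
      rw [shiftExp_apply_same, ← (Nat.dvd_add_iff_left (Finset.dvd_sum fun j _ =>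
        Dvd.dvd.mul_right (hN j) _))]
      exact hi
    · rwa [shiftExp_apply_of_ne (fun h => hil (Fin.castLE_injective hm h))]
  · right
    refine ⟨j, hj, ?_⟩
    rwa [shiftExp_apply_of_ne (castLE_ne_of_le hj l).symm]

/-- After suitable blowing-ups, the exponents of `φ (X t)` in the first `j` variables have a
smallest element. -/
theorem Diag.exists_min {p : ℕ} (hp : 0 < p) {φ : PS k n →ₐ[k] PS k m} {hn : s ≤ n} {hm : s ≤ m}
    {α : Fin s → ℕ} (h : Diag p φ hn hm α) {t : Fin n} (hts : s ≤ (t : ℕ)) (ht : φ (X t) ≠ 0)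
    (hav : Avoids (fun i => p ^ α i) hm (φ (X t))) (j : ℕ) (hj : j ≤ s) :
    ∃ φ', Reach φ φ' ∧ Diag p φ' hn hm α ∧ Avoids (fun i => p ^ α i) hm (φ' (X t)) ∧
      ∃ β : Fin s → ℕ, (∀ δ, coeff δ (φ' (X t)) ≠ 0 → ∀ i : Fin s, (i : ℕ) < j →
          β i ≤ δ (Fin.castLE hm i)) ∧
        ∃ δ, coeff δ (φ' (X t)) ≠ 0 ∧ ∀ i : Fin s, (i : ℕ) < j → δ (Fin.castLE hm i) = β i := by
  classical
  induction j with
  | zero =>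
    refine ⟨φ, Relation.ReflTransGen.refl, h, hav, 0, fun _ _ i hi => absurd hi (by omega), ?_⟩
    obtain ⟨δ, hδ⟩ : ∃ δ, coeff δ (φ (X t)) ≠ 0 := by
      by_contra! hc
      exact ht (by ext δ; simpa using hc δ)
    exact ⟨δ, hδ, fun i hi => absurd hi (by omega)⟩
  | succ j ih =>
    obtain ⟨φ₁, h1, h2, h3, β, h4, h5⟩ := ih (by omega)
    set l : Fin s := ⟨j, by omega⟩ with hl
    set L := Fin.castLE hm l with hL
    set Q := φ₁ (X t) with hQ
    have hne : {b : ℕ | ∃ δ, coeff δ Q ≠ 0 ∧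
        (∀ i : Fin s, (i : ℕ) < j → δ (Fin.castLE hm i) = β i) ∧ δ L = b}.Nonempty := by
      obtain ⟨δ, hδ, hδ'⟩ := h5
      exact ⟨_, δ, hδ, hδ', rfl⟩
    obtain ⟨δ₀, hδ₀, hδ₀β, hδ₀b⟩ := Nat.sInf_mem hne
    set b := sInf {b : ℕ | ∃ δ, coeff δ Q ≠ 0 ∧
        (∀ i : Fin s, (i : ℕ) < j → δ (Fin.castLE hm i) = β i) ∧ δ L = b} with hb
    -- This shift is divisible by `p ^ α l`, as contraction and `Avoids` require, and is at least
    -- `b`. An exponent that is not minimal in the first `j` places has there a sum larger by at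
    -- least one than `δ₀`; the blowing-up then adds at least `N₀ ≥ b` more to its `l`-th place than
    -- to that of `δ₀`. Thus `δ₀` becomes minimal there too.
    set N₀ := p ^ α l * b with hN₀
    have hbN : b ≤ N₀ := Nat.le_mul_of_pos_left _ (pow_pos hp _)
    set N : Fin m → ℕ := fun i => if (i : ℕ) < j then N₀ else 0 with hN
    obtain ⟨ψ, hψ⟩ := exists_algHom_X (k := k) (fun i : Fin m => (X i * X L ^ N i : PS k m))
      (fun i => by rw [map_mul, constantCoeff_X, zero_mul])
    have hNd : ∀ i, p ^ α l ∣ N i := fun i => by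
      simp only [hN]
      split_ifs
      · exact Dvd.intro _ rfl
      · exact dvd_zero _
    obtain ⟨φ₂, h6, h7, h8⟩ := h2.exists_pivot hp (l := l) (N := N) hNd
      (by simp [hN, hl]) hψ
    set S : Finset (Fin m) := Finset.univ.filter (fun i : Fin m => (i : ℕ) < j) with hS
    have hsum : ∀ δ : Fin m →₀ ℕ, ∑ i, N i * δ i =
        N₀ * ∑ i ∈ S, δ i := by
      intro δ
      rw [hS, Finset.mul_sum, Finset.sum_filter]
      refine Finset.sum_congr rfl fun i _ => ?_
      simp only [hN]
      split_ifs <;> simp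
    have hLi : ∀ i : Fin s, (i : ℕ) < j → Fin.castLE hm i ≠ L := by
      intro i hi heq
      have := Fin.castLE_injective hm heq
      rw [this] at hi
      simp [hl] at hi
    refine ⟨φ₂, h1.trans h6, h7, ?_, ?_⟩
    · rw [h8 t hts]
      exact h3.pivot hNd hψ
    rw [h8 t hts]
    refine ⟨Function.update β l (shiftExp L N δ₀ L), fun δ hδ i hi => ?_, shiftExp L N δ₀, ?_,
      fun i hi => ?_⟩
    · obtain ⟨e, rfl, he⟩ := exists_of_coeff_monomial_algHom_ne_zero ψ _
        (algHom_monomial_eq_shiftExp hψ) _ _ hδ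
      by_cases hil : i = l
      · subst hil
        rw [Function.update_self, shiftExp_apply_same, hsum, ← hL, shiftExp_apply_same, hsum,
          hδ₀b]
        have hle : ∀ i : Fin m, i ∈ S →
            δ₀ i ≤ e i := by
          intro i hi
          rw [hS, Finset.mem_filter] at hi
          obtain ⟨i', rfl⟩ := exists_castLE_eq (hm := hm) (j := i) (by omega)
          rw [hδ₀β i' (by simpa using hi.2)]
          exact h4 e he i' (by simpa using hi.2)
        by_cases hall : ∀ i : Fin s, (i : ℕ) < j → e (Fin.castLE hm i) = β i
        · have h9 : b ≤ e L := Nat.sInf_le ⟨e, he, hall, rfl⟩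
          exact add_le_add h9 (Nat.mul_le_mul_left _ (Finset.sum_le_sum hle))
        · push Not at hall
          obtain ⟨i', hi', hne'⟩ := hall
          have h10 : ∑ i ∈ S, δ₀ i < ∑ i ∈ S, e i := by
            refine Finset.sum_lt_sum hle ⟨Fin.castLE hm i', by simpa [hS] using hi', ?_⟩
            rw [hδ₀β i' hi']
            exact lt_of_le_of_ne (h4 e he i' hi') (Ne.symm hne')
          calc b + N₀ * ∑ i ∈ S, δ₀ i
              ≤ N₀ * (∑ i ∈ S, δ₀ i + 1) := by rw [mul_add]; omega
            _ ≤ N₀ * ∑ i ∈ S, e i := Nat.mul_le_mul_left _ h10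
            _ ≤ _ := Nat.le_add_left _ _
      · have hij : (i : ℕ) < j := by
          have : (i : ℕ) ≠ j := fun h => hil (Fin.ext h)
          omega
        rw [Function.update_of_ne hil, shiftExp_apply_of_ne (hLi i hij)]
        exact h4 e he i hij
    · rwa [coeff_monomial_algHom ψ _ (algHom_monomial_eq_shiftExp hψ) (shiftExp_injective L N)]
    · by_cases hil : i = l
      · subst hil
        rw [Function.update_self]
      · have hij : (i : ℕ) < j := by
          have : (i : ℕ) ≠ j := fun h => hil (Fin.ext h)
          omega
        rw [Function.update_of_ne hil, shiftExp_apply_of_ne (hLi i hij), hδ₀β i hij]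

end Diagonal

/-- In the second case divide by the `p`-part of `a`: the cofactor of `a` is invertible modulo `p ^
e`, so the congruence can be solved for `N`. -/
theorem exists_dvd_add_mul {p : ℕ} (hp : p.Prime) {a b e : ℕ} (ha : a ≠ 0)
    (h : p ^ e ∣ b ∨ p ^ padicValNat p a ∣ b) : ∃ N, p ^ e ∣ b + N * a := by
  have := Fact.mk hp
  rcases h with h | ⟨b', rfl⟩
  · exact ⟨0, by simpa using h⟩
  obtain ⟨c, hc⟩ := pow_padicValNat_dvd (p := p) (n := a)
  have hpc : ¬ p ∣ c := by
    rintro ⟨c', rfl⟩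
    apply pow_succ_padicValNat_not_dvd (p := p) ha
    exact ⟨c', by conv_lhs => rw [hc]
                  ring⟩
  have hcop : Nat.Coprime c (p ^ e) := ((Nat.Prime.coprime_iff_not_dvd hp).mpr hpc).symm.pow_right e
  obtain ⟨x, hx⟩ : ∃ x : ℕ, (c * x : ℤ) ≡ 1 [ZMOD (p ^ e : ℕ)] := by
    obtain ⟨x, hx⟩ := Int.mod_coprime hcop
    have hpe : (0 : ℤ) < (p ^ e : ℕ) := by exact_mod_cast pow_pos hp.pos e
    refine ⟨(x % (p ^ e : ℕ)).toNat, ?_⟩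
    rw [Int.toNat_of_nonneg (Int.emod_nonneg _ hpe.ne')]
    exact ((Int.mod_modEq x _).mul_left _).trans hx
  have hpe : 1 ≤ p ^ e := pow_pos hp.pos e
  -- `x` inverts `c` modulo `p ^ e`, and `p ^ e - 1` represents `-1` by a natural number.
  refine ⟨b' * (p ^ e - 1) * x, ?_⟩
  have h1 : p ^ padicValNat p a * b' + b' * (p ^ e - 1) * x * a =
      p ^ padicValNat p a * (b' + b' * (p ^ e - 1) * (c * x)) := by
    conv_lhs => rw [hc]
    have h2 : padicValNat p (p ^ padicValNat p a * c) = padicValNat p a := by rw [← hc]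
    rw [h2]
    ring
  rw [h1]
  apply Dvd.dvd.mul_left
  rw [← Int.natCast_dvd_natCast, ← Int.modEq_zero_iff_dvd]
  push_cast [hpe]
  have h3 : (b' + b' * ((p : ℤ) ^ e - 1) * (c * x)) ≡ b' + b' * ((p : ℤ) ^ e - 1) * 1
      [ZMOD (p ^ e : ℕ)] := (hx.mul_left _).add_left _
  push_cast at h3
  refine h3.trans ?_
  rw [Int.modEq_zero_iff_dvd]
  exact ⟨b', by ring⟩

/-! ### Lowering an exponent by means of a monomial image -/

section Reduction

variable {k : Type*} [Field k] {n m s : ℕ}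

theorem isUnit_one_add_X (i : Fin m) : IsUnit (1 + X i : PS k m) := by
  rw [isUnit_iff_constantCoeff_ne_zero]
  simp

/-- Only variables in `T` serve as pivots, since `Diag.exists_sum_lt` applies this when one of the
first `s` images is no longer diagonal. -/
theorem Reach.exists_contraction_diag (φ : PS k n →ₐ[k] PS k m) {hn : s ≤ n} {t : Fin n}
    (ht : s ≤ (t : ℕ)) (T : Finset (Fin s)) {x u : Fin s → PS k m} {d q : Fin s → ℕ}
    (hu : ∀ j ∈ T, IsUnit (u j)) (h0 : ∀ j ∈ T, φ (X (Fin.castLE hn j)) ≠ 0)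
    (hφ : ∀ j ∈ T, φ (X (Fin.castLE hn j)) = x j ^ d j * u j) {g : PS k m}
    (hg : constantCoeff g = 0) (h : φ (X t) = g * ∏ j ∈ T, x j ^ (d j * q j)) :
    ∃ φ' w, Reach φ φ' ∧ IsUnit w ∧ φ' (X t) = g * w ∧ ∀ j, j ≠ t → φ' (X j) = φ (X j) := by
  classical
  have hv : ∀ j, ∃ v, j ∈ T → u j * v = 1 := by
    intro j
    by_cases hj : j ∈ T
    · obtain ⟨v, hv⟩ := (hu j hj).exists_right_inv
      exact ⟨v, fun _ => hv⟩
    · exact ⟨0, fun h => absurd h hj⟩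
  choose v hv using hv
  let a : Fin n → ℕ := fun l => if hl : (l : ℕ) < s then
    (if (⟨l, hl⟩ : Fin s) ∈ T then q ⟨l, hl⟩ else 0) else 0
  have has : ∀ j : Fin s, a (Fin.castLE hn j) = if j ∈ T then q j else 0 := fun j => dif_pos j.2
  have hage : ∀ l : Fin n, s ≤ (l : ℕ) → a l = 0 := fun l hl => dif_neg (not_lt.mpr hl)
  have hprod : ∏ l, φ (X l) ^ a l = ∏ j ∈ T, φ (X (Fin.castLE hn j)) ^ q j := by
    rw [← Fintype.prod_of_injective (Fin.castLE hn) (Fin.castLE_injective hn)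
      (fun j => φ (X (Fin.castLE hn j)) ^ (if j ∈ T then q j else 0))
      (fun l => φ (X l) ^ a l) (fun l hl => ?_) (fun j => by rw [has])]
    · rw [← Finset.prod_subset (Finset.subset_univ T)]
      · exact Finset.prod_congr rfl fun j hj => by rw [if_pos hj]
      · intro j _ hj
        rw [if_neg hj, pow_zero]
    · rw [hage l, pow_zero]
      by_contra hlt
      push Not at hlt
      exact hl (exists_castLE_eq hlt)
  have hw : IsUnit (∏ j ∈ T, v j ^ q j) := by
    rw [IsUnit.prod_iff]
    intro j hj
    exact (IsUnit.of_mul_eq_one (u j) (by rw [mul_comm]; exact hv j hj)).pow _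
  obtain ⟨φ', h1, h2, h3⟩ := Reach.exists_contraction_of φ (i := t) (g := g * ∏ j ∈ T, v j ^ q j)
    (by rw [map_mul, hg, zero_mul]) (a := a) (hage t ht) (fun l hl => by
      have hls : (l : ℕ) < s := by
        by_contra hc
        exact hl (hage l (not_lt.mp hc))
      obtain ⟨j, rfl⟩ := exists_castLE_eq (hm := hn) hls
      rw [has] at hl
      by_cases hj : j ∈ T
      · exact h0 j hj
      · rw [if_neg hj] at hl
        exact absurd rfl hl) (by
      rw [hprod, h, mul_assoc, ← Finset.prod_mul_distrib]
      congr 1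
      refine Finset.prod_congr rfl fun j hj => ?_
      rw [hφ j hj, mul_pow, ← pow_mul, mul_left_comm, ← mul_pow, mul_comm (v j), hv j hj,
        one_pow, mul_one])
  exact ⟨φ', _, h1, hw, h2, h3⟩

theorem exists_ordPow_mul {p : ℕ} (hp : p.Prime) [CharP k p] {b : ℕ} (hb : b ≠ 0) :
    ∃ c : ℕ, b = p ^ padicValNat p b * c ∧ (c : k) ≠ 0 := by
  have := Fact.mk hp
  obtain ⟨c, hc⟩ := pow_padicValNat_dvd (p := p) (n := b)
  refine ⟨c, hc, fun h => ?_⟩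
  obtain ⟨c', rfl⟩ := (CharP.cast_eq_zero_iff k p c).mp h
  apply pow_succ_padicValNat_not_dvd (p := p) hb
  exact ⟨c', by conv_lhs => rw [hc]
                ring⟩

/-- If a further variable is sent to a monomial in the diagonal variables that is not a
monomial in their given powers, then one of these powers can be lowered. -/
theorem Diag.exists_sum_lt {p : ℕ} (hp : p.Prime) [CharP k p] {φ : PS k n →ₐ[k] PS k m}
    {hn : s ≤ n} {hm : s ≤ m} {α : Fin s → ℕ} (h : Diag p φ hn hm α) {t : Fin n}
    (hts : s ≤ (t : ℕ)) {β : Fin s → ℕ} {w : PS k m} (hw : IsUnit w)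
    (ht : φ (X t) = (∏ i, X (Fin.castLE hm i) ^ β i) * w) (hβ : ∃ i, ¬ p ^ α i ∣ β i) :
    ∃ φ' α', Reach φ φ' ∧ Diag p φ' hn hm α' ∧ ∑ i, α' i < ∑ i, α i := by
  classical
  have := Fact.mk hp
  -- With the least `p`-adic valuation among the bad exponents, every `β j` can be made divisible by
  -- `p ^ α j` by adding a multiple of `β i`. The blowing-up of `X i` by these multiples spoils `φ
  -- (X i)`, but that image is discarded in the final swap.
  obtain ⟨i, hi, hmin⟩ := Finset.exists_min_image
    (Finset.univ.filter fun i => ¬ p ^ α i ∣ β i) (fun i => padicValNat p (β i))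
    (by obtain ⟨i, hi⟩ := hβ; exact ⟨i, by simpa using hi⟩)
  simp only [Finset.mem_filter, Finset.mem_univ, true_and] at hi hmin
  have hβi : β i ≠ 0 := fun h0 => hi (by rw [h0]; exact dvd_zero _)
  have hvlt : padicValNat p (β i) < α i := by
    by_contra hc
    exact hi ((pow_dvd_pow p (not_lt.mp hc)).trans pow_padicValNat_dvd)
  have hNf : ∀ j, ∃ N, p ^ α j ∣ β j + N * β i := by
    intro j
    refine exists_dvd_add_mul hp hβi ?_
    by_cases hj : p ^ α j ∣ β j
    · exact Or.inl hj
    · exact Or.inr ((pow_dvd_pow p (hmin j hj)).trans pow_padicValNat_dvd)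
  choose Nf hNf using hNf
  choose q hq using hNf
  let N : Fin m → ℕ := fun x => if hx : (x : ℕ) < s then
    (if (⟨x, hx⟩ : Fin s) = i then 0 else Nf ⟨x, hx⟩) else 0
  have hNs : ∀ j : Fin s, N (Fin.castLE hm j) = if j = i then 0 else Nf j := fun j => dif_pos j.2
  have hNge : ∀ x : Fin m, s ≤ (x : ℕ) → N x = 0 := fun x hx => dif_neg (not_lt.mpr hx)
  have hNprod : ∏ x, (X x : PS k m) ^ N x =
      ∏ j ∈ Finset.univ.erase i, X (Fin.castLE hm j) ^ Nf j := by
    rw [← Fintype.prod_of_injective (Fin.castLE hm) (Fin.castLE_injective hm)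
      (fun j => (X (Fin.castLE hm j) : PS k m) ^ (if j = i then 0 else Nf j))
      (fun x => (X x : PS k m) ^ N x) (fun x hx => ?_) (fun j => by rw [hNs]),
      ← Finset.mul_prod_erase _ _ (Finset.mem_univ i), if_pos rfl, pow_zero, one_mul]
    · exact Finset.prod_congr rfl fun j hj => by rw [if_neg (Finset.ne_of_mem_erase hj)]
    · rw [hNge x, pow_zero]
      by_contra hlt
      push Not at hlt
      exact hx (exists_castLE_eq hlt)
  obtain ⟨ψ, hψ⟩ := exists_algHom_X (k := k)
    (fun x : Fin m => (if x = Fin.castLE hm i then X x * ∏ x', X x' ^ N x' else X x : PS k m))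
    (by intro x; split_ifs <;> simp)
  have hψi : ψ (X (Fin.castLE hm i)) = X (Fin.castLE hm i) * ∏ x', X x' ^ N x' := by
    rw [hψ, if_pos rfl]
  have hψj : ∀ x, x ≠ Fin.castLE hm i → ψ (X x) = X x := fun x hx => by rw [hψ, if_neg hx]
  have h1 := Reach.coPivot φ (ψ := ψ) (i := Fin.castLE hm i) (N := N)
    (by rw [hNs, if_pos rfl]) hψi hψj
  choose u hu hφ using h
  have hval : ∀ j, j ≠ i → (ψ.comp φ) (X (Fin.castLE hn j)) =
      X (Fin.castLE hm j) ^ p ^ α j * ψ (u j) := by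
    intro j hj
    rw [AlgHom.comp_apply, hφ, map_mul, map_pow,
      hψj _ (fun h => hj (Fin.castLE_injective hm h))]
  have hvalt : (ψ.comp φ) (X t) = (X (Fin.castLE hm i) ^ β i * ψ w) *
      ∏ j ∈ Finset.univ.erase i, X (Fin.castLE hm j) ^ (p ^ α j * q j) := by
    have h2 : ∏ j ∈ Finset.univ.erase i, ψ (X (Fin.castLE hm j)) ^ β j =
        ∏ j ∈ Finset.univ.erase i, (X (Fin.castLE hm j) : PS k m) ^ β j := by
      refine Finset.prod_congr rfl fun j hj => ?_
      rw [hψj _ (fun h => Finset.ne_of_mem_erase hj (Fin.castLE_injective hm h))]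
    have h3 : ∏ j ∈ Finset.univ.erase i, (X (Fin.castLE hm j) : PS k m) ^ (p ^ α j * q j) =
        (∏ j ∈ Finset.univ.erase i, (X (Fin.castLE hm j) : PS k m) ^ β j) *
          (∏ j ∈ Finset.univ.erase i, (X (Fin.castLE hm j) : PS k m) ^ Nf j) ^ β i := by
      rw [← Finset.prod_pow, ← Finset.prod_mul_distrib]
      refine Finset.prod_congr rfl fun j _ => ?_
      rw [← hq, pow_add, pow_mul]
    rw [AlgHom.comp_apply, ht, map_mul, map_prod]
    simp only [map_pow]
    rw [← Finset.mul_prod_erase _ _ (Finset.mem_univ i), h2, hψi, hNprod, h3]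
    ring
  obtain ⟨φ₂, w₂, h2, hw₂, h3, h4⟩ := Reach.exists_contraction_diag (ψ.comp φ) (hn := hn) hts
    (Finset.univ.erase i) (x := fun j => X (Fin.castLE hm j)) (u := fun j => ψ (u j))
    (d := fun j => p ^ α j) (q := q) (fun j _ => (hu j).map ψ)
    (fun j hj => by
      rw [hval j (Finset.ne_of_mem_erase hj)]
      exact X_pow_mul_unit_ne_zero ((hu j).map ψ))
    (fun j hj => hval j (Finset.ne_of_mem_erase hj))
    (by rw [map_mul, map_pow, constantCoeff_X, zero_pow hβi, zero_mul]) hvalt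
  obtain ⟨c, hc, hck⟩ := exists_ordPow_mul (k := k) hp hβi
  obtain ⟨φ₃, w₃, h5, hw₃, h6, h7⟩ := Reach.exists_ramification_unit φ₂ (t := t)
    (x := X (Fin.castLE hm i)) (w := ψ w * w₂) (a := p ^ padicValNat p (β i)) (c := c)
    (constantCoeff_X _) (pow_pos hp.pos _) hck ((hw.map ψ).mul hw₂) (by rw [h3, ← hc, mul_assoc])
  -- The image of `X t` is now a unit times a `p`-power of the `i`-th variable, with exponent below
  -- `p ^ α i`; it takes over the `i`-th place.
  obtain ⟨φ₄, h8, h9⟩ := Reach.exists_swap φ₃ (Fin.castLE hn i) t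
  refine ⟨φ₄, Function.update α i (padicValNat p (β i)),
    ((h1.trans h2).trans h5).trans h8, fun j => ?_, ?_⟩
  · rw [h9]
    by_cases hj : j = i
    · subst hj
      rw [Equiv.swap_apply_left, Function.update_self]
      exact ⟨w₃, hw₃, h6⟩
    · have hjt : Fin.castLE hn j ≠ t := castLE_ne_of_le hts j
      rw [Equiv.swap_apply_of_ne_of_ne (fun h => hj (Fin.castLE_injective hn h)) hjt,
        Function.update_of_ne hj, h7 _ hjt, h4 _ hjt, hval j hj]
      exact ⟨_, (hu j).map ψ, rfl⟩
  · rw [Finset.sum_update_of_mem (Finset.mem_univ i),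
      ← Finset.add_sum_erase _ _ (Finset.mem_univ i), Finset.sdiff_singleton_eq_erase]
    omega

end Reduction

/-! ### Turning a nonunit into a power of a new variable -/

section Purify

variable {k : Type*} [Field k] {m : ℕ}

/-- Integer weights for which a given lexicographically smallest exponent is the smallest. -/
theorem weight_lt_weight_of_lex {δ e : Fin m →₀ ℕ} {w : Fin m → ℕ} {B : ℕ}
    (hw : ∀ i j : Fin m, i < j → w j * B ≤ w i) (hw0 : ∀ i, 0 < w i)
    (hB : ∑ i, δ i < B) (h : toLex δ < toLex e) : ∑ i, w i * δ i < ∑ i, w i * e i := by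
  classical
  obtain ⟨j, hj, hlt⟩ := h
  change ∀ i, i < j → δ i = e i at hj
  change δ j < e j at hlt
  have hB0 : 0 < B := by omega
  -- All that `δ` has after the first differing place `j` weighs less than the surplus of at least
  -- `w j` that `e` has at `j`.
  have h1 : (∑ i ∈ Finset.univ.filter (fun i => j < i), w i * δ i) < w j := by
    refine Nat.lt_of_mul_lt_mul_right (a := B) ?_
    rw [Finset.sum_mul]
    calc ∑ i ∈ Finset.univ.filter (fun i => j < i), w i * δ i * B
        ≤ ∑ i ∈ Finset.univ.filter (fun i => j < i), w j * δ i := by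
          refine Finset.sum_le_sum fun i hi => ?_
          rw [Finset.mem_filter] at hi
          calc w i * δ i * B = w i * B * δ i := by ring
            _ ≤ w j * δ i := Nat.mul_le_mul_right _ (hw j i hi.2)
      _ ≤ ∑ i, w j * δ i := Finset.sum_le_univ_sum_of_nonneg fun _ => Nat.zero_le _
      _ = w j * ∑ i, δ i := by rw [Finset.mul_sum]
      _ < w j * B := Nat.mul_lt_mul_of_pos_left hB (hw0 j)
  have hsplit : ∀ f : Fin m → ℕ, ∑ i, f i = ∑ i ∈ Finset.univ.filter (fun i => j < i), f i +
      (f j + ∑ i ∈ Finset.univ.filter (fun i => i < j), f i) := by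
    intro f
    rw [← Finset.sum_filter_add_sum_filter_not Finset.univ (fun i => j < i)]
    congr 1
    have : Finset.univ.filter (fun i => ¬ j < i) =
        insert j (Finset.univ.filter (fun i => i < j)) := by
      ext i
      simp only [Finset.mem_filter, Finset.mem_univ, true_and, Finset.mem_insert, not_lt]
      rw [le_iff_lt_or_eq]
      tauto
    rw [this, Finset.sum_insert (by simp)]
  rw [hsplit (fun i => w i * δ i), hsplit (fun i => w i * e i)]
  have h2 : ∑ i ∈ Finset.univ.filter (fun i => i < j), w i * δ i =
      ∑ i ∈ Finset.univ.filter (fun i => i < j), w i * e i := by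
    refine Finset.sum_congr rfl fun i hi => ?_
    rw [hj i (Finset.mem_filter.mp hi).2]
  have h3 : w j * δ j + w j ≤ w j * e j := by
    rw [← Nat.mul_succ]
    exact Nat.mul_le_mul_left _ hlt
  rw [h2]
  omega

/-- If `h` involves a monomial in the variables from the `s`-th one on, then automorphisms and
blowing-ups transform it into a power of the `s`-th variable, up to a unit. -/
theorem exists_purify {h : PS k m} (h0 : constantCoeff h = 0) {s : ℕ}
    (hδ : ∃ δ, coeff δ h ≠ 0 ∧ ∀ i : Fin m, (i : ℕ) < s → δ i = 0) :
    ∃ z : Fin m, (z : ℕ) = s ∧ ∃ b, 0 < b ∧ ∀ N₀, b ≤ N₀ → ∃ Ψ : PS k m →ₐ[k] PS k m,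
      (∀ {n : ℕ} (φ : PS k n →ₐ[k] PS k m), Reach φ (Ψ.comp φ)) ∧
      (∀ i : Fin m, (i : ℕ) < s → Ψ (X i) = X i * X z ^ N₀) ∧
      ∃ w, IsUnit w ∧ Ψ h = X z ^ b * w := by
  classical
  obtain ⟨δ, hδ, hδs⟩ := hδ
  have hh : h ≠ 0 := by
    rintro rfl
    simp at hδ
  obtain ⟨δ₀, hδ₀⟩ := exists_finsupp_eq_lexOrder_of_ne_zero hh
  have hc₀ : coeff δ₀ h ≠ 0 := coeff_ne_zero_of_lexOrder hδ₀.symm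
  have hmin : ∀ e, coeff e h ≠ 0 → toLex δ₀ ≤ toLex e := fun e he => by
    have := lexOrder_le_of_coeff_ne_zero he
    rw [hδ₀] at this
    exact_mod_cast this
  have hδ₀s : ∀ i : Fin m, (i : ℕ) < s → δ₀ i = 0 := by
    intro i hi
    rcases (hmin δ hδ).eq_or_lt with heq | hlt
    · have : δ₀ = δ := heq
      rw [this, hδs i hi]
    · obtain ⟨j, hj, hlt⟩ := hlt
      change ∀ i, i < j → δ₀ i = δ i at hj
      change δ₀ j < δ j at hlt
      have hjs : s ≤ (j : ℕ) := by
        by_contra hc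
        rw [hδs j (not_le.mp hc)] at hlt
        omega
      rw [hj i (Fin.lt_def.mpr (by omega)), hδs i hi]
  obtain ⟨j₀, hj₀⟩ : ∃ j, δ₀ j ≠ 0 := by
    by_contra! hc
    have : δ₀ = 0 := by
      ext j
      simpa using hc j
    rw [this, coeff_zero_eq_constantCoeff_apply, h0] at hc₀
    exact hc₀ rfl
  have hsm : s < m := by
    by_contra hc
    exact hj₀ (hδ₀s j₀ (by omega))
  set z : Fin m := ⟨s, hsm⟩ with hz
  -- The last variable is used as pivot; it is exchanged with `z` at the end.
  set l : Fin m := ⟨m - 1, by omega⟩ with hl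
  set B := ∑ i, δ₀ i + 1 with hB
  -- Digit weights in base `B > ∑ δ₀`, with weight one for the last variable: `δ₀` has the strictly
  -- smallest weight among the exponents of `h` that vanish in the first `s` places.
  set w : Fin m → ℕ := fun i => B ^ (m - 1 - (i : ℕ)) with hw
  have hw0 : ∀ i, 0 < w i := fun i => pow_pos (by omega) _
  have hwl : w l = 1 := by simp [hw, hl]
  have hwB : ∀ i j : Fin m, i < j → w j * B ≤ w i := by
    intro i j hij
    simp only [hw]
    rw [← pow_succ]
    apply Nat.pow_le_pow_right (by omega)
    have := j.2
    rw [Fin.lt_def] at hij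
    omega
  set W := ∑ i, w i * δ₀ i with hW
  obtain ⟨σ, hσ⟩ := exists_shear (k := k)
    (fun j : Fin m => if s ≤ (j : ℕ) ∧ j ≠ l then X l ^ w j else 0)
    (fun j => by
      split_ifs
      · rw [map_pow, constantCoeff_X, zero_pow (hw0 j).ne']
      · simp) {l} (fun i hi => by
      rw [Set.mem_singleton_iff] at hi
      rw [if_neg (by simp [hi])]) (fun χ hχ i => by
      split_ifs
      · rw [map_pow, hχ l rfl]
      · simp)
  -- `κ` restricts to the `X l`-axis. After the shear, the exponents of `h` supported in the
  -- variables from `s` on become powers of `X l` given by their weights, and the others vanish;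
  -- hence the term of `δ₀` cannot cancel.
  obtain ⟨κ, hκ⟩ := exists_algHom_X (k := k) (fun j : Fin m => (if j = l then X j else 0 : PS k m))
    (by intro j; split_ifs <;> simp)
  have hκc : ∀ (f : PS k m) c, coeff (Finsupp.single l c) (κ f) = coeff (Finsupp.single l c) f := by
    intro f c
    rw [coeff_algHom κ f _ {Finsupp.single l c}, Finset.sum_singleton]
    · have : κ (monomial (Finsupp.single l c) 1) = monomial (Finsupp.single l c) 1 := by
        rw [← X_pow_eq, map_pow, hκ, if_pos rfl]
      rw [this]
      simp
    · intro e he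
      by_cases hel : ∃ j, j ≠ l ∧ e j ≠ 0
      · obtain ⟨j, hj, hej⟩ := hel
        rw [algHom_monomial, Finset.prod_eq_zero (Finset.mem_univ j), map_zero, mul_zero]
        rw [hκ, if_neg hj, zero_pow hej]
      · push Not at hel
        have he' : e = Finsupp.single l (e l) := by
          ext j
          by_cases hj : j = l
          · subst hj
            simp
          · simp [hel j hj, Ne.symm hj]
        rw [he', ← X_pow_eq, map_pow, hκ, if_pos rfl, X_pow_eq, coeff_monomial, if_neg, mul_zero]
        rw [← he']
        exact fun h => he (by simp [h])
  have hχX : ∀ j : Fin m, (κ.comp σ.toAlgHom) (X j) =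
      if (j : ℕ) < s then 0 else X l ^ w j := by
    intro j
    change κ (σ (X j)) = _
    rw [hσ, map_add, hκ]
    by_cases hjl : j = l
    · subst hjl
      rw [if_pos rfl, if_neg (by simp), if_neg (by simp only [hl]; omega), map_zero, hwl,
        pow_one, add_zero]
    · rw [if_neg hjl, zero_add]
      by_cases hjs : (j : ℕ) < s
      · rw [if_pos hjs, if_neg (by omega), map_zero]
      · rw [if_neg hjs, if_pos ⟨by omega, hjl⟩, map_pow, hκ, if_pos rfl]
  have hχmon : ∀ e : Fin m →₀ ℕ, (∀ i : Fin m, (i : ℕ) < s → e i = 0) →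
      (κ.comp σ.toAlgHom) (monomial e 1) = monomial (Finsupp.single l (∑ i, w i * e i)) 1 := by
    intro e he
    rw [algHom_monomial, ← X_pow_eq, ← Finset.prod_pow_eq_pow_sum]
    refine Finset.prod_congr rfl fun j _ => ?_
    rw [hχX]
    by_cases hjs : (j : ℕ) < s
    · rw [he j hjs, mul_zero, pow_zero, pow_zero]
    · rw [if_neg hjs, pow_mul]
  have hWne : coeff (Finsupp.single l W) (σ h) ≠ 0 := by
    rw [← hκc]
    change coeff (Finsupp.single l W) ((κ.comp σ.toAlgHom) h) ≠ 0
    rw [coeff_algHom (κ.comp σ.toAlgHom) h _ {δ₀}, Finset.sum_singleton, hχmon δ₀ hδ₀s]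
    · rw [coeff_monomial_same, mul_one]
      exact hc₀
    · intro e he
      by_cases hce : coeff e h = 0
      · rw [hce, zero_mul]
      by_cases hes : ∀ i : Fin m, (i : ℕ) < s → e i = 0
      · have hlt : toLex δ₀ < toLex e := lt_of_le_of_ne (hmin e hce) fun heq => he (by
          have : δ₀ = e := heq
          simp [this])
        have hwt := weight_lt_weight_of_lex hwB hw0 (by omega) hlt
        rw [hχmon e hes, coeff_monomial, if_neg, mul_zero]
        intro heq
        have := DFunLike.congr_fun heq l
        simp only [Finsupp.single_eq_same] at this
        omega
      · push Not at hes
        obtain ⟨i, hi, hei⟩ := hes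
        rw [algHom_monomial, Finset.prod_eq_zero (Finset.mem_univ i), map_zero, mul_zero]
        rw [hχX, if_pos hi, zero_pow hei]
  have hex : ∃ b, coeff (Finsupp.single l b) (σ h) ≠ 0 := ⟨W, hWne⟩
  -- The order of `σ h` along the `X l`-axis. Blowing up by `X l ^ N₀` with `N₀ ≥ b` makes every
  -- monomial off the axis divisible by `X l ^ b`, while the axis terms do not change.
  set b := Nat.find hex with hb
  have hbne : coeff (Finsupp.single l b) (σ h) ≠ 0 := Nat.find_spec hex
  have hbmin : ∀ c < b, coeff (Finsupp.single l c) (σ h) = 0 := fun c hc => by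
    simpa using Nat.find_min hex hc
  have hbpos : 0 < b := by
    rcases Nat.eq_zero_or_pos b with h1 | h1
    · rw [h1, Finsupp.single_zero, coeff_zero_eq_constantCoeff_apply] at hbne
      exact absurd ((constantCoeff_algHom σ.toAlgHom h).trans h0) hbne
    · exact h1
  refine ⟨z, rfl, b, hbpos, fun N₀ hN₀ => ?_⟩
  set N : Fin m → ℕ := fun i => if i = l then 0 else N₀ with hN
  obtain ⟨ψ, hψ⟩ := exists_algHom_X (k := k) (fun i : Fin m => (X i * X l ^ N i : PS k m))
      (fun i => by rw [map_mul, constantCoeff_X, zero_mul])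
  have hNl : N l = 0 := by simp [hN]
  refine ⟨(permEquiv (Equiv.swap z l)).toAlgHom.comp (ψ.comp σ.toAlgHom), fun φ => ?_,
    fun i hi => ?_, ?_⟩
  · have h1 := Reach.target (ψ.comp (σ.toAlgHom.comp φ)) (permEquiv (Equiv.swap z l))
    exact ((Reach.target φ σ).trans (Reach.pivot _ hNl hψ)).trans h1
  · have hil : i ≠ l := by
      rintro rfl
      simp only [hl] at hi
      omega
    have hiz : i ≠ z := by
      rintro rfl
      simp [hz] at hi
    change permEquiv _ (ψ (σ (X i))) = _
    rw [hσ, if_neg (by omega), add_zero, hψ, map_mul, map_pow, permEquiv_X, permEquiv_X,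
      Equiv.swap_apply_right, Equiv.swap_apply_of_ne_of_ne hiz hil]
    simp [hN, hil]
  · obtain ⟨v, hv⟩ : (X l : PS k m) ^ b ∣ ψ (σ h) := by
      rw [X_pow_dvd_iff]
      intro d hd
      by_contra hne
      obtain ⟨e, rfl, he⟩ := exists_of_coeff_monomial_algHom_ne_zero ψ _
        (algHom_monomial_eq_shiftExp hψ) _ _ hne
      rw [shiftExp_apply_same] at hd
      by_cases hel : ∃ j, j ≠ l ∧ e j ≠ 0
      · obtain ⟨j, hj, hej⟩ := hel
        have h1 : N j * e j ≤ ∑ i, N i * e i :=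
          Finset.single_le_sum (f := fun i => N i * e i) (fun i _ => Nat.zero_le _)
            (Finset.mem_univ j)
        have h2 : N j = N₀ := by simp [hN, hj]
        have h3 : N₀ ≤ N j * e j := by
          rw [h2]
          exact Nat.le_mul_of_pos_right _ (Nat.pos_of_ne_zero hej)
        omega
      · push Not at hel
        have he' : e = Finsupp.single l (e l) := by
          ext j
          by_cases hj : j = l
          · subst hj
            simp
          · simp [hel j hj, Ne.symm hj]
        rw [he'] at he
        exact he (hbmin _ (by omega))
    have hvu : IsUnit v := by
      rw [isUnit_iff_constantCoeff_ne_zero, ← coeff_zero_eq_constantCoeff_apply]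
      have h1 : coeff (Finsupp.single l b) (ψ (σ h)) = coeff 0 v := by
        rw [hv, X_pow_eq]
        have := coeff_add_monomial_mul (Finsupp.single l b) 0 v (1 : k)
        rw [add_zero, one_mul] at this
        exact this
      rw [← h1]
      have h2 : shiftExp l N (Finsupp.single l b) = Finsupp.single l b := by
        have : ∑ i, N i * (Finsupp.single l b) i = 0 := by
          refine Finset.sum_eq_zero fun i _ => ?_
          by_cases hi : i = l
          · subst hi
            simp [hNl]
          · simp [Ne.symm hi]
        rw [shiftExp, this, Finsupp.single_zero, add_zero]
      rw [← h2, coeff_monomial_algHom ψ _ (algHom_monomial_eq_shiftExp hψ)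
        (shiftExp_injective l N)]
      exact hbne
    refine ⟨permEquiv (Equiv.swap z l) v, hvu.map _, ?_⟩
    change permEquiv _ (ψ (σ h)) = _
    rw [hv, map_mul, map_pow, permEquiv_X, Equiv.swap_apply_right]

end Purify

/-! ### The induction towards a diagonal homomorphism -/

section Progress

variable {k : Type*} [Field k] {n m s : ℕ}

/-- A single monomial of `Q` attains all the minima `β i` simultaneously; divided by the common
factor it is free of the first `s` variables. -/
theorem exists_eq_prod_X_pow_mul {Q : PS k m} (hm : s ≤ m) (β : Fin s → ℕ)
    (hβ : ∀ δ, coeff δ Q ≠ 0 → ∀ i : Fin s, β i ≤ δ (Fin.castLE hm i))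
    (hδ : ∃ δ, coeff δ Q ≠ 0 ∧ ∀ i : Fin s, δ (Fin.castLE hm i) = β i) :
    ∃ h : PS k m, Q = (∏ i, X (Fin.castLE hm i) ^ β i) * h ∧
      ∃ δ, coeff δ h ≠ 0 ∧ ∀ i : Fin m, (i : ℕ) < s → δ i = 0 := by
  classical
  set b : Fin m →₀ ℕ := ∑ i : Fin s, Finsupp.single (Fin.castLE hm i) (β i) with hb
  have hbi : ∀ i : Fin s, b (Fin.castLE hm i) = β i := by
    intro i
    rw [hb, Finsupp.finsetSum_apply, Finset.sum_eq_single i]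
    · simp
    · intro j _ hj
      rw [Finsupp.single_eq_of_ne]
      exact fun h => hj (Fin.castLE_injective hm h).symm
    · simp
  have hb0 : ∀ j : Fin m, s ≤ (j : ℕ) → b j = 0 := by
    intro j hj
    rw [hb, Finsupp.finsetSum_apply]
    refine Finset.sum_eq_zero fun i _ => ?_
    rw [Finsupp.single_eq_of_ne]
    exact (castLE_ne_of_le hj i).symm
  have hle : ∀ δ, coeff δ Q ≠ 0 → b ≤ δ := by
    intro δ h j
    rcases lt_or_ge (j : ℕ) s with hj | hj
    · obtain ⟨i, rfl⟩ := exists_castLE_eq (hm := hm) hj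
      rw [hbi]
      exact hβ δ h i
    · rw [hb0 j hj]
      exact Nat.zero_le _
  refine ⟨ofCoeff fun δ => coeff (b + δ) Q, ?_, ?_⟩
  · rw [← monomial_sum_single, ← hb]
    ext δ
    rw [coeff_monomial_mul]
    split_ifs with h
    · rw [coeff_ofCoeff, one_mul, add_tsub_cancel_of_le h]
    · by_contra hc
      exact h (hle δ hc)
  · obtain ⟨δ, hδ, hi⟩ := hδ
    refine ⟨δ - b, ?_, fun i his => ?_⟩
    · rw [coeff_ofCoeff, add_tsub_cancel_of_le (hle δ hδ)]
      exact hδ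
    · obtain ⟨i, rfl⟩ := exists_castLE_eq (hm := hm) his
      rw [Finsupp.tsub_apply, hi, hbi, Nat.sub_self]

/-- A homomorphism with one more diagonal variable, put in the right place. -/
theorem Diag.exists_snoc {p : ℕ} {φ : PS k n →ₐ[k] PS k m} {hn : s ≤ n} {hm : s ≤ m}
    {α : Fin s → ℕ} (h : Diag p φ hn hm α) {t : Fin n} (hts : s ≤ (t : ℕ)) {z : Fin m}
    (hz : (z : ℕ) = s) {a : ℕ} {w : PS k m} (hw : IsUnit w) (ht : φ (X t) = X z ^ p ^ a * w) :
    ∃ (hn' : s + 1 ≤ n) (hm' : s + 1 ≤ m) (φ' : PS k n →ₐ[k] PS k m) (α' : Fin (s + 1) → ℕ),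
      Reach φ φ' ∧ Diag p φ' hn' hm' α' := by
  have hn' : s + 1 ≤ n := by have := t.2; omega
  have hm' : s + 1 ≤ m := by have := z.2; omega
  obtain ⟨φ', hr, hφ'⟩ := Reach.exists_swap φ (Fin.castLE hn' (Fin.last s)) t
  refine ⟨hn', hm', φ', Fin.snoc (α := fun _ => ℕ) α a, hr, fun i => ?_⟩
  induction i using Fin.lastCases with
  | last =>
    refine ⟨w, hw, ?_⟩
    have : z = Fin.castLE hm' (Fin.last s) := Fin.ext (by simp [hz])
    rw [hφ', Equiv.swap_apply_left, ht, Fin.snoc_last, this]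
  | cast i =>
    obtain ⟨u, hu, hi⟩ := h i
    refine ⟨u, hu, ?_⟩
    rw [hφ', Equiv.swap_apply_of_ne_of_ne, Fin.snoc_castSucc]
    · exact hi
    · intro hc
      have h1 := congrArg Fin.val hc
      have h2 := i.2
      simp at h1
      omega
    · intro hc
      have h1 := congrArg Fin.val hc
      have h2 := i.2
      simp at h1
      omega

/-- The case where the image of a further variable is a power of a new variable. -/
theorem Diag.exists_succ_of_purify {p : ℕ} (hp : p.Prime) [CharP k p] {φ : PS k n →ₐ[k] PS k m}
    {hn : s ≤ n} {hm : s ≤ m} {α : Fin s → ℕ} (h : Diag p φ hn hm α) {t : Fin n}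
    (hts : s ≤ (t : ℕ)) {z : Fin m} (hz : (z : ℕ) = s) {b : ℕ} (hb : 0 < b)
    {Ψ : PS k m →ₐ[k] PS k m} (hΨ : ∀ i : Fin m, (i : ℕ) < s → Ψ (X i) = X i * X z ^ b)
    {w : PS k m} (hw : IsUnit w) (ht : Ψ (φ (X t)) = X z ^ b * w) :
    ∃ (hn' : s + 1 ≤ n) (hm' : s + 1 ≤ m) (φ' : PS k n →ₐ[k] PS k m) (α' : Fin (s + 1) → ℕ),
      Reach (Ψ.comp φ) φ' ∧ Diag p φ' hn' hm' α' := by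
  obtain ⟨φ₁, hr₁, hd₁, h₁⟩ := Diag.exists_of_cleanUp (φ := Ψ.comp φ) (hm := hm) (α := α) hp.pos
    (hn := hn) (l := t) (x := X z) (u := w) (d := b) ht hw (by
      change Ψ (φ (X t)) ≠ 0
      rw [ht]
      exact X_pow_mul_unit_ne_zero hw) (fun i => b * p ^ α i) (fun i => dvd_mul_right _ _)
    (fun i hi => absurd hi (castLE_ne_of_le hts i)) (fun i => by
      obtain ⟨v, hv, hi⟩ := h i
      refine ⟨Ψ v, hv.map _, ?_⟩
      change Ψ (φ _) = _
      rw [hi, map_mul, map_pow, hΨ _ (by simp), mul_pow, pow_mul]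
      ring)
  -- Only the prime-to-`p` part of `b` can be removed by ramification in the presence of the unit
  -- `w`.
  obtain ⟨c, hbc, hc⟩ := exists_ordPow_mul (k := k) hp hb.ne'
  obtain ⟨φ₂, w₂, hr₂, hw₂, ht₂, h₂⟩ := Reach.exists_ramification_unit φ₁ (t := t) (x := X z)
    (w := w) (a := p ^ padicValNat p b) (c := c) (constantCoeff_X _) (pow_pos hp.pos _) hc hw (by
      rw [h₁ t hts, ← hbc]
      exact ht)
  have hd₂ : Diag p φ₂ hn hm α := hd₁.congr fun i => h₂ _ (castLE_ne_of_le hts i)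
  obtain ⟨hn', hm', φ₃, α', hr₃, hd₃⟩ := hd₂.exists_snoc hts hz hw₂ ht₂
  exact ⟨hn', hm', φ₃, α', (hr₁.trans hr₂).trans hr₃, hd₃⟩

/-- Substituting a power of a diagonal variable for a new one. -/
theorem Diag.exists_sum_lt_of_purify {p : ℕ} (hp : p.Prime) [CharP k p]
    {φ : PS k n →ₐ[k] PS k m}
    {hn : s ≤ n} {hm : s ≤ m} {α : Fin s → ℕ} (h : Diag p φ hn hm α) {t : Fin n}
    (hts : s ≤ (t : ℕ)) {z : Fin m} (hz : (z : ℕ) = s) {b : ℕ}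
    {Ψ : PS k m →ₐ[k] PS k m} (hΨ : ∀ i : Fin m, (i : ℕ) < s → Ψ (X i) = X i * X z ^ b)
    {w : PS k m} (hw : IsUnit w) {β : Fin s → ℕ}
    (ht : Ψ (φ (X t)) = (∏ i, X (Fin.castLE hm i) ^ β i) * (X z ^ (b * (∑ i, β i) + b) * w))
    {i : Fin s} (hi : ¬ p ^ α i ∣ β i) :
    ∃ φ' α', Reach (Ψ.comp φ) φ' ∧ Diag p φ' hn hm α' ∧ ∑ i, α' i < ∑ i, α i := by
  classical
  set x : Fin m := Fin.castLE hm i with hx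
  -- `M` is divisible by `p ^ α i`, so adding multiples of `M` to `β i` keeps it indivisible, and by
  -- `p`, so `1 + M * b` is nonzero in `k`.
  set M := p ^ (α i + 1) with hM
  have hM0 : 0 < M := pow_pos hp.pos _
  have hxz : x ≠ z := castLE_ne_of_le hz.ge i
  obtain ⟨σ, hσ⟩ := exists_shear (k := k) (fun j : Fin m => if j = z then X x ^ M else 0)
    (fun j => by
      split_ifs
      · rw [map_pow, constantCoeff_X, zero_pow hM0.ne']
      · simp) {x} (fun j hj => by
      rw [Set.mem_singleton_iff] at hj
      rw [if_neg (by rw [hj]; exact hxz)]) (fun χ hχ j => by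
      split_ifs
      · rw [map_pow, hχ x rfl]
      · simp)
  obtain ⟨ψ, hψ⟩ := exists_algHom_X (k := k)
    (fun j : Fin m => (X j * X x ^ (if j = z then M else 0) : PS k m))
    (fun i => by rw [map_mul, constantCoeff_X, zero_mul])
  -- Shear and blowing-up together send `X z` to `X x ^ M` times the unit `1 + X z`, which
  -- eliminates `X z` up to units.
  set χ : PS k m →ₐ[k] PS k m := ψ.comp σ.toAlgHom with hχ
  have hχX : ∀ j, j ≠ z → χ (X j) = X j := by
    intro j hj
    change ψ (σ (X j)) = _
    rw [hσ, if_neg hj, add_zero, hψ, if_neg hj, pow_zero, mul_one]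
  have hχz : χ (X z) = X x ^ M * (1 + X z) := by
    change ψ (σ (X z)) = _
    rw [hσ, if_pos rfl, map_add, map_pow, hψ, hψ, if_pos rfl, if_neg hxz]
    ring
  set y : PS k m := 1 + X z with hy
  have hyu : IsUnit y := isUnit_one_add_X z
  have hr₁ : Reach (Ψ.comp φ) (χ.comp (Ψ.comp φ)) := by
    have h1 := Reach.target (Ψ.comp φ) σ
    exact h1.trans (Reach.pivot (l := x) (N := fun j => if j = z then M else 0) _ (if_neg hxz) hψ)
  have hχs : ∀ j : Fin s, χ (Ψ (X (Fin.castLE hm j))) =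
      X (Fin.castLE hm j) * (X x ^ (M * b) * y ^ b) := by
    intro j
    rw [hΨ _ (by simp), map_mul, map_pow, hχz, hχX _ (castLE_ne_of_le hz.ge j), mul_pow, pow_mul]
  have hdiag : ∀ j : Fin s, ∃ v, IsUnit v ∧ χ (Ψ (φ (X (Fin.castLE hn j)))) =
      X (Fin.castLE hm j) ^ p ^ α j * v * X x ^ (M * b * p ^ α j) := by
    intro j
    obtain ⟨v, hv, hj⟩ := h j
    refine ⟨(y ^ b) ^ p ^ α j * χ (Ψ v), ((hyu.pow _).pow _).mul ((hv.map _).map _), ?_⟩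
    rw [hj, map_mul, map_pow, map_mul, map_pow, hχs, mul_pow, mul_pow, ← pow_mul (X x)]
    ring
  obtain ⟨v, hv, hvi⟩ := hdiag i
  -- The `i`-th image has become a unit times `X x ^ (p ^ α i * (1 + M * b))`; ramification restores
  -- its old exponent, and it then serves to divide the extra powers of `X x` out of the other
  -- images.
  obtain ⟨φ₂, w₂, hr₂, hw₂, hi₂, h₂⟩ := Reach.exists_ramification_unit (χ.comp (Ψ.comp φ))
    (t := Fin.castLE hn i) (x := X x) (w := v) (a := p ^ α i) (c := 1 + M * b)
    (constantCoeff_X _) (pow_pos hp.pos _) (by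
      rw [hM, pow_succ]
      push_cast
      rw [CharP.cast_eq_zero k p]
      simp) hv (hvi.trans (by rw [← hx]; ring))
  obtain ⟨φ₃, hr₃, hd₃, h₃⟩ := Diag.exists_of_cleanUp (φ := φ₂) (hn := hn) (hm := hm) (α := α)
    hp.pos hi₂ hw₂ (by rw [hi₂]; exact X_pow_mul_unit_ne_zero hw₂)
    (fun j => if j = i then 0 else M * b * p ^ α j) (fun j => by
      split_ifs
      · exact dvd_zero _
      · rw [hM, pow_succ, mul_assoc, mul_assoc]
        exact dvd_mul_right _ _) (fun j hj => if_pos (Fin.castLE_injective hn hj)) (fun j => by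
      by_cases hj : j = i
      · subst hj
        refine ⟨w₂, hw₂, ?_⟩
        rw [hi₂, if_pos rfl, pow_zero, mul_one]
      · obtain ⟨v', hv', hj'⟩ := hdiag j
        refine ⟨v', hv', ?_⟩
        rw [if_neg hj, h₂ _ fun hc => hj (Fin.castLE_injective hn hc)]
        exact hj')
  -- The exponent of `X z` in the image of `X t`: each diagonal variable contributed `b`, and the
  -- purified factor another `b`.
  set E := b * (∑ i, β i) + b with hE
  obtain ⟨φ₄, α', hr₄, hd₄, hlt⟩ := hd₃.exists_sum_lt hp hts
    (β := Function.update β i (β i + M * E)) (w := y ^ E * χ w) ((hyu.pow _).mul (hw.map _)) (by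
      rw [h₃ t hts, h₂ t (castLE_ne_of_le hts i).symm]
      change χ (Ψ (φ (X t))) = _
      rw [ht, map_mul, map_mul, map_prod, map_pow, hχz, mul_pow, ← pow_mul]
      have h1 : ∏ j, χ (X (Fin.castLE hm j) ^ β j) = ∏ j, (X (Fin.castLE hm j) : PS k m) ^ β j :=
        Finset.prod_congr rfl fun j _ => by rw [map_pow, hχX _ (castLE_ne_of_le hz.ge j)]
      have h2 : ∏ j, (X (Fin.castLE hm j) : PS k m) ^ (Function.update β i (β i + M * E) j) =
          (∏ j, (X (Fin.castLE hm j) : PS k m) ^ β j) * X x ^ (M * E) := by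
        rw [← Finset.mul_prod_erase _ _ (Finset.mem_univ i),
          ← Finset.mul_prod_erase _ (fun j => (X (Fin.castLE hm j) : PS k m) ^ β j)
          (Finset.mem_univ i), Function.update_self, pow_add]
        rw [Finset.prod_congr rfl fun j hj => by
          rw [Function.update_of_ne (Finset.ne_of_mem_erase hj)]]
        ring
      rw [h1, h2]
      ring) ⟨i, by
      rw [Function.update_self, Nat.dvd_add_left]
      · exact hi
      · rw [hM, pow_succ, mul_assoc]
        exact dvd_mul_right _ _⟩
  exact ⟨φ₄, α', ((hr₁.trans hr₂).trans hr₃).trans hr₄, hd₄, hlt⟩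

/-- Split off the largest monomial `y^β` in the diagonal variables from `φ (X t)`. If the cofactor
is a nonunit, purify it: when all `p ^ α i ∣ β i`, the monomial is first contracted away and a new
diagonal variable appears; otherwise `Diag.exists_sum_lt_of_purify` lowers an exponent. If the
cofactor is a unit, `Diag.exists_sum_lt` applies. -/
theorem Diag.exists_progress {p : ℕ} (hp : p.Prime) [CharP k p] {φ : PS k n →ₐ[k] PS k m}
    {hn : s ≤ n} {hm : s ≤ m} {α : Fin s → ℕ} (h : Diag p φ hn hm α) {t : Fin n}
    (hts : s ≤ (t : ℕ)) (ht : φ (X t) ≠ 0) (hav : Avoids (fun i => p ^ α i) hm (φ (X t))) :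
    (∃ φ' α', Reach φ φ' ∧ Diag p φ' hn hm α' ∧ ∑ i, α' i < ∑ i, α i) ∨
      ∃ (hn' : s + 1 ≤ n) (hm' : s + 1 ≤ m) (φ' : PS k n →ₐ[k] PS k m) (α' : Fin (s + 1) → ℕ),
        Reach φ φ' ∧ Diag p φ' hn' hm' α' := by
  obtain ⟨φ₁, hr₁, h₁, hav₁, β, hβ, δ, hδ, hδβ⟩ := h.exists_min hp.pos hts ht hav s le_rfl
  obtain ⟨f, hf, hf0⟩ := exists_eq_prod_X_pow_mul hm β (fun δ hδ i => hβ δ hδ i i.2)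
    ⟨δ, hδ, fun i => hδβ i i.2⟩
  by_cases hc : constantCoeff f = 0
  · obtain ⟨z, hz, b, hb, hΨ⟩ := exists_purify hc hf0
    by_cases hall : ∀ i, p ^ α i ∣ β i
    · right
      choose q hq using hall
      choose u hu hφ using h₁
      obtain ⟨φ₂, w, hr₂, hw, ht₂, h₂⟩ := Reach.exists_contraction_diag φ₁ (hn := hn) hts
        Finset.univ (x := fun i => X (Fin.castLE hm i)) (u := u) (d := fun i => p ^ α i) (q := q)
        (fun i _ => hu i) (fun i _ => by
          rw [hφ]
          exact X_pow_mul_unit_ne_zero (hu i)) (fun i _ => hφ i) hc (by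
          rw [hf, mul_comm]
          simp_rw [hq])
      obtain ⟨Ψ, hΨr, hΨX, w', hw', hΨf⟩ := hΨ b le_rfl
      have hd₂ : Diag p φ₂ hn hm α := fun i =>
        ⟨u i, hu i, (h₂ _ (castLE_ne_of_le hts i)).trans (hφ i)⟩
      obtain ⟨hn', hm', φ₃, α', hr₃, hd₃⟩ := hd₂.exists_succ_of_purify hp hts hz hb hΨX
        (w := w' * Ψ w) (hw'.mul (hw.map _)) (by rw [ht₂, map_mul, hΨf, mul_assoc])
      exact ⟨hn', hm', φ₃, α', ((hr₁.trans hr₂).trans (hΨr φ₂)).trans hr₃, hd₃⟩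
    · left
      push Not at hall
      obtain ⟨i, hi⟩ := hall
      obtain ⟨Ψ, hΨr, hΨX, w', hw', hΨf⟩ := hΨ b le_rfl
      obtain ⟨φ₃, α', hr₃, hd₃, hlt⟩ := h₁.exists_sum_lt_of_purify hp hts hz hΨX hw' (β := β) (by
        rw [hf, map_mul, hΨf, map_prod, Finset.prod_congr rfl fun j _ => by
          rw [map_pow, hΨX _ (by simp), mul_pow, ← pow_mul], Finset.prod_mul_distrib,
          Finset.prod_pow_eq_pow_sum, ← Finset.mul_sum, pow_add]
        ring) hi
      exact ⟨φ₃, α', (hr₁.trans (hΨr φ₁)).trans hr₃, hd₃, hlt⟩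
  · left
    have hfu : IsUnit f := isUnit_iff_constantCoeff_ne_zero.mpr hc
    obtain ⟨φ₂, α', hr₂, hd₂, hlt⟩ := h₁.exists_sum_lt hp hts hfu hf (by
      -- Since `f` is a unit, the monomial `y^β` itself occurs in the image; if all the
      -- divisibilities held, this would contradict `hav₁`.
      by_contra! hdvd
      set e : Fin m →₀ ℕ := ∑ i : Fin s, Finsupp.single (Fin.castLE hm i) (β i) with he
      have h2 : coeff e (φ₁ (X t)) ≠ 0 := by
        rw [hf, ← monomial_sum_single, ← he, coeff_monomial_mul, if_pos le_rfl, one_mul,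
          tsub_self, coeff_zero_eq_constantCoeff_apply]
        exact hc
      rcases hav₁ _ h2 with ⟨i, hi⟩ | ⟨j, hj, hne⟩
      · refine hi (?_ : p ^ α i ∣ e (Fin.castLE hm i))
        rw [he, Finsupp.finsetSum_apply]
        refine Finset.dvd_sum fun j _ => ?_
        by_cases hj : j = i
        · rw [hj, Finsupp.single_eq_same]
          exact hdvd i
        · rw [Finsupp.single_eq_of_ne fun h => hj (Fin.castLE_injective hm h).symm]
          exact dvd_zero _
      · refine hne ?_
        rw [he, Finsupp.finsetSum_apply]
        exact Finset.sum_eq_zero fun i _ =>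
          Finsupp.single_eq_of_ne (castLE_ne_of_le hj i).symm)
    exact ⟨φ₂, α', hr₁.trans hr₂, hd₂, hlt⟩

/-- Every homomorphism can be transformed into a diagonal one. -/
theorem exists_diag {p : ℕ} (hp : p.Prime) [CharP k p] (φ : PS k n →ₐ[k] PS k m) :
    ∃ (s : ℕ) (hn : s ≤ n) (hm : s ≤ m) (φ' : PS k n →ₐ[k] PS k m) (α : Fin s → ℕ),
      Reach φ φ' ∧ Diag p φ' hn hm α ∧ ∀ i : Fin n, s ≤ (i : ℕ) → φ' (X i) = 0 := by
  -- Lexicographic induction on the number of unused target variables and the sum of the `α i`; the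
  -- latter may grow when `s` does.
  have main : ∀ a b (s : ℕ) (hn : s ≤ n) (hm : s ≤ m) (φ' : PS k n →ₐ[k] PS k m)
      (α : Fin s → ℕ), m - s = a → ∑ i, α i = b → Reach φ φ' → Diag p φ' hn hm α →
      ∃ (s : ℕ) (hn : s ≤ n) (hm : s ≤ m) (φ' : PS k n →ₐ[k] PS k m) (α : Fin s → ℕ),
        Reach φ φ' ∧ Diag p φ' hn hm α ∧ ∀ i : Fin n, s ≤ (i : ℕ) → φ' (X i) = 0 := by
    intro a
    induction a using Nat.strong_induction_on with
    | _ a iha =>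
    intro b
    induction b using Nat.strong_induction_on with
    | _ b ihb =>
    intro s hn hm φ' α ha hb hr hd
    obtain ⟨φ₁, hr₁, hd₁, hav⟩ := hd.exists_avoids hp.pos
    by_cases h0 : ∀ i : Fin n, s ≤ (i : ℕ) → φ₁ (X i) = 0
    · exact ⟨s, hn, hm, φ₁, α, hr.trans hr₁, hd₁, h0⟩
    push Not at h0
    obtain ⟨t, hts, ht⟩ := h0
    rcases hd₁.exists_progress hp hts ht (hav t hts) with
      ⟨φ₂, α', hr₂, hd₂, hlt⟩ | ⟨hn', hm', φ₂, α', hr₂, hd₂⟩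
    · exact ihb _ (hb ▸ hlt) s hn hm φ₂ α' ha rfl ((hr.trans hr₁).trans hr₂) hd₂
    · exact iha (m - (s + 1)) (by omega) _ (s + 1) hn' hm' φ₂ α' rfl rfl
        ((hr.trans hr₁).trans hr₂) hd₂
  exact main _ _ 0 (Nat.zero_le _) (Nat.zero_le _) φ (fun i => i.elim0) rfl rfl
    Relation.ReflTransGen.refl fun i => i.elim0

end Progress

/-! ### Normalizing the units -/

section NormalForm

variable {k : Type*} [Field k] {n m : ℕ}

theorem initialForm_eq_one {u : PS k m} (hu : constantCoeff u = 1) : initialForm u = 1 := by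
  have h0 : u.order = 0 := by
    by_contra h
    have : (constantCoeff : PS k m →+* k) u = 0 := by
      rw [← coeff_zero_eq_constantCoeff_apply]
      exact coeff_of_lt_order (by simpa using pos_iff_ne_zero.mpr h)
    rw [hu] at this
    exact one_ne_zero this
  ext d
  rw [initialForm, h0, coeff_homogeneousComponent, coeff_one]
  by_cases hd : d = 0
  · subst hd
    simp [hu]
  · have : d.degree ≠ 0 := fun h => hd ((Finsupp.degree_eq_zero_iff d).mp h)
    simp [hd, this]

/-- The normal form, for some number `r` of variables. -/
theorem exists_normalForm {p : ℕ} (hp : p.Prime) [CharP k p] (φ : PS k n →ₐ[k] PS k m) :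
    ∃ (r : ℕ) (hn : r ≤ n) (hm : r ≤ m) (φ' : PS k n →ₐ[k] PS k m) (α : Fin r → ℕ)
      (u : Fin r → PS k m), Reach φ φ' ∧
      (∀ i, φ' (X (Fin.castLE hn i)) = X (Fin.castLE hm i) ^ p ^ α i * u i) ∧
      (∀ i, IsUnit (u i)) ∧ (∀ i, α i = 0 → u i = 1) ∧
      (∀ i, 0 < α i → constantCoeff (u i) = 1 ∧ ¬ ∃ v, v ^ p = u i) ∧
      ∀ i : Fin n, r ≤ (i : ℕ) → φ' (X i) = 0 := by
  classical
  obtain ⟨r, hn, hm, φ₀, α₀, h₀⟩ := exists_diag hp φ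
  have hex : ∃ N, ∃ φ' α, (Reach φ φ' ∧ Diag p φ' hn hm α ∧
      ∀ i : Fin n, r ≤ (i : ℕ) → φ' (X i) = 0) ∧ ∑ i, α i = N := ⟨_, φ₀, α₀, h₀, rfl⟩
  -- Among all diagonal forms with this `r` reachable from `φ`, take one with the least sum of
  -- exponents.
  obtain ⟨φ₁, α, ⟨hr₁, hd, hz⟩, hN⟩ := Nat.find_spec hex
  have hmin : ∀ φ' α', Reach φ φ' → Diag p φ' hn hm α' →
      (∀ i : Fin n, r ≤ (i : ℕ) → φ' (X i) = 0) → ∑ i, α i ≤ ∑ i, α' i := by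
    intro φ' α' h1 h2 h3
    rw [hN]
    exact Nat.find_min' hex ⟨φ', α', ⟨h1, h2, h3⟩, rfl⟩
  choose u hu hφ using hd
  -- Otherwise scaling and ramification of degree `p` would lower `α i` by one. The scalar is
  -- allowed because the units are rescaled afterwards.
  have hnp : ∀ i, 0 < α i → ∀ (c : k) v, c ≠ 0 → u i ≠ c • v ^ p := by
    intro i hi c v hc hcv
    have hv : IsUnit v := by
      have h1 := hu i
      rw [isUnit_iff_constantCoeff_ne_zero] at h1 ⊢
      intro h2
      rw [hcv, constantCoeff_smul, map_pow, h2, zero_pow hp.ne_zero, smul_zero] at h1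
      exact h1 rfl
    obtain ⟨φ₂, hr₂, hi₂, h₂⟩ := Reach.exists_scale φ₁ (Fin.castLE hn i) (inv_ne_zero hc)
    obtain ⟨φ₃, hr₃, hi₃, h₃⟩ := Reach.exists_ramification φ₂ (i := Fin.castLE hn i) hp.pos
      (g := X (Fin.castLE hm i) ^ p ^ (α i - 1) * v) (by
        rw [map_mul, map_pow, constantCoeff_X, zero_pow (pow_pos hp.pos _).ne', zero_mul]) (by
        rw [hi₂, hφ, hcv, mul_smul_comm, smul_smul, inv_mul_cancel₀ hc, one_smul, mul_pow,
          ← pow_mul, ← pow_succ, Nat.sub_add_cancel hi])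
    have := hmin φ₃ (Function.update α i (α i - 1)) ((hr₁.trans hr₂).trans hr₃) (fun j => by
      by_cases hj : j = i
      · subst hj
        rw [Function.update_self]
        exact ⟨v, hv, hi₃⟩
      · have hj' : Fin.castLE hn j ≠ Fin.castLE hn i := fun h => hj (Fin.castLE_injective hn h)
        rw [Function.update_of_ne hj]
        exact ⟨u j, hu j, by rw [h₃ _ hj', h₂ _ hj', hφ]⟩) (fun j hj => by
      rw [h₃ j (castLE_ne_of_le hj i).symm, h₂ j (castLE_ne_of_le hj i).symm, hz j hj])
    have hlt : ∑ j, Function.update α i (α i - 1) j < ∑ j, α j := by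
      refine Finset.sum_lt_sum (fun j _ => ?_) ⟨i, Finset.mem_univ i, ?_⟩
      · by_cases hj : j = i
        · subst hj
          rw [Function.update_self]
          omega
        · rw [Function.update_of_ne hj]
      · rw [Function.update_self]
        omega
    omega
  set c : Fin r → k := fun i => constantCoeff (u i) with hc
  have hc0 : ∀ i, c i ≠ 0 := fun i => isUnit_iff_constantCoeff_ne_zero.mp (hu i)
  set v : Fin r → PS k m := fun i => (c i)⁻¹ • u i with hv
  have hv1 : ∀ i, constantCoeff (v i) = 1 := fun i => by
    rw [hv, constantCoeff_smul, smul_eq_mul]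
    exact inv_mul_cancel₀ (hc0 i)
  have hvu : ∀ i, IsUnit (v i) := fun i => by
    rw [isUnit_iff_constantCoeff_ne_zero, hv1]
    exact one_ne_zero
  obtain ⟨τ, hτ⟩ := exists_scaling (k := k)
    (fun i : Fin n => if h : (i : ℕ) < r then (c ⟨i, h⟩)⁻¹ else 1) (fun i => by
      split_ifs
      · exact inv_ne_zero (hc0 _)
      · exact one_ne_zero)
  -- A unit is absorbed into its target variable only where `α i = 0`; the diagonal variables with
  -- `α i > 0` are fixed by `σ`, and not being a `p`-th power is invariant under automorphisms.
  obtain ⟨σ, hσ⟩ := exists_algEquiv_of_units (k := k) (u := fun j : Fin m =>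
    if h : (j : ℕ) < r then if α ⟨j, h⟩ = 0 then v ⟨j, h⟩ else 1 else 1) (fun j => by
      split_ifs
      · exact hvu _
      · exact isUnit_one
      · exact isUnit_one)
  have hτ' : ∀ i, φ₁ (τ (X (Fin.castLE hn i))) = X (Fin.castLE hm i) ^ p ^ α i * v i := by
    intro i
    rw [hτ, map_smul, hφ, dif_pos (show ((Fin.castLE hn i : Fin n) : ℕ) < r by simp),
      ← mul_smul_comm]
    rfl
  have hσ0 : ∀ i, α i = 0 → σ (X (Fin.castLE hm i)) = X (Fin.castLE hm i) * v i := by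
    intro i hi
    rw [hσ, dif_pos (show ((Fin.castLE hm i : Fin m) : ℕ) < r by simp)]
    exact congrArg _ (if_pos hi)
  have hσ1 : ∀ i, 0 < α i → σ (X (Fin.castLE hm i)) = X (Fin.castLE hm i) := by
    intro i hi
    rw [hσ, dif_pos (show ((Fin.castLE hm i : Fin m) : ℕ) < r by simp)]
    exact (congrArg _ (if_neg hi.ne')).trans (mul_one _)
  refine ⟨r, hn, hm, σ.symm.toAlgHom.comp (φ₁.comp τ.toAlgHom), α,
    fun i => if α i = 0 then 1 else σ.symm (v i),
    (hr₁.trans (Reach.source φ₁ τ)).trans (Reach.target _ _), fun i => ?_, fun i => ?_,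
    fun i hi => if_pos hi, fun i hi => ?_, fun i hi => ?_⟩
  · change σ.symm (φ₁ (τ _)) = _
    rw [hτ']
    dsimp only
    by_cases hi : α i = 0
    · rw [if_pos hi, hi, pow_zero, pow_one, mul_one, ← hσ0 i hi, AlgEquiv.symm_apply_apply]
    · have h1 : σ.symm (X (Fin.castLE hm i)) = X (Fin.castLE hm i) := by
        rw [AlgEquiv.symm_apply_eq, hσ1 i (Nat.pos_of_ne_zero hi)]
      rw [if_neg hi, map_mul, map_pow, h1]
  · dsimp only
    split_ifs
    · exact isUnit_one
    · exact (hvu i).map _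
  · simp only [if_neg hi.ne']
    refine ⟨?_, ?_⟩
    · have := constantCoeff_algHom σ.symm.toAlgHom (v i)
      rw [hv1] at this
      exact this
    · rintro ⟨w, hw⟩
      refine hnp i hi (c i) (σ w) (hc0 i) ?_
      rw [← map_pow, hw, AlgEquiv.apply_symm_apply, hv, smul_smul, mul_inv_cancel₀ (hc0 i),
        one_smul]
  · change σ.symm (φ₁ (τ _)) = _
    rw [hτ, map_smul, hz i hi, smul_zero, map_zero]

end NormalForm

/-! ### Growth of the normal form -/

section NormalFormGrowth

variable {k : Type*} [Field k] {n m : ℕ}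

theorem card_le_hilbertFunction {ι : Type*} [Fintype ι] (φ : PS k n →ₐ[k] PS k m) {N : ℕ}
    (a : ι → PS k n)
    (h : ∀ w : ι → k, (N : ℕ∞) ≤ (φ (∑ i, w i • a i)).order → w = 0) :
    Fintype.card ι ≤ hilbertFunction φ N := by
  have hli : LinearIndependent k fun i => (orderKernel φ N).mkQ (a i) := by
    rw [Fintype.linearIndependent_iff]
    intro w hw
    refine congrFun (h w ?_)
    simp only [← map_smul, ← map_sum] at hw
    rwa [Submodule.mkQ_apply, Submodule.Quotient.mk_eq_zero] at hw
  exact hli.fintype_card_le_finrank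

variable {r : ℕ} {hn : r ≤ n} {hm : r ≤ m} {φ : PS k n →ₐ[k] PS k m} {d : Fin r → ℕ}
  {u : Fin r → PS k m}

/-- Modulo elements with image of order `N`, only monomials in the first `r` variables with all
exponents below `N` survive. -/
theorem hilbertFunction_le_pow (hn : r ≤ n) (hz : ∀ i : Fin n, r ≤ (i : ℕ) → φ (X i) = 0) (N : ℕ) :
    hilbertFunction φ N ≤ N ^ r := by
  classical
  set S : Finset (Fin n →₀ ℕ) := Finset.univ.image fun b : Fin r → Fin N =>
    Finsupp.equivFunOnFinite.symm fun i : Fin n =>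
      if h : (i : ℕ) < r then (b ⟨i, h⟩ : ℕ) else 0 with hS
  refine (finrank_quotient_le_card _ S fun f hf => ?_).2.trans
    (Finset.card_image_le.trans (by simp))
  rw [mem_orderKernel]
  apply nat_le_order
  intro δ hδ
  rw [coeff_algHom φ f δ ∅, Finset.sum_empty]
  intro e _
  by_cases he0 : ∃ i : Fin n, r ≤ (i : ℕ) ∧ e i ≠ 0
  · obtain ⟨i, hi, hei⟩ := he0
    rw [algHom_monomial, Finset.prod_eq_zero (Finset.mem_univ i), map_zero, mul_zero]
    rw [hz i hi, zero_pow hei]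
  push Not at he0
  by_cases heN : ∀ i, e i < N
  · have : e ∈ S := by
      rw [hS, Finset.mem_image]
      refine ⟨fun i => ⟨e (Fin.castLE hn i), heN _⟩, Finset.mem_univ _, ?_⟩
      ext i
      simp only [Finsupp.equivFunOnFinite_symm_apply_apply]
      split_ifs with h
      · rfl
      · exact (he0 i (not_lt.mp h)).symm
    rw [hf e this, zero_mul]
  · push Not at heN
    obtain ⟨i, hi⟩ := heN
    rw [coeff_of_lt_order (f := φ (monomial e 1)), mul_zero]
    refine lt_of_lt_of_le ?_ (degree_le_order_algHom_monomial φ e)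
    have := Finsupp.le_degree i e
    exact_mod_cast (by omega : δ.degree < e.degree)

/-- In a nontrivial combination of monomials with exponents below `M`, a minimal exponent survives
in the image by triangularity, at degree at most `(∑ i, d i) * M`; the summand `1` makes the bound
strict. -/
theorem pow_le_hilbertFunction (hd : ∀ i, 0 < d i) (hu : ∀ i, IsUnit (u i))
    (hφ : ∀ i, φ (X (Fin.castLE hn i)) = X (Fin.castLE hm i) ^ d i * u i) {M : ℕ} (hM : 0 < M) :
    M ^ r ≤ hilbertFunction φ ((1 + ∑ i, d i) * M) := by
  classical
  obtain ⟨ι, hι⟩ := exists_algHom_X (k := k) (fun i : Fin r => (X (Fin.castLE hn i) : PS k n))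
    (fun i => constantCoeff_X _)
  set θ := φ.comp ι with hθ
  have hθX : ∀ i, θ (X i) = X (Fin.castLE hm i) ^ d i * u i := fun i => by
    change φ (ι (X i)) = _
    rw [hι, hφ]
  set q : (Fin r → Fin M) → (Fin r →₀ ℕ) := fun b =>
    Finsupp.equivFunOnFinite.symm fun i => (b i : ℕ) with hq
  have hqi : Function.Injective q := by
    intro b b' h
    funext i
    have := DFunLike.congr_fun h i
    exact Fin.ext this
  have h := card_le_hilbertFunction φ (N := (1 + ∑ i, d i) * M)
    (fun b : Fin r → Fin M => ι (monomial (q b) 1)) (fun w hw => ?_)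
  · simpa using h
  by_contra hne
  obtain ⟨b₀, hb₀⟩ : ∃ b, w b ≠ 0 := by
    by_contra! hc
    exact hne (funext hc)
  set P : PS k r := ∑ b, w b • monomial (q b) 1 with hP
  have hcP : ∀ b, coeff (q b) P = w b := by
    intro b
    rw [hP, map_sum, Finset.sum_eq_single b]
    · simp
    · intro b' _ hb'
      rw [map_smul, coeff_monomial, if_neg fun h => hb' (hqi h).symm, smul_zero]
    · simp
  have hcP0 : ∀ a, a ∉ Set.range q → coeff a P = 0 := by
    intro a ha
    rw [hP, map_sum]
    refine Finset.sum_eq_zero fun b _ => ?_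
    rw [map_smul, coeff_monomial, if_neg fun h => ha ⟨b, h.symm⟩, smul_zero]
  obtain ⟨a, ⟨b, hb, rfl⟩, hmin⟩ := wellFounded_lt.has_min
    {a : Fin r →₀ ℕ | ∃ b, w b ≠ 0 ∧ q b = a} ⟨_, b₀, hb₀, rfl⟩
  have hne : coeff (expo (Fin.castLE hm) d (q b)) (θ P) ≠ 0 := by
    rw [coeff_expo_algHom (Fin.castLE_injective hm) hd hθX, Finset.sum_eq_zero, add_zero, hcP]
    · exact mul_ne_zero hb (coeff_expo_algHom_monomial_self hu hθX _)
    · intro a ha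
      rw [Finset.mem_Iio] at ha
      by_cases har : a ∈ Set.range q
      · obtain ⟨b', rfl⟩ := har
        have : w b' = 0 := by
          by_contra hc
          exact hmin _ ⟨b', hc, rfl⟩ ha
        rw [hcP, this, zero_mul]
      · rw [hcP0 a har, zero_mul]
  have hdeg : (expo (Fin.castLE hm) d (q b)).degree < (1 + ∑ i, d i) * M := by
    have h1 : (expo (Fin.castLE hm) d (q b)).degree = ∑ i, d i * q b i := by
      rw [expo, map_sum]
      exact Finset.sum_congr rfl fun i _ => Finsupp.degree_single _ _
    have h2 : ∑ i, d i * q b i ≤ (∑ i, d i) * M := by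
      rw [Finset.sum_mul]
      exact Finset.sum_le_sum fun i _ => Nat.mul_le_mul_left _ (b i).2.le
    rw [h1, add_mul, one_mul]
    omega
  have hPθ : θ P = φ (∑ b, w b • ι (monomial (q b) 1)) := by
    rw [hP, hθ, AlgHom.comp_apply, map_sum]
    simp only [map_smul]
  refine hne (coeff_of_lt_order (lt_of_lt_of_le ?_ (hPθ ▸ hw)))
  exact_mod_cast hdeg

theorem growth_of_diag (hd : ∀ i, 0 < d i) (hu : ∀ i, IsUnit (u i))
    (hφ : ∀ i, φ (X (Fin.castLE hn i)) = X (Fin.castLE hm i) ^ d i * u i)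
    (hz : ∀ i : Fin n, r ≤ (i : ℕ) → φ (X i) = 0) : Growth φ r := by
  refine ⟨⟨1 + ∑ i, d i, fun M hM => (pow_le_hilbertFunction hd hu hφ hM).trans
    (Nat.le_mul_of_pos_left _ (by omega))⟩, 1, fun N => ?_⟩
  rw [one_mul]
  exact (hilbertFunction_le_pow hn hz N).trans (Nat.pow_le_pow_left (Nat.le_succ N) r)

end NormalFormGrowth

/-! ### Homogenized polynomial relations -/

section HomogeneousEvaluation

variable {k R : Type*} [Field k] [CommRing R] [Algebra k R] {t : ℕ}

/-- The homogenization of degree `M` of a polynomial, evaluated at `(a, b)`. -/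
noncomputable def homEval (P : MvPolynomial (Fin t) k) (M : ℕ) (a : Fin t → R) (b : R) : R :=
  ∑ β ∈ P.support, P.coeff β • ((∏ i, a i ^ β i) * b ^ (M - β.degree))

theorem map_homEval {R' : Type*} [CommRing R'] [Algebra k R'] (f : R →ₐ[k] R')
    (P : MvPolynomial (Fin t) k) (M : ℕ) (a : Fin t → R) (b : R) :
    f (homEval P M a b) = homEval P M (fun i => f (a i)) (f b) := by
  simp [homEval, map_sum, map_smul, map_mul, map_prod, map_pow]

theorem aeval_eq_sum_smul (P : MvPolynomial (Fin t) k) (x : Fin t → R) :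
    MvPolynomial.aeval x P = ∑ β ∈ P.support, P.coeff β • ∏ i, x i ^ β i := by
  rw [MvPolynomial.aeval_def, MvPolynomial.eval₂_eq']
  simp [Algebra.smul_def]

theorem homEval_mul {P : MvPolynomial (Fin t) k} {M : ℕ} (hP : P.totalDegree ≤ M)
    (x : Fin t → R) (b : R) :
    homEval P M (fun i => x i * b) b = MvPolynomial.aeval x P * b ^ M := by
  rw [homEval, aeval_eq_sum_smul, Finset.sum_mul]
  refine Finset.sum_congr rfl fun β hβ => ?_
  have h1 : β.degree ≤ M := (MvPolynomial.le_totalDegree hβ).trans hP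
  have h2 : (∏ i, (x i * b) ^ β i) = (∏ i, x i ^ β i) * b ^ β.degree := by
    rw [Finsupp.degree_eq_sum, ← Finset.prod_pow_eq_pow_sum, ← Finset.prod_mul_distrib]
    exact Finset.prod_congr rfl fun i _ => mul_pow _ _ _
  rw [h2, mul_assoc, ← pow_add, Nat.add_sub_cancel' h1, smul_mul_assoc]

/-- The homogenization `Q` of `P` is nonzero, because setting the extra variable to `1` recovers
`P`. -/
theorem homEval_ne_zero {h : Fin (t + 1) → R} (hh : AlgebraicIndependent k h)
    {P : MvPolynomial (Fin t) k} (hP : P ≠ 0) {M : ℕ} (hM : P.totalDegree ≤ M) :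
    homEval P M (fun i => h i.succ) (h 0) ≠ 0 := by
  set Q : MvPolynomial (Fin (t + 1)) k :=
    homEval P M (fun i => MvPolynomial.X i.succ) (MvPolynomial.X 0) with hQ
  have h1 : MvPolynomial.aeval h Q = homEval P M (fun i => h i.succ) (h 0) := by
    rw [hQ, map_homEval]
    simp
  have h2 : MvPolynomial.aeval (Fin.cons 1 MvPolynomial.X : Fin (t + 1) → MvPolynomial (Fin t) k)
      Q = P := by
    rw [hQ, map_homEval]
    simp only [MvPolynomial.aeval_X, Fin.cons_succ, Fin.cons_zero]
    have := homEval_mul hM (MvPolynomial.X : Fin t → MvPolynomial (Fin t) k) 1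
    simpa using this
  rw [← h1]
  intro h3
  have h4 : Q = 0 := hh (by rw [h3, map_zero])
  rw [h4, map_zero] at h2
  exact hP h2.symm

end HomogeneousEvaluation

/-! ### Residues of fractions expressed by orders -/

section Residue

variable {k : Type*} [Field k] {n m : ℕ}

theorem orderValuation_apply {f : PS k m} (hf : f ≠ 0) :
    orderValuation k m f = WithZero.exp (-(f.order.toNat : ℤ)) := by
  classical
  exact if_neg hf

theorem orderValuation_lt_iff {f g : PS k m} (hg : g ≠ 0) :
    orderValuation k m f < orderValuation k m g ↔ g.order < f.order := by
  have hg' : g.order ≠ ⊤ := by simpa using hg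
  by_cases hf : f = 0
  · subst hf
    rw [map_zero, order_zero]
    exact ⟨fun _ => lt_top_iff_ne_top.mpr hg',
      fun _ => zero_lt_iff.mpr (orderValuation_ne_zero hg)⟩
  have hf' : f.order ≠ ⊤ := by simpa using hf
  rw [orderValuation_apply hf, orderValuation_apply hg, WithZero.exp_lt_exp]
  obtain ⟨a, ha⟩ := ENat.ne_top_iff_exists.mp hf'
  obtain ⟨b, hb⟩ := ENat.ne_top_iff_exists.mp hg'
  rw [← ha, ← hb, ENat.toNat_natCast, ENat.toNat_natCast, Nat.cast_lt]
  omega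

theorem orderValuation_le_iff {f g : PS k m} (hg : g ≠ 0) :
    orderValuation k m f ≤ orderValuation k m g ↔ g.order ≤ f.order := by
  have hg' : g.order ≠ ⊤ := by simpa using hg
  by_cases hf : f = 0
  · subst hf
    simp
  · rw [← not_lt, orderValuation_lt_iff hf, not_lt]

variable (φ : PS k n →ₐ[k] PS k m)

/-- The class of a power series in the fraction field of the coimage. -/
noncomputable def toFrac : PS k n →ₐ[k] FractionRing (Coimage φ) :=
  (IsScalarTower.toAlgHom k (Coimage φ) (FractionRing (Coimage φ))).comp
    (Ideal.Quotient.mkₐ k (RingHom.ker φ))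

theorem toFrac_apply (f : PS k n) :
    toFrac φ f = algebraMap (Coimage φ) _ (Ideal.Quotient.mk (RingHom.ker φ) f) := rfl

theorem inducedValuation_toFrac (f : PS k n) :
    inducedValuation φ (toFrac φ f) = orderValuation k m (φ f) :=
  (Valuation.extendToLocalization_apply_map_apply _ _ _ _).trans rfl

theorem toFrac_ne_zero {b : PS k n} (hb : φ b ≠ 0) : toFrac φ b ≠ 0 := by
  intro h
  have := inducedValuation_toFrac φ b
  rw [h, map_zero] at this
  exact orderValuation_ne_zero hb this.symm

theorem exists_toFrac_eq_mul {t : ℕ} (x : Fin t → FractionRing (Coimage φ)) :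
    ∃ (a : Fin t → PS k n) (b : PS k n), φ b ≠ 0 ∧ ∀ i, toFrac φ (a i) = x i * toFrac φ b := by
  obtain ⟨b, hb⟩ := IsLocalization.exist_integer_multiples_of_finite
    (nonZeroDivisors (Coimage φ)) x
  choose a ha using hb
  choose a' ha' using fun i => Ideal.Quotient.mk_surjective (a i)
  obtain ⟨b', hb'⟩ := Ideal.Quotient.mk_surjective (b : Coimage φ)
  refine ⟨a', b', ?_, fun i => ?_⟩
  · intro h
    refine nonZeroDivisors.ne_zero b.2 ?_
    rw [← hb']
    exact Ideal.Quotient.eq_zero_iff_mem.mpr h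
  · rw [toFrac_apply, toFrac_apply, hb', ha', ha, Algebra.smul_def, mul_comm]

section Fractions

variable {φ} {t : ℕ} {x : Fin t → (inducedValuation φ).valuationSubring}
  {a : Fin t → PS k n} {b : PS k n} {d : ℕ}

theorem ne_zero_of_order_eq {f : PS k m} (hf : f.order = d) : f ≠ 0 := by
  rintro rfl
  rw [order_zero] at hf
  exact ENat.natCast_ne_top d hf.symm

/-- Clearing denominators: `P(a / b) * b ^ M` is the homogenization of `P` at `(a, b)`, so the
valuation of `P(a / b)` is measured by orders of power series. -/
theorem exists_residue_eq
    (hx : ∀ i, toFrac φ (a i) = (x i : FractionRing (Coimage φ)) * toFrac φ b)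
    {P : MvPolynomial (Fin t) k} {M : ℕ} (hM : P.totalDegree ≤ M) :
    ∃ y : (inducedValuation φ).valuationSubring,
      MvPolynomial.aeval (fun i => (IsLocalRing.residue _ (x i) : ValuationResidueField φ)) P =
        IsLocalRing.residue _ y ∧
      inducedValuation φ y * orderValuation k m (φ b ^ M) =
        orderValuation k m (φ (homEval P M a b)) := by
  set γ := (algebraMap k (FractionRing (Coimage φ))).codRestrict
    (inducedValuation φ).valuationSubring (inducedValuation_algebraMap_le_one φ) with hγ
  refine ⟨MvPolynomial.eval₂ γ x P, ?_, ?_⟩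
  · rw [MvPolynomial.hom_eval₂]
    rfl
  · have h2 : ((MvPolynomial.eval₂ γ x P : (inducedValuation φ).valuationSubring) :
        FractionRing (Coimage φ)) = MvPolynomial.aeval (fun i => (x i : FractionRing _)) P :=
      MvPolynomial.hom_eval₂ P γ (inducedValuation φ).valuationSubring.subtype x
    have h3 : toFrac φ (homEval P M a b) =
        MvPolynomial.aeval (fun i => (x i : FractionRing (Coimage φ))) P * toFrac φ b ^ M := by
      rw [map_homEval, ← homEval_mul hM]
      simp_rw [hx]
    rw [h2, ← inducedValuation_toFrac, h3, map_mul, ← map_pow, ← inducedValuation_toFrac,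
      map_pow (toFrac φ)]

theorem le_order_homEval (hb : (φ b).order = d)
    (hx : ∀ i, toFrac φ (a i) = (x i : FractionRing (Coimage φ)) * toFrac φ b)
    {P : MvPolynomial (Fin t) k} {M : ℕ} (hM : P.totalDegree ≤ M) :
    ((d * M : ℕ) : ℕ∞) ≤ (φ (homEval P M a b)).order := by
  obtain ⟨y, -, hy⟩ := exists_residue_eq hx hM
  rw [← order_pow_eq hb, ← orderValuation_le_iff (pow_ne_zero _ (ne_zero_of_order_eq hb)), ← hy]
  exact mul_le_of_le_one_left' y.2

/-- Algebraic relations between residues of fractions `a i / b` in terms of orders. -/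
theorem aeval_residue_eq_zero_iff (hb : (φ b).order = d)
    (hx : ∀ i, toFrac φ (a i) = (x i : FractionRing (Coimage φ)) * toFrac φ b)
    {P : MvPolynomial (Fin t) k} {M : ℕ} (hM : P.totalDegree ≤ M) :
    MvPolynomial.aeval (fun i => (IsLocalRing.residue _ (x i) : ValuationResidueField φ)) P = 0 ↔
      ((d * M : ℕ) : ℕ∞) < (φ (homEval P M a b)).order := by
  obtain ⟨y, hy₁, hy⟩ := exists_residue_eq hx hM
  have hb' := pow_ne_zero M (ne_zero_of_order_eq hb)
  rw [hy₁, IsLocalRing.residue_eq_zero_iff, Valuation.mem_maximalIdeal_iff, ← order_pow_eq hb,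
    ← orderValuation_lt_iff hb', ← hy, ← mul_lt_mul_iff_left₀
    (zero_lt_iff.mpr (orderValuation_ne_zero hb')), one_mul]

end Fractions

end Residue

/-! ### Algebraically independent residues bound the growth from below -/

section UpperBound

variable {k : Type*} [Field k] {n m : ℕ}

theorem le_of_forall_pow_le {a b C : ℕ} (h : ∀ M : ℕ, (M + 1) ^ a ≤ C * (M + 1) ^ b) : a ≤ b := by
  by_contra hab
  have h1 := h C
  have h2 : (C + 1) ^ (b + 1) ≤ (C + 1) ^ a := Nat.pow_le_pow_right (by omega) (by omega)
  have h3 : 0 < (C + 1) ^ b := by positivity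
  rw [pow_succ] at h2
  nlinarith

theorem homEval_eq_sum {R : Type*} [CommRing R] [Algebra k R] {t : ℕ}
    (P : MvPolynomial (Fin t) k) (M : ℕ) (a : Fin t → R) (b : R) (S : Finset (Fin t →₀ ℕ))
    (hS : P.support ⊆ S) :
    homEval P M a b = ∑ β ∈ S, P.coeff β • ((∏ i, a i ^ β i) * b ^ (M - β.degree)) := by
  refine Finset.sum_subset hS fun β _ hβ => ?_
  rw [MvPolynomial.notMem_support_iff.mp hβ, zero_smul]

variable {φ : PS k n →ₐ[k] PS k m}

/-- Residues that are algebraically independent produce many power series that are linearly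
independent modulo those of large order. -/
theorem pow_le_hilbertFunction_of_residue {t : ℕ}
    {x : Fin t → (inducedValuation φ).valuationSubring}
    {a : Fin t → PS k n} {b z : PS k n} {d e : ℕ} (hb : (φ b).order = d)
    (hx : ∀ i, toFrac φ (a i) = (x i : FractionRing (Coimage φ)) * toFrac φ b)
    (hz : (φ z).order = e) (he : 0 < e)
    (hind : AlgebraicIndependent k
      (fun i => (IsLocalRing.residue _ (x i) : ValuationResidueField φ))) (M : ℕ) :
    (M + 1) ^ (t + 1) ≤ hilbertFunction φ (d * (t * M) + M * e + 1) := by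
  classical
  set q : (Fin t → Fin (M + 1)) → (Fin t →₀ ℕ) := fun β =>
    Finsupp.equivFunOnFinite.symm fun i => (β i : ℕ) with hq
  have hqi : Function.Injective q := by
    intro β β' h
    funext i
    exact Fin.ext (DFunLike.congr_fun h i)
  have h := card_le_hilbertFunction φ (N := d * (t * M) + M * e + 1)
    (fun i : (Fin t → Fin (M + 1)) × Fin (M + 1) =>
      ((∏ l, a l ^ (q i.1) l) * b ^ (t * M - (q i.1).degree)) * z ^ (i.2 : ℕ)) (fun w hw => ?_)
  · simpa [pow_succ] using h
  by_contra hne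
  set P : Fin (M + 1) → MvPolynomial (Fin t) k := fun j =>
    ∑ β, MvPolynomial.monomial (q β) (w (β, j)) with hP
  have hPc : ∀ j β, (P j).coeff (q β) = w (β, j) := by
    intro j β
    rw [hP, MvPolynomial.coeff_sum, Finset.sum_eq_single β]
    · simp
    · intro β' _ hβ'
      rw [MvPolynomial.coeff_monomial, if_neg fun h => hβ' (hqi h)]
    · simp
  have hPs : ∀ j, (P j).support ⊆ Finset.univ.image q := by
    intro j β hβ
    by_contra hc
    rw [MvPolynomial.mem_support_iff, hP, MvPolynomial.coeff_sum] at hβ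
    refine hβ (Finset.sum_eq_zero fun β' _ => ?_)
    rw [MvPolynomial.coeff_monomial, if_neg]
    rintro rfl
    exact hc (Finset.mem_image_of_mem _ (Finset.mem_univ _))
  have hPd : ∀ j, (P j).totalDegree ≤ t * M := by
    intro j
    rw [MvPolynomial.totalDegree, Finset.sup_le_iff]
    intro β hβ
    obtain ⟨β', -, rfl⟩ := Finset.mem_image.mp (hPs j hβ)
    change (q β').degree ≤ t * M
    rw [Finsupp.degree_eq_sum]
    calc ∑ i, q β' i ≤ ∑ _i : Fin t, M :=
          Finset.sum_le_sum fun i _ => Nat.lt_succ_iff.mp (β' i).2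
      _ = t * M := by simp
  have hsum : ∑ i : (Fin t → Fin (M + 1)) × Fin (M + 1),
      w i • (((∏ l, a l ^ (q i.1) l) * b ^ (t * M - (q i.1).degree)) * z ^ (i.2 : ℕ)) =
      ∑ j : Fin (M + 1), homEval (P j) (t * M) a b * z ^ (j : ℕ) := by
    rw [Fintype.sum_prod_type_right]
    refine Finset.sum_congr rfl fun j _ => ?_
    rw [homEval_eq_sum _ _ _ _ _ (hPs j), Finset.sum_image fun _ _ _ _ h => hqi h,
      Finset.sum_mul]
    refine Finset.sum_congr rfl fun β _ => ?_
    rw [hPc, smul_mul_assoc]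
  have hex : ∃ j, ∃ hj : j < M + 1, P ⟨j, hj⟩ ≠ 0 := by
    by_contra! hc
    refine hne (funext fun i => ?_)
    rw [← hPc i.2 i.1, hc i.2 i.2.2, MvPolynomial.coeff_zero]
    rfl
  -- Independence of the residues gives every nonzero `P j` a homogenization of order exactly `d *
  -- (t * M)`. The factors `z ^ j` separate these orders, so the smallest `j` with `P j ≠ 0`
  -- determines the order of the sum, which is too small.
  obtain ⟨hj₀, hPj₀⟩ := Nat.find_spec hex
  set j₀ : Fin (M + 1) := ⟨Nat.find hex, hj₀⟩ with hj₀'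
  have hlt : ∀ j, j < j₀ → P j = 0 := by
    intro j hj
    by_contra hc
    exact Nat.find_min hex hj ⟨j.2, hc⟩
  set L := d * (t * M) + j₀ * e with hL
  have hordj : ∀ j : Fin (M + 1), ((d * (t * M) + j * e : ℕ) : ℕ∞) ≤
      (φ (homEval (P j) (t * M) a b * z ^ (j : ℕ))).order := by
    intro j
    rw [map_mul, map_pow, order_mul, order_pow_eq hz, mul_comm (j : ℕ) e, Nat.cast_add]
    exact add_le_add_left (le_order_homEval hb hx (hPd j)) _
  have h1 : ((L + 1 : ℕ) : ℕ∞) ≤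
      (φ (∑ j ∈ Finset.univ.erase j₀, homEval (P j) (t * M) a b * z ^ (j : ℕ))).order := by
    rw [map_sum]
    refine le_order_sum _ _ _ fun j hj => ?_
    rcases lt_trichotomy j j₀ with hlj | rfl | hlj
    · rw [hlt j hlj]
      simp [homEval]
    · simp at hj
    · refine le_trans ?_ (hordj j)
      have h2 : (j₀ : ℕ) + 1 ≤ j := hlj
      have h3 : (j₀ + 1) * e ≤ (j : ℕ) * e := Nat.mul_le_mul_right _ h2
      rw [add_mul] at h3
      exact_mod_cast (by omega : L + 1 ≤ d * (t * M) + j * e)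
  have h2 : ((L + 1 : ℕ) : ℕ∞) ≤ (φ (homEval (P j₀) (t * M) a b * z ^ (j₀ : ℕ))).order := by
    rw [hsum, ← Finset.add_sum_erase _ _ (Finset.mem_univ j₀), map_add] at hw
    have h3 : ((L + 1 : ℕ) : ℕ∞) ≤ ((d * (t * M) + M * e + 1 : ℕ) : ℕ∞) := by
      have : (j₀ : ℕ) * e ≤ M * e := Nat.mul_le_mul_right _ (Nat.lt_succ_iff.mp j₀.2)
      exact_mod_cast (by omega : L + 1 ≤ d * (t * M) + M * e + 1)
    exact (mem_orderKernel (φ := φ)).mp <| by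
      have h4 := (orderKernel φ (L + 1)).sub_mem
        (x := homEval (P j₀) (t * M) a b * z ^ (j₀ : ℕ) +
          ∑ j ∈ Finset.univ.erase j₀, homEval (P j) (t * M) a b * z ^ (j : ℕ))
        (mem_orderKernel.mpr (by rw [map_add]; exact h3.trans hw)) (mem_orderKernel.mpr h1)
      rwa [add_sub_cancel_right] at h4
  have h3 : ¬ ((d * (t * M) : ℕ) : ℕ∞) < (φ (homEval (P j₀) (t * M) a b)).order := by
    rw [← aeval_residue_eq_zero_iff hb hx (hPd j₀)]
    intro h0
    exact hPj₀ (hind (by rw [h0, map_zero]))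
  rw [map_mul, map_pow, order_mul, order_pow_eq hz] at h2
  have h4 := h2.trans (add_le_add_left (not_lt.mp h3) _)
  have h5 : L + 1 ≤ d * (t * M) + e * j₀ := by exact_mod_cast h4
  rw [hL, mul_comm (j₀ : ℕ) e] at h5
  omega

theorem exists_order_eq {f : PS k m} (hf : f ≠ 0) : ∃ d : ℕ, f.order = d := by
  have hf' : f.order ≠ ⊤ := by simpa using hf
  obtain ⟨d, hd⟩ := ENat.ne_top_iff_exists.mp hf'
  exact ⟨d, hd.symm⟩

/-- The `t` residues and the value of `z` contribute `t + 1` independent directions of growth. -/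
theorem Growth.succ_le {r t : ℕ} (hG : Growth φ r) {z : PS k n} (hz0 : constantCoeff z = 0)
    (hz : φ z ≠ 0) {y : Fin t → ValuationResidueField φ} (hy : AlgebraicIndependent k y) :
    t + 1 ≤ r := by
  obtain ⟨e, he⟩ := exists_order_eq hz
  have he0 : 0 < e := by
    rcases Nat.eq_zero_or_pos e with rfl | h
    · have h1 : constantCoeff (φ z) ≠ 0 := by
        intro h0
        have h2 : (1 : ℕ∞) ≤ (φ z).order := one_le_order_iff_constCoeff_eq_zero.mpr h0
        rw [he] at h2
        exact absurd h2 (by simp)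
      rw [constantCoeff_algHom] at h1
      exact absurd hz0 h1
    · exact h
  choose x hx using fun i => IsLocalRing.residue_surjective (y i)
  obtain ⟨a, b, hb, hab⟩ := exists_toFrac_eq_mul φ fun i => (x i : FractionRing (Coimage φ))
  obtain ⟨d, hd⟩ := exists_order_eq hb
  have hind : AlgebraicIndependent k
      (fun i => (IsLocalRing.residue _ (x i) : ValuationResidueField φ)) := by
    simp_rw [hx]
    exact hy
  obtain ⟨-, c, hc⟩ := hG
  refine le_of_forall_pow_le (C := c * (d * t + e + 2) ^ r) fun M => ?_
  refine (pow_le_hilbertFunction_of_residue hd hab he he0 hind M).trans ((hc _).trans ?_)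
  rw [mul_assoc, ← mul_pow]
  refine Nat.mul_le_mul_left _ (Nat.pow_le_pow_left ?_ _)
  nlinarith

end UpperBound

/-! ### Leading forms of the image and their graded algebra -/

section LeadingPart

variable {k : Type*} [Field k] {n m : ℕ}

/-- The homogeneous component of degree `j`, as a polynomial. -/
noncomputable def leadingPart (j : ℕ) : PS k m →ₗ[k] MvPolynomial (Fin m) k :=
  (truncTotal (j + 1)).comp (homogeneousComponent j)

theorem coe_leadingPart (j : ℕ) (f : PS k m) :
    (leadingPart j f : PS k m) = homogeneousComponent j f := by
  ext d
  rw [MvPolynomial.coeff_coe, leadingPart, LinearMap.comp_apply, coeff_truncTotal_eq_ite]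
  split_ifs with h
  · rfl
  · rw [coeff_homogeneousComponent, if_neg (by omega)]

theorem leadingPart_mul {i j : ℕ} {f g : PS k m} (hf : (i : ℕ∞) ≤ f.order)
    (hg : (j : ℕ∞) ≤ g.order) :
    leadingPart (i + j) (f * g) = leadingPart i f * leadingPart j g := by
  refine MvPolynomial.coe_injective _ _ ?_
  rw [MvPolynomial.coe_mul, coe_leadingPart, coe_leadingPart, coe_leadingPart,
    homogeneousComponent_mul_of_le_order hf hg]

theorem leadingPart_one : leadingPart 0 (1 : PS k m) = 1 := by
  refine MvPolynomial.coe_injective _ _ ?_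
  rw [coe_leadingPart, MvPolynomial.coe_one]
  ext d
  rw [coeff_homogeneousComponent, coeff_one]
  by_cases hd : d = 0
  · simp [hd]
  · simp [hd]

theorem mul_le_order_pow {i : ℕ} {f : PS k m} (hf : (i : ℕ∞) ≤ f.order) (M : ℕ) :
    ((i * M : ℕ) : ℕ∞) ≤ (f ^ M).order := by
  induction M with
  | zero => simp
  | succ M ih =>
    rw [pow_succ, order_mul, mul_add, mul_one, Nat.cast_add]
    exact add_le_add ih hf

theorem leadingPart_pow {i : ℕ} {f : PS k m} (hf : (i : ℕ∞) ≤ f.order) (M : ℕ) :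
    leadingPart (i * M) (f ^ M) = leadingPart i f ^ M := by
  induction M with
  | zero => simp [leadingPart_one]
  | succ M ih => rw [pow_succ, mul_add, mul_one, leadingPart_mul (mul_le_order_pow hf M) hf, ih,
      pow_succ]

theorem le_order_prod_pow {ι : Type*} (S : Finset ι) {i : ℕ} {f : ι → PS k m}
    (hf : ∀ l, (i : ℕ∞) ≤ (f l).order) (M : ι → ℕ) :
    ((i * ∑ l ∈ S, M l : ℕ) : ℕ∞) ≤ (∏ l ∈ S, f l ^ M l).order := by
  classical
  induction S using Finset.induction_on with
  | empty => simp
  | insert l S hl ih =>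
    rw [Finset.prod_insert hl, Finset.sum_insert hl, mul_add, Nat.cast_add, order_mul]
    exact add_le_add (mul_le_order_pow (hf l) _) ih

theorem leadingPart_prod_pow {ι : Type*} (S : Finset ι) {i : ℕ} {f : ι → PS k m}
    (hf : ∀ l, (i : ℕ∞) ≤ (f l).order) (M : ι → ℕ) :
    leadingPart (i * ∑ l ∈ S, M l) (∏ l ∈ S, f l ^ M l) = ∏ l ∈ S, leadingPart i (f l) ^ M l := by
  classical
  induction S using Finset.induction_on with
  | empty => simp [leadingPart_one]
  | insert l S hl ih =>
    rw [Finset.prod_insert hl, Finset.sum_insert hl, mul_add,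
      leadingPart_mul (mul_le_order_pow (hf l) _) (le_order_prod_pow S hf M), ih,
      Finset.prod_insert hl, leadingPart_pow (hf l)]

theorem leadingPart_homEval {t i : ℕ} {P : MvPolynomial (Fin t) k} {M : ℕ}
    (hM : P.totalDegree ≤ M) {f : Fin t → PS k m} {g : PS k m}
    (hf : ∀ l, (i : ℕ∞) ≤ (f l).order) (hg : (i : ℕ∞) ≤ g.order) :
    leadingPart (i * M) (homEval P M f g) =
      homEval P M (fun l => leadingPart i (f l)) (leadingPart i g) := by
  rw [homEval, map_sum, homEval]
  refine Finset.sum_congr rfl fun β hβ => ?_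
  have h1 : β.degree ≤ M := (MvPolynomial.le_totalDegree hβ).trans hM
  have h2 : i * M = i * ∑ l, β l + i * (M - β.degree) := by
    rw [← mul_add, ← Finsupp.degree_eq_sum, Nat.add_sub_cancel' h1]
  rw [map_smul, h2, leadingPart_mul (le_order_prod_pow _ hf _) (mul_le_order_pow hg _),
    leadingPart_prod_pow _ hf, leadingPart_pow hg]

theorem leadingPart_eq_zero {j : ℕ} {f : PS k m} (hf : (j : ℕ∞) < f.order) :
    leadingPart j f = 0 := by
  refine MvPolynomial.coe_injective _ _ ?_
  rw [coe_leadingPart, homogeneousComponent_of_lt_order_eq_zero hf, MvPolynomial.coe_zero]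

theorem leadingPart_ne_zero {j : ℕ} {f : PS k m} (hf : f.order = j) : leadingPart j f ≠ 0 := by
  intro h
  refine homogeneousComponent_of_order hf.symm ?_
  rw [← coe_leadingPart, h, MvPolynomial.coe_zero]

theorem leadingPart_monomial (e : Fin m →₀ ℕ) :
    leadingPart e.degree (monomial e (1 : k)) = MvPolynomial.monomial e 1 := by
  classical
  refine MvPolynomial.coe_injective _ _ ?_
  rw [coe_leadingPart, MvPolynomial.coe_monomial]
  ext d
  rw [coeff_homogeneousComponent, coeff_monomial]
  by_cases h : d = e
  · simp [h]
  · simp [h]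

/-- The homogeneous components of lowest degree of the elements of the image. -/
def leadingParts (φ : PS k n →ₐ[k] PS k m) : Set (MvPolynomial (Fin m) k) :=
  {P | ∃ f j, ((j : ℕ) : ℕ∞) ≤ (φ f).order ∧ leadingPart j (φ f) = P}

/-- Comparison of the growth of the graded algebra of the image with the dimension of the target,
over the subalgebra generated by the leading parts. -/
theorem hilbertFunction_mul_pow_le (φ : PS k n →ₐ[k] PS k m) {q : ℕ} {e : Fin q → Fin m}
    (he : AlgebraicIndependent (Algebra.adjoin k (leadingParts φ))
      fun i => (MvPolynomial.X (e i) : MvPolynomial (Fin m) k)) (N M : ℕ) :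
    hilbertFunction φ N * M ^ q ≤ (N + q * M) ^ m := by
  classical
  set S := Algebra.adjoin k (leadingParts φ) with hS
  obtain ⟨c, hc⟩ : ∃ c : Fin (hilbertFunction φ N) → PS k n,
      ∀ w : Fin (hilbertFunction φ N) → k, (N : ℕ∞) ≤ (φ (∑ i, w i • c i)).order → w = 0 := by
    set B := Module.finBasis k (PS k n ⧸ orderKernel φ N) with hB
    choose c hc using fun i => (orderKernel φ N).mkQ_surjective (B i)
    refine ⟨c, fun w hw => ?_⟩
    have h1 := B.linearIndependent
    rw [Fintype.linearIndependent_iff] at h1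
    refine funext (h1 w ?_)
    have h2 : (orderKernel φ N).mkQ (∑ i, w i • c i) = 0 := by
      rw [Submodule.mkQ_apply, Submodule.Quotient.mk_eq_zero]
      exact hw
    rw [map_sum] at h2
    rw [← h2]
    refine Finset.sum_congr rfl fun i _ => ?_
    rw [map_smul, hc]
  set g : (Fin q → Fin M) → (Fin m →₀ ℕ) := fun γ =>
    ∑ i, Finsupp.single (e i) (γ i : ℕ) with hg
  have hgd : ∀ γ, (g γ).degree ≤ q * M := by
    intro γ
    rw [hg, map_sum]
    simp only [Finsupp.degree_single]
    calc ∑ i, (γ i : ℕ) ≤ ∑ _i : Fin q, M := Finset.sum_le_sum fun i _ => (γ i).2.le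
      _ = q * M := by simp
  -- Products of a basis modulo order `N` with monomials in the `q` independent variables are
  -- independent modulo order `N + q * M` in the target, where there is room for at most `(N + q *
  -- M) ^ m` of them.
  have h := card_le_hilbertFunction (AlgHom.id k (PS k m)) (N := N + q * M)
    (fun i : Fin (hilbertFunction φ N) × (Fin q → Fin M) => φ (c i.1) * monomial (g i.2) 1)
    (fun w hw => ?_)
  · refine le_trans ?_ (h.trans (hilbertFunction_le_pow le_rfl (fun i hi => ?_) _))
    · simp
    · exact absurd i.2 (by omega)
  by_contra hne
  rw [AlgHom.id_apply, Fintype.sum_prod_type_right] at hw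
  set f : (Fin q → Fin M) → PS k n := fun γ => ∑ i, w (i, γ) • c i with hf
  have hsum : ∑ γ, ∑ i, w (i, γ) • (φ (c i) * monomial (g γ) 1) =
      ∑ γ, φ (f γ) * monomial (g γ) 1 := by
    refine Finset.sum_congr rfl fun γ _ => ?_
    rw [hf, map_sum, Finset.sum_mul]
    refine Finset.sum_congr rfl fun i _ => ?_
    rw [map_smul, smul_mul_assoc]
  rw [hsum] at hw
  obtain ⟨γ₁, j₁, hj₁, hj₁N⟩ : ∃ γ, ∃ j : ℕ, (φ (f γ)).order = j ∧ j < N := by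
    obtain ⟨⟨i, γ⟩, hi⟩ : ∃ i, w i ≠ 0 := by
      by_contra! h0
      exact hne (funext h0)
    have h1 : ¬ (N : ℕ∞) ≤ (φ (f γ)).order := fun h0 =>
      hi (congrFun (hc (fun i => w (i, γ)) h0) i)
    have h2 := not_le.mp h1
    obtain ⟨j, hj⟩ := ENat.ne_top_iff_exists.mp h2.ne_top
    rw [← hj] at h2
    exact ⟨γ, j, hj.symm, by exact_mod_cast h2⟩
  have hex : ∃ D γ, ∃ j : ℕ, (φ (f γ)).order = j ∧ j + (g γ).degree = D := ⟨_, γ₁, j₁, hj₁, rfl⟩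
  -- The lowest total degree of a summand. The parts of degree `D` give a relation with coefficients
  -- in `S` between distinct monomials; summands of higher degree enter with coefficient zero.
  set D := Nat.find hex with hD
  obtain ⟨γ₀, j₀, hj₀, hD₀⟩ := Nat.find_spec hex
  rw [← hD] at hD₀
  have hDlt : D < N + q * M := by
    have h1 : D ≤ j₁ + (g γ₁).degree := Nat.find_min' hex ⟨γ₁, j₁, hj₁, rfl⟩
    have h2 := hgd γ₁
    omega
  have hle : ∀ γ, (D : ℕ∞) ≤ (φ (f γ)).order + ((g γ).degree : ℕ) := by
    intro γ
    by_cases hγ : φ (f γ) = 0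
    · rw [hγ, order_zero, top_add]
      exact le_top
    · obtain ⟨j, hj⟩ := exists_order_eq hγ
      rw [hj]
      exact_mod_cast Nat.find_min' hex ⟨γ, j, hj, rfl⟩
  set v : (Fin q → Fin M) → MvPolynomial (Fin m) k := fun γ =>
    if (g γ).degree ≤ D then leadingPart (D - (g γ).degree) (φ (f γ)) else 0 with hv
  have hle' : ∀ γ, (g γ).degree ≤ D → ((D - (g γ).degree : ℕ) : ℕ∞) ≤ (φ (f γ)).order := by
    intro γ hγ
    have h1 := hle γ
    by_cases h0 : φ (f γ) = 0
    · rw [h0, order_zero]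
      exact le_top
    · obtain ⟨j, hj⟩ := exists_order_eq h0
      rw [hj] at h1 ⊢
      have h2 : D ≤ j + (g γ).degree := by exact_mod_cast h1
      exact_mod_cast (by omega : D - (g γ).degree ≤ j)
  have hvS : ∀ γ, v γ ∈ S := by
    intro γ
    simp only [hv]
    split_ifs with hγ
    · exact Algebra.subset_adjoin ⟨_, _, hle' γ hγ, rfl⟩
    · exact S.zero_mem
  have hordmon : ∀ γ, (((g γ).degree : ℕ) : ℕ∞) ≤ (monomial (g γ) (1 : k)).order :=
    fun γ => (order_monomial_of_ne_zero one_ne_zero).ge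
  have hlead : ∀ γ, leadingPart D (φ (f γ) * monomial (g γ) 1) =
      v γ * MvPolynomial.monomial (g γ) 1 := by
    intro γ
    simp only [hv]
    split_ifs with hγ
    · rw [← leadingPart_monomial, ← leadingPart_mul (hle' γ hγ) (hordmon γ),
        Nat.sub_add_cancel hγ]
    · rw [zero_mul, leadingPart_eq_zero]
      rw [order_mul]
      refine lt_of_lt_of_le ?_ ((hordmon γ).trans le_add_self)
      exact_mod_cast not_le.mp hγ
  have hzero : ∑ γ, v γ * MvPolynomial.monomial (g γ) 1 = 0 := by
    have h1 : leadingPart D (∑ γ, φ (f γ) * monomial (g γ) 1) = 0 :=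
      leadingPart_eq_zero (lt_of_lt_of_le (by exact_mod_cast hDlt) hw)
    rw [map_sum] at h1
    rw [← h1]
    exact Finset.sum_congr rfl fun γ _ => (hlead γ).symm
  set E : (Fin q → Fin M) → (Fin q →₀ ℕ) := fun γ =>
    Finsupp.equivFunOnFinite.symm fun i => (γ i : ℕ) with hE
  have hEi : Function.Injective E := by
    intro γ γ' h
    funext i
    exact Fin.ext (DFunLike.congr_fun h i)
  set Q : MvPolynomial (Fin q) S := ∑ γ, MvPolynomial.monomial (E γ) ⟨v γ, hvS γ⟩ with hQ
  have hQ0 : MvPolynomial.aeval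
      (fun i => (MvPolynomial.X (e i) : MvPolynomial (Fin m) k)) Q = 0 := by
    rw [← hzero, hQ, map_sum]
    refine Finset.sum_congr rfl fun γ _ => ?_
    rw [MvPolynomial.aeval_monomial, Finsupp.prod_fintype _ _ (by simp)]
    have h1 : (MvPolynomial.monomial (g γ) (1 : k)) =
        ∏ i, (MvPolynomial.X (e i) : MvPolynomial (Fin m) k) ^ (E γ i) := by
      rw [hg, MvPolynomial.monomial_sum_one]
      exact Finset.prod_congr rfl fun i _ => MvPolynomial.X_pow_eq_monomial.symm
    rw [h1]
    rfl
  have hQ' : Q = 0 := he (by rw [hQ0, map_zero])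
  have hv₀ : v γ₀ = 0 := by
    have h1 : Q.coeff (E γ₀) = ⟨v γ₀, hvS γ₀⟩ := by
      rw [hQ, MvPolynomial.coeff_sum, Finset.sum_eq_single γ₀]
      · simp
      · intro γ _ hγ
        rw [MvPolynomial.coeff_monomial, if_neg fun h => hγ (hEi h)]
      · simp
    rw [hQ', MvPolynomial.coeff_zero] at h1
    exact (congrArg Subtype.val h1).symm
  simp only [hv] at hv₀
  rw [if_pos (by omega), ← hD₀, Nat.add_sub_cancel] at hv₀
  exact leadingPart_ne_zero hj₀ hv₀

end LeadingPart

open Cardinal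

/-! ### From growth to algebraically independent residues -/

section LowerBound

variable {k : Type*} [Field k] {n m : ℕ} {φ : PS k n →ₐ[k] PS k m}

theorem le_of_forall_pos_pow_le {a b C : ℕ} (h : ∀ M : ℕ, 0 < M → M ^ a ≤ C * M ^ b) : a ≤ b :=
  le_of_forall_pow_le fun M => h (M + 1) M.succ_pos

theorem isAlgebraic_of_surjective {R A : Type*} [CommRing R] [CommRing A] [Nontrivial R]
    [Algebra R A] (h : Function.Surjective (algebraMap R A)) : Algebra.IsAlgebraic R A :=
  ⟨fun x => by
    obtain ⟨y, rfl⟩ := h x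
    exact isAlgebraic_algebraMap y⟩

theorem isAlgebraic_adjoin_of_adjoin_eq_top {R A : Type*} [CommRing R] [CommRing A] [Nontrivial A]
    [Algebra R A] (S : Subalgebra R A) {s : Set A} (h : Algebra.adjoin R s = ⊤) :
    Algebra.IsAlgebraic (Algebra.adjoin S s) A := by
  have htop : Algebra.adjoin S s = ⊤ := by
    rw [eq_top_iff]
    intro x _
    have h1 : x ∈ Algebra.adjoin R s := by
      rw [h]
      exact Algebra.mem_top
    refine Algebra.adjoin_induction (p := fun y _ => y ∈ Algebra.adjoin S s) ?_ ?_ ?_ ?_ h1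
    · exact fun y hy => Algebra.subset_adjoin hy
    · exact fun c => (Algebra.adjoin S s).algebraMap_mem (algebraMap R S c)
    · exact fun y z _ _ => add_mem
    · exact fun y z _ _ => mul_mem
  rw [htop]
  exact isAlgebraic_of_surjective fun x => ⟨⟨x, Algebra.mem_top⟩, rfl⟩

theorem exists_isTranscendenceBasis_adjoin (R : Type*) {A : Type*} [Field R] [CommRing A]
    [IsDomain A] [Algebra R A] (s : Set A) :
    ∃ T : Set (Algebra.adjoin R s), (∀ x ∈ T, (x : A) ∈ s) ∧
      IsTranscendenceBasis R ((↑) : T → Algebra.adjoin R s) := by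
  have halg : Algebra.IsAlgebraic
      (Algebra.adjoin R ((↑) ⁻¹' s : Set (Algebra.adjoin R s))) (Algebra.adjoin R s) := by
    refine isAlgebraic_of_surjective fun x => ?_
    have h1 : x ∈ Algebra.adjoin R ((↑) ⁻¹' s : Set (Algebra.adjoin R s)) := by
      rw [Algebra.adjoin_adjoin_coe_preimage]
      trivial
    exact ⟨⟨x, h1⟩, rfl⟩
  obtain ⟨T, hTs, hT⟩ := exists_isTranscendenceBasis_subset (R := R)
    ((↑) ⁻¹' s : Set (Algebra.adjoin R s))
  exact ⟨T, fun x hx => hTs hx, hT⟩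

/-- There are `r` algebraically independent leading parts. -/
theorem Growth.exists_leadingParts {r : ℕ} (hG : Growth φ r) :
    ∃ h : Fin r → MvPolynomial (Fin m) k, AlgebraicIndependent k h ∧
      ∀ i, h i ∈ leadingParts φ := by
  classical
  set S := Algebra.adjoin k (leadingParts φ) with hS
  have halg := isAlgebraic_adjoin_of_adjoin_eq_top S
    (MvPolynomial.adjoin_range_X (R := k) (σ := Fin m))
  obtain ⟨J, hJX, hJ⟩ := exists_isTranscendenceBasis_subset (R := S)
    (Set.range (MvPolynomial.X : Fin m → MvPolynomial (Fin m) k))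
  have hJfin : J.Finite := (Set.finite_range _).subset hJX
  have : Fintype J := hJfin.fintype
  set q := Fintype.card J with hq
  let ε : Fin q ≃ J := (Fintype.equivFin J).symm
  choose e he using fun i : Fin q => hJX (ε i).2
  have hind : AlgebraicIndependent S fun i => (MvPolynomial.X (e i) : MvPolynomial (Fin m) k) := by
    simp_rw [he]
    exact hJ.1.comp ε ε.injective
  -- The `q` variables form a transcendence basis over `S`. Comparing exponents in
  -- `hilbertFunction_mul_pow_le` gives `r + q ≤ m`, while `q` and the transcendence degree of `S`
  -- add up to `m`; so the latter is at least `r`.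
  have hrq : r + q ≤ m := by
    obtain ⟨⟨c, hc⟩, -⟩ := hG
    refine le_of_forall_pos_pow_le (C := c * (c + q) ^ m) fun M hM => ?_
    calc M ^ (r + q) = M ^ r * M ^ q := pow_add _ _ _
      _ ≤ c * hilbertFunction φ (c * M) * M ^ q := Nat.mul_le_mul_right _ (hc M hM)
      _ = c * (hilbertFunction φ (c * M) * M ^ q) := mul_assoc _ _ _
      _ ≤ c * (c * M + q * M) ^ m := Nat.mul_le_mul_left _ (hilbertFunction_mul_pow_le φ hind _ _)
      _ = c * (c + q) ^ m * M ^ m := by rw [← add_mul, mul_pow, mul_assoc]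
  have htr : Algebra.trdeg k S + q = m := by
    have h1 := trdeg_add_eq k S (A := MvPolynomial (Fin m) k)
    rw [← hJ.cardinalMk_eq_trdeg, MvPolynomial.trdeg_of_isDomain] at h1
    simpa [hq] using h1
  obtain ⟨T, hTs, hT⟩ := exists_isTranscendenceBasis_adjoin k (leadingParts φ)
  rw [← hT.cardinalMk_eq_trdeg] at htr
  have hrT : (r : Cardinal) ≤ #T := by
    by_contra hc
    have h1 := not_le.mp hc
    obtain ⟨a, ha⟩ := Cardinal.lt_aleph0.mp (h1.trans (Cardinal.natCast_lt_aleph0))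
    rw [ha] at htr h1
    have h2 : a + q = m := by exact_mod_cast htr
    have h3 : a < r := by exact_mod_cast h1
    omega
  obtain ⟨g⟩ : Nonempty (Fin r ↪ T) := by
    rw [← Cardinal.lift_mk_le']
    simpa using hrT
  refine ⟨fun i => ((g i : S) : MvPolynomial (Fin m) k), ?_, fun i => hTs _ (g i).2⟩
  exact (hT.1.comp g g.injective).map' (f := S.val) Subtype.val_injective

theorem leadingPart_zero_eq_C (f : PS k m) :
    leadingPart 0 f = MvPolynomial.C (constantCoeff f) := by
  classical
  refine MvPolynomial.coe_injective _ _ ?_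
  rw [coe_leadingPart, MvPolynomial.coe_C]
  ext d
  rw [coeff_homogeneousComponent, coeff_C]
  by_cases hd : d = 0
  · simp [hd]
  · have : d.degree ≠ 0 := fun h => hd ((Finsupp.degree_eq_zero_iff d).mp h)
    simp [hd, this]

theorem not_transcendental_leadingPart_zero (f : PS k m) :
    ¬ Transcendental k (leadingPart 0 f) := by
  rw [leadingPart_zero_eq_C]
  exact fun h => h (isAlgebraic_algebraMap (R := k) (A := MvPolynomial (Fin m) k) _)

/-- There are `r` power series whose images have the same order and algebraically independent
leading parts. -/
theorem Growth.exists_leadingPart_eq {r : ℕ} (hG : Growth φ r) :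
    ∃ (a : Fin r → PS k n) (d : ℕ), (∀ i, (φ (a i)).order = d) ∧
      AlgebraicIndependent k fun i => leadingPart d (φ (a i)) := by
  obtain ⟨h, hind, hh⟩ := hG.exists_leadingParts
  choose a j hj hja using hh
  have hj0 : ∀ i, 0 < j i := by
    intro i
    by_contra hc
    have h0 : j i = 0 := by omega
    have htr := hind.transcendental i
    rw [← hja i, h0] at htr
    exact not_transcendental_leadingPart_zero _ htr
  -- A common multiple of the degrees, which are positive since forms of degree zero are constants.
  -- Raising to powers equalizes the degrees and preserves algebraic independence.
  set d := ∏ i, j i with hd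
  have hdvd : ∀ i, j i * (d / j i) = d := fun i =>
    Nat.mul_div_cancel' (Finset.dvd_prod_of_mem _ (Finset.mem_univ i))
  have hpos : ∀ i, 0 < d / j i := fun i =>
    Nat.div_pos (Nat.le_of_dvd (Finset.prod_pos fun i _ => hj0 i)
      (Finset.dvd_prod_of_mem _ (Finset.mem_univ i))) (hj0 i)
  have hord : ∀ i, (φ (a i)).order = j i := by
    intro i
    refine le_antisymm (not_lt.mp fun hlt => ?_) (hj i)
    have h1 := leadingPart_eq_zero hlt
    rw [hja] at h1
    exact hind.ne_zero i h1
  refine ⟨fun i => a i ^ (d / j i), d, fun i => ?_, ?_⟩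
  · rw [map_pow, order_pow_eq (hord i), hdvd]
  · have h1 : ∀ i, leadingPart d (φ (a i ^ (d / j i))) = h i ^ (d / j i) := by
      intro i
      conv_lhs => rw [← hdvd i]
      rw [map_pow, hdvd, ← hja i, ← leadingPart_pow (hj i), hdvd]
    simp_rw [h1]
    have h2 := hind.polynomial_aeval_of_transcendental
      (f := fun i => (Polynomial.X : Polynomial k) ^ (d / j i))
      (fun i => (Polynomial.transcendental_X k).pow (hpos i))
    simpa using h2

/-- The residues are those of the quotients `a i / a 0` of elements of equal order. An algebraic
relation between them would, after homogenizing, be one between the leading forms. -/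
theorem Growth.exists_residue {r : ℕ} (hG : Growth φ (r + 1)) :
    ∃ y : Fin r → ValuationResidueField φ, AlgebraicIndependent k y := by
  obtain ⟨a, d, hd, hind⟩ := hG.exists_leadingPart_eq
  have hb : toFrac φ (a 0) ≠ 0 := toFrac_ne_zero φ (ne_zero_of_order_eq (hd 0))
  have hmem : ∀ i : Fin r, inducedValuation φ (toFrac φ (a i.succ) / toFrac φ (a 0)) ≤ 1 := by
    intro i
    rw [map_div₀, inducedValuation_toFrac, inducedValuation_toFrac]
    refine div_le_one_of_le₀ ?_ zero_le
    rw [orderValuation_le_iff (ne_zero_of_order_eq (hd 0)), hd, hd]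
  set x : Fin r → (inducedValuation φ).valuationSubring := fun i => ⟨_, hmem i⟩ with hx
  refine ⟨fun i => IsLocalRing.residue _ (x i), ?_⟩
  rw [algebraicIndependent_iff]
  intro P hP
  by_contra hne
  rw [aeval_residue_eq_zero_iff (a := fun i => a i.succ) (hd 0)
    (fun i => (div_mul_cancel₀ _ hb).symm) le_rfl] at hP
  have h1 := leadingPart_eq_zero hP
  rw [map_homEval, leadingPart_homEval le_rfl (fun i => (hd _).ge) (hd 0).ge] at h1
  exact homEval_ne_zero hind hne le_rfl h1

theorem Growth.geometricRank_eq {r : ℕ} (hG : Growth φ r) : geometricRank φ = r := by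
  classical
  rw [geometricRank]
  split_ifs with h
  · rcases r with _ | r
    · rfl
    · obtain ⟨a, d, hd, hind⟩ := hG.exists_leadingPart_eq
      set c := constantCoeff (a 0) with hc
      have hmem : a 0 - C c ∈ IsLocalRing.maximalIdeal (PS k n) := by
        rw [IsLocalRing.mem_maximalIdeal, mem_nonunits_iff, isUnit_iff_constantCoeff_ne_zero]
        simp [hc]
      have h1 : φ (a 0) = C c := by
        have h2 := h _ hmem
        rw [map_sub, sub_eq_zero] at h2
        rw [h2]
        exact φ.commutes c
      have h2 : (C c : PS k m).order = d := by rw [← h1, hd]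
      have hd0 : d = 0 := by
        have hc0 : c ≠ 0 := by
          rintro h0
          rw [h0, map_zero] at h2
          exact ne_zero_of_order_eq h2 rfl
        rw [← monomial_zero_eq_C_apply, order_monomial_of_ne_zero hc0] at h2
        simpa using h2.symm
      have htr := hind.transcendental 0
      rw [hd0] at htr
      exact absurd htr (not_transcendental_leadingPart_zero _)
  · push Not at h
    obtain ⟨z, hz, hφz⟩ := h
    have hz0 : constantCoeff z = 0 := by
      by_contra hc
      rw [IsLocalRing.mem_maximalIdeal] at hz
      exact hz (isUnit_iff_constantCoeff_ne_zero.mpr hc)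
    obtain ⟨T, hT⟩ := exists_isTranscendenceBasis k (ValuationResidueField φ)
    rw [← hT.cardinalMk_eq_trdeg]
    have hle : ∀ t : ℕ, (t : Cardinal) ≤ #T → t + 1 ≤ r := by
      intro t ht
      obtain ⟨g⟩ : Nonempty (Fin t ↪ T) := by
        rw [← Cardinal.lift_mk_le']
        simpa using ht
      exact hG.succ_le hz0 hφz (hT.1.comp g g.injective)
    -- The bound holds for every finite number of independent residues, so an infinite basis would
    -- give `r + 1 ≤ r`.
    have hfin : #T < ℵ₀ := by
      by_contra hc
      have := hle r (Cardinal.natCast_le_aleph0.trans (not_lt.mp hc))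
      omega
    obtain ⟨t, ht⟩ := Cardinal.lt_aleph0.mp hfin
    rw [ht, Cardinal.toNat_natCast]
    refine le_antisymm (hle t ht.ge) ?_
    rcases r with _ | r
    · omega
    · obtain ⟨y, hy⟩ := hG.exists_residue
      have h1 := hy.lift_cardinalMk_le_trdeg
      rw [← hT.cardinalMk_eq_trdeg, ht] at h1
      have h2 : r ≤ t := by simpa using h1
      omega

end LowerBound

end QuasiMonomial

theorem theorem4p3 {k : Type*} [Field k] (p : ℕ) [Fact p.Prime] [CharP k p] (n m : ℕ)
    (φ : MvPowerSeries (Fin n) k →ₐ[k] MvPowerSeries (Fin m) k) :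
    QuasiMonomial.geometricRank φ ≤ n ∧
    ∃ hm : QuasiMonomial.geometricRank φ ≤ m,
    ∃ φ' : MvPowerSeries (Fin n) k →ₐ[k] MvPowerSeries (Fin m) k,
      Relation.ReflTransGen QuasiMonomial.IsAdmissible φ φ' ∧
      ∃ (α : Fin n → ℕ) (u : Fin n → MvPowerSeries (Fin m) k),
        (∀ (i : Fin n) (hi : (i : ℕ) < QuasiMonomial.geometricRank φ),
          φ' (MvPowerSeries.X i) =
            MvPowerSeries.X (⟨(i : ℕ), lt_of_lt_of_le hi hm⟩ : Fin m) ^ p ^ α i * u i ∧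
          IsUnit (u i) ∧
          (α i = 0 → u i = 1) ∧
          (0 < α i → QuasiMonomial.initialForm (u i) = 1 ∧
            ¬ ∃ v : MvPowerSeries (Fin m) k, v ^ p = u i)) ∧
        ∀ i : Fin n, QuasiMonomial.geometricRank φ ≤ (i : ℕ) → φ' (MvPowerSeries.X i) = 0 := by
  have hp : p.Prime := Fact.out
  obtain ⟨r, hn, hm, φ', α, u, hr, hφ, hu, hu0, hu1, hz⟩ := QuasiMonomial.exists_normalForm hp φ
  -- The growth exponent of the normal form is carried back along the chain to `φ`; it identifies
  -- `r` with the geometric rank.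
  have hG := hr.growth (QuasiMonomial.growth_of_diag (fun i => pow_pos hp.pos (α i)) hu hφ hz)
  have hgr := hG.geometricRank_eq
  subst hgr
  refine ⟨hn, hm, φ', hr.isAdmissible, fun i => if h : (i : ℕ) < _ then α ⟨i, h⟩ else 0,
    fun i => if h : (i : ℕ) < _ then u ⟨i, h⟩ else 1, fun i hi => ?_, hz⟩
  simp only [dif_pos hi]
  exact ⟨hφ ⟨i, hi⟩, hu _, hu0 _, fun h =>
    ⟨QuasiMonomial.initialForm_eq_one (hu1 _ h).1, (hu1 _ h).2⟩⟩
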